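/- Let $n$ be an odd positive integer and let $C_n$ be the cyclic group of order $n$ with generator $t$. For $d\mid n$ let $\Theta_d=C_n/\langle t^d\rangle$, and let $\pi\colon\Theta_d\to\Theta_1$ be the projection. Let $\underline{\mathbb Z}$ be the constant Mackey functor for $C_n$ with value $\mathbb Z$ (restrictions are identities, transfers are multiplication by the index). A $\underline{\mathbb Z}$-module is a contravariant additive functor to abelian groups on the category $\mathcal B\mathbb Z$ whose objects are the orbits $\Theta_d$ and whose morphism groups are the groups of spans of finite $C_n$-sets modulo the relations $p_*p^*=\deg p$; equivalently, $\mathcal B\mathbb Z(\Theta_b,\Theta_c)=\operatorname{Hom}_{\mathbb Z[C_n]}(\mathbb Z\langle\Theta_b\rangle,\mathbb Z\langle\Theta_c\rangle)$. A $C_n$-map $f\colon\Theta_b\to\Theta_c$ gives morphisms $Rf\colon\Theta_b\to\Theta_c$ (inducing the restriction $f^*$) and $If\colon\Theta_c\to\Theta_b$ (inducing the transfer $f_*$). Let $F_d=\mathcal B\mathbb Z(-,\Theta_d)$ be the free $\underline{\mathbb Z}$-module on one generator in spot $\Theta_d$ (so $F_1\cong\underline{\mathbb Z}$), let $I_d\subseteq\underline{\mathbb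 Z}$ be the ideal generated by $1\in\underline{\mathbb Z}(\Theta_d)=\mathbb Z$, and let $\Box$ denote the box product (Day convolution) of $\underline{\mathbb Z}$-modules and of chain complexes of $\underline{\mathbb Z}$-modules. For $b\mid n$ let $S^{\lambda_b}$ be the chain complex $$0\to F_b\xrightarrow{\ \mathrm{id}-Rt\ }F_b\xrightarrow{\ R\pi\ }F_1\to 0$$ with $F_1$ in degree $0$. Let $a_b\in \underline H_0(S^{\lambda_b})(\Theta_1)$ be the class of the generator of $F_1$, and let $u_b\in\underline H_2(S^{\lambda_b})(\Theta_1)$ be the class of $I\pi\in F_b(\Theta_1)$. Let $b_1,\dots,b_s$ ($s\ge 0$) be divisors of $n$, and let $\underline H_k$ denote the $k$-th homology $\underline{\mathbb Z}$-module of $S^{\lambda_{b_1}}\Box\cdots\Box S^{\lambda_{b_s}}$ (which is $F_1$ in degree $0$ if $s=0$). For $1\le j\le s$ put $$(\underline b;j)=\gcd\{\operatorname{lcm}(b_{i_1},\dots,b_{i_j}) : 1\le i_1<\cdots<i_j\le s\}.$$ Then: 1. $\underline H_k=0$ if $k$ is odd or $k>2s$; 2. $\underline H_{2s}\cong\underline{\mathbb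 Z}$; 3. $\underline H_{2i}\cong\underline{\mathbb Z}/I_{(\underline b;i+1)}$ for $0\le i<s$; 4. for every $k$ the $\underline{\mathbb Z}$-module $\underline H_k$ is generated by the $au$-classes in $\underline H_k(\Theta_1)$, that is, by the products $x_1\cdots x_s$ of total degree $k$ in which each $x_i$ is $a_{b_i}$ or $u_{b_i}$: no proper submodule of $\underline H_k$ contains all of them. -/

import Mathlib

open CategoryTheory CategoryTheory.Limits Opposite
open scoped ZeroObject

noncomputable section

namespace CyclicMackey

/-! ## The category `BZ`

Throughout, `C_n` is the cyclic group of order `n` with generator `t`. -/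

/-- A transitive `C_n`-set `Θ_d = C_n/⟨t^d⟩`, for `d` a positive divisor of `n`.
Its underlying set is `ZMod d`, on which the generator `t` acts by `x ↦ x + 1`. -/
structure Orbit (n : ℕ) where
  /-- the number of elements -/
  size : ℕ
  dvd : size ∣ n
  pos : 0 < size

variable {n : ℕ}

instance (b : Orbit n) : NeZero b.size := ⟨b.pos.ne'⟩

/-- The one-point orbit `Θ_1`. -/
def Orbit.one (n : ℕ) : Orbit n := ⟨1, one_dvd n, one_pos⟩

/-- The orbit `Θ_d` of a divisor `d` of an odd number. -/
def Orbit.ofDvd (hn : Odd n) {d : ℕ} (h : d ∣ n) : Orbit n :=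
  ⟨d, h, Nat.pos_of_dvd_of_pos h hn.pos⟩

/-- `BZ(Θ_b, Θ_c)`: the quotient of the group of spans `Θ_c ← S → Θ_b` of finite `C_n`-sets by the
relations `p_* p^* = (degree of p)`. A span is determined modulo these relations by the number
of points of `S` above each `(x, y)`, so that this is the group of `C_n`-invariant
integer matrices, that is, of `ℤ[C_n]`-linear maps `ℤ⟨Θ_b⟩ → ℤ⟨Θ_c⟩`. -/
def orbitHom (b c : Orbit n) : AddSubgroup (ZMod b.size → ZMod c.size → ℤ) where
  carrier := {A | ∀ x y, A (x + 1) (y + 1) = A x y}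
  zero_mem' _ _ := rfl
  add_mem' hA hB x y := by simp only [Pi.add_apply, hA x y, hB x y]
  neg_mem' hA x y := by simp only [Pi.neg_apply, hA x y]

/-- Composition in `BZ`: multiplication of matrices (composition of spans by pullback). -/
def orbitComp {b c d : Orbit n} (A : orbitHom b c) (B : orbitHom c d) : orbitHom b d :=
  ⟨fun x z => ∑ y, A.1 x y * B.1 y z, fun x z => by
    change ∑ y, A.1 (x + 1) y * B.1 y (z + 1) = ∑ y, A.1 x y * B.1 y z
    rw [← Equiv.sum_comp (Equiv.addRight (1 : ZMod c.size))]
    exact Finset.sum_congr rfl fun y _ => by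
      rw [Equiv.coe_addRight, A.2 x y, B.2 y z]⟩

instance : Category (Orbit n) where
  Hom b c := orbitHom b c
  id b := ⟨fun x y => if x = y then 1 else 0, fun x y => by simp⟩
  comp A B := orbitComp A B
  id_comp A := Subtype.ext <| by
    funext x z
    simp [orbitComp]
  comp_id A := Subtype.ext <| by
    funext x z
    simp [orbitComp]
  assoc A B C := Subtype.ext <| by
    funext x w
    simp only [orbitComp, Finset.sum_mul, Finset.mul_sum]
    rw [Finset.sum_comm]
    simp only [mul_assoc]

instance : Preadditive (Orbit n) where
  homGroup b c := inferInstanceAs (AddCommGroup (orbitHom b c))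
  add_comp _ _ _ A A' B := Subtype.ext <| by
    funext x z
    change ∑ y, (A.1 x y + A'.1 x y) * B.1 y z = (∑ y, A.1 x y * B.1 y z) + ∑ y, A'.1 x y * B.1 y z
    simp only [add_mul, Finset.sum_add_distrib]
  comp_add _ _ _ A B B' := Subtype.ext <| by
    funext x z
    change ∑ y, A.1 x y * (B.1 y z + B'.1 y z) = (∑ y, A.1 x y * B.1 y z) + ∑ y, A.1 x y * B'.1 y z
    simp only [mul_add, Finset.sum_add_distrib]

/-- The morphism `Rf : Θ_b → Θ_c` of `BZ` given by a `C_n`-map `f : Θ_b → Θ_c`. -/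
def R {b c : Orbit n} (f : ZMod b.size → ZMod c.size) (hf : ∀ x, f (x + 1) = f x + 1) : b ⟶ c :=
  (⟨fun x y => if f x = y then 1 else 0, fun x y => by simp [hf]⟩ : orbitHom b c)

/-- The morphism `If : Θ_c → Θ_b` of `BZ` given by a `C_n`-map `f : Θ_b → Θ_c`. -/
def I {b c : Orbit n} (f : ZMod b.size → ZMod c.size) (hf : ∀ x, f (x + 1) = f x + 1) : c ⟶ b :=
  (⟨fun y x => if f x = y then 1 else 0, fun y x => by simp [hf]⟩ : orbitHom c b)

/-- `Rt`, for the action map `t : Θ_b → Θ_b`. -/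
def Rt (b : Orbit n) : b ⟶ b := R (fun x => x + 1) fun _ => rfl

instance : Subsingleton (ZMod (Orbit.one n).size) := inferInstanceAs (Subsingleton (ZMod 1))

/-- `Rπ`, for the projection `π : Θ_b → Θ_1`. -/
def Rpi (b : Orbit n) : b ⟶ Orbit.one n := R (fun _ => 0) fun _ => Subsingleton.elim _ _

/-- `Iπ`, for the projection `π : Θ_b → Θ_1`. -/
def Ipi (b : Orbit n) : Orbit.one n ⟶ b := I (fun _ => 0) fun _ => Subsingleton.elim _ _

/-! ## Modules over the constant Mackey ring -/

/-- The category of modules over the constant-coefficient Mackey ring of `C_n`: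
contravariant additive functors from `BZ` to abelian groups. -/
abbrev MackeyMod (n : ℕ) := (Orbit n)ᵒᵖ ⥤+ AddCommGrpCat.{0}

section Abelian

variable {J : Type} [SmallCategory J]

instance : (additiveFunctor (Orbit n)ᵒᵖ AddCommGrpCat.{0}).IsClosedUnderLimitsOfShape J where
  limitsOfShape_le := by
    rintro G ⟨pres⟩
    refine ⟨fun {X Y f g} => ?_⟩
    refine (isLimitOfPreserves ((evaluation _ _).obj Y) pres.isLimit).hom_ext fun j => ?_
    have hadd := pres.prop_diag_obj j
    have := hadd.map_add (f := f) (g := g)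
    change G.map (f + g) ≫ (pres.π.app j).app Y = (G.map f + G.map g) ≫ (pres.π.app j).app Y
    rw [Preadditive.add_comp, NatTrans.naturality, NatTrans.naturality, NatTrans.naturality, this,
      Preadditive.comp_add]

instance : (additiveFunctor (Orbit n)ᵒᵖ AddCommGrpCat.{0}).IsClosedUnderColimitsOfShape J where
  colimitsOfShape_le := by
    rintro G ⟨pres⟩
    refine ⟨fun {X Y f g} => ?_⟩
    refine (isColimitOfPreserves ((evaluation _ _).obj X) pres.isColimit).hom_ext fun j => ?_
    have hadd := pres.prop_diag_obj j
    have := hadd.map_add (f := f) (g := g)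
    have hn (h : X ⟶ Y) : (pres.ι.app j).app X ≫ G.map h =
        (pres.diag.obj j).map h ≫ (pres.ι.app j).app Y := ((pres.ι.app j).naturality h).symm
    change (pres.ι.app j).app X ≫ G.map (f + g) = (pres.ι.app j).app X ≫ (G.map f + G.map g)
    rw [Preadditive.comp_add, hn, hn, hn, this, Preadditive.add_comp]

end Abelian

instance : (additiveFunctor (Orbit n)ᵒᵖ AddCommGrpCat.{0}).IsClosedUnderSubobjects where
  prop_of_mono {X Y} i _ hY := by
    refine ⟨fun {a b f g} => ?_⟩
    have hadd := hY.map_add (f := f) (g := g)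
    rw [← cancel_mono (i.app b), Preadditive.add_comp, NatTrans.naturality, NatTrans.naturality,
      NatTrans.naturality, hadd, Preadditive.comp_add]

instance : (additiveFunctor (Orbit n)ᵒᵖ AddCommGrpCat.{0}).IsClosedUnderQuotients where
  prop_of_epi {X Y} p _ hX := by
    refine ⟨fun {a b f g} => ?_⟩
    have hadd := hX.map_add (f := f) (g := g)
    rw [← cancel_epi (p.app a), Preadditive.comp_add, ← NatTrans.naturality,
      ← NatTrans.naturality, ← NatTrans.naturality, hadd, Preadditive.add_comp]

instance : (additiveFunctor (Orbit n)ᵒᵖ AddCommGrpCat.{0}).ContainsZero where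
  exists_zero := ⟨0, isZero_zero _, ⟨fun {_ _ _ _} =>
    ((isZero_zero _ : IsZero (0 : (Orbit n)ᵒᵖ ⥤ AddCommGrpCat.{0})).obj _).eq_of_src _ _⟩⟩

instance : (additiveFunctor (Orbit n)ᵒᵖ AddCommGrpCat.{0}).IsClosedUnderFiniteProducts where

instance : HasColimits (MackeyMod n) := ⟨fun _ _ => inferInstance⟩

instance : Abelian (MackeyMod n) := inferInstance

/-- The value `M(Θ_b)`. -/
abbrev MackeyMod.val (M : MackeyMod n) (b : Orbit n) : AddCommGrpCat.{0} := M.obj.obj (op b)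

/-- For a morphism `φ : Θ_a → Θ_b` of `BZ`, the map `φ^* : M(Θ_b) → M(Θ_a)`.
So `(Rf)^* = f^*` is a restriction, and `(If)^* = f_*` is a transfer. -/
abbrev MackeyMod.act (M : MackeyMod n) {a b : Orbit n} (φ : a ⟶ b) : M.val b →+ M.val a :=
  (M.obj.map φ.op).hom

/-- The component `M(Θ_b) → N(Θ_b)` of a map of modules. -/
abbrev MackeyMod.component {M N : MackeyMod n} (f : M ⟶ N) (b : Orbit n) : M.val b →+ N.val b :=
  (f.hom.app (op b)).hom

/-- The free module functor: `F_b = BZ(-, Θ_b)` is free on the generator `g_b = id ∈ F_b(Θ_b)`.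
A morphism `Θ_b → Θ_c` of `BZ` acts on free modules by postcomposition. -/
def free : Orbit n ⥤ MackeyMod n :=
  ObjectProperty.lift _ preadditiveYoneda fun b =>
    (inferInstance : (preadditiveYoneda.obj b).Additive)

/-- A morphism `φ : Θ_a → Θ_b` of `BZ`, as an element of `F_b(Θ_a)`. -/
def free.elt {a b : Orbit n} (φ : a ⟶ b) : (free.obj b).val a := φ

/-- The map `F_b → M` sending the generator `g_b` to `x`. -/
def free.desc {M : MackeyMod n} {b : Orbit n} (x : M.val b) : free.obj b ⟶ M :=
  ObjectProperty.homMk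
    { app := fun a => AddCommGrpCat.ofHom
        { toFun := fun φ : a.unop ⟶ b => M.act φ x
          map_zero' := by
            change (M.obj.map (0 : op b ⟶ a)).hom x = 0
            rw [M.obj.map_zero]; rfl
          map_add' := fun φ ψ => by
            change (M.obj.map (φ.op + ψ.op)).hom x = _
            rw [M.obj.map_add]; rfl }
      naturality := fun a c h => by
        refine AddCommGrpCat.hom_ext (AddMonoidHom.ext fun φ : a.unop ⟶ b => ?_)
        exact ConcreteCategory.congr_hom (M.obj.map_comp φ.op h) x }

/-- The degree of a morphism `A : Θ_a → Θ_b` of `BZ`: the sum of the entries in a row. -/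
def degree {a b : Orbit n} (A : a ⟶ b) : ℤ := ∑ y, (show orbitHom a b from A).1 0 y

lemma row_sum {a b : Orbit n} (A : orbitHom a b) (x : ZMod a.size) :
    ∑ y, A.1 x y = ∑ y, A.1 0 y := by
  obtain ⟨k, rfl⟩ : ∃ k : ℕ, (k : ZMod a.size) = x := ⟨x.val, ZMod.natCast_zmod_val x⟩
  induction k with
  | zero => simp
  | succ k ih =>
    rw [← ih, ← Equiv.sum_comp (Equiv.addRight (1 : ZMod b.size)), Nat.cast_succ]
    exact Finset.sum_congr rfl fun y _ => A.2 _ _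

lemma degree_comp {a b c : Orbit n} (A : a ⟶ b) (B : b ⟶ c) :
    degree (A ≫ B) = degree A * degree B := by
  change ∑ z, ∑ y, (show orbitHom a b from A).1 0 y * (show orbitHom b c from B).1 y z = _
  rw [Finset.sum_comm]
  simp only [← Finset.mul_sum, row_sum, ← Finset.sum_mul]
  rfl

lemma degree_id (a : Orbit n) : degree (𝟙 a) = 1 := by
  change ∑ y : ZMod a.size, (if (0 : ZMod a.size) = y then (1 : ℤ) else 0) = 1
  simp

lemma degree_add {a b : Orbit n} (A B : a ⟶ b) : degree (A + B) = degree A + degree B :=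
  Finset.sum_add_distrib

/-- The constant Mackey functor with value `ℤ`: all restrictions `(Rf)^*` are the identity, and the
transfer `(If)^*` along `f : Θ_d → Θ_e` is multiplication by `d / e`. -/
def constZ (n : ℕ) : MackeyMod n :=
  ⟨{ obj := fun _ => AddCommGrpCat.of ℤ
     map := fun φ => AddCommGrpCat.ofHom (AddMonoidHom.mulLeft (degree φ.unop))
     map_id := fun a => by
       ext
       change degree (𝟙 a.unop) * 1 = 1
       rw [degree_id, mul_one]
     map_comp := fun f g => by
       ext
       change degree (g.unop ≫ f.unop) * 1 = degree g.unop * (degree f.unop * 1)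
       rw [degree_comp, mul_assoc] },
   ⟨fun {a b f g} => by
     ext
     change degree (f.unop + g.unop) * 1 = degree f.unop * 1 + degree g.unop * 1
     rw [degree_add, add_mul]⟩⟩

/-- The ideal `I_d` of the constant Mackey functor generated by `1 ∈ ℤ = constZ(Θ_d)`. -/
def idealI (d : Orbit n) : MackeyMod n :=
  image (free.desc (M := constZ n) (b := d) (1 : ℤ))

/-- The inclusion of `I_d` into the constant Mackey functor. -/
def idealI.incl (d : Orbit n) : idealI d ⟶ constZ n :=
  image.ι (free.desc (M := constZ n) (b := d) (1 : ℤ))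

/-- The quotient of the constant Mackey functor by `I_d`. -/
def quotI (d : Orbit n) : MackeyMod n := cokernel (idealI.incl d)

/-- `M` is generated by a set `S` of elements in the `Θ_1` spot: a submodule
of `M` that contains `S` is all of `M`. -/
def GeneratedBy (M : MackeyMod n) (S : Set (M.val (Orbit.one n))) : Prop :=
  ∀ (P : MackeyMod n) (i : P ⟶ M) [Mono i],
    (∀ x ∈ S, ∃ y, MackeyMod.component i (Orbit.one n) y = x) → IsIso i

/-! ## The box product -/

/-- `BZ(Θ_d, Θ_a × Θ_b)`, as the group of invariant integer matrices. -/
def pairHom (d a b : Orbit n) : AddSubgroup (ZMod d.size → ZMod a.size → ZMod b.size → ℤ) where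
  carrier := {A | ∀ x y z, A (x + 1) (y + 1) (z + 1) = A x y z}
  zero_mem' _ _ _ := rfl
  add_mem' hA hB x y z := by simp only [Pi.add_apply, hA x y z, hB x y z]
  neg_mem' hA x y z := by simp only [Pi.neg_apply, hA x y z]

/-- Precomposition of `e : Θ_d → Θ_a × Θ_b` with `ψ : Θ_d' → Θ_d`. -/
def pairPre {d' d a b : Orbit n} (ψ : d' ⟶ d) (e : pairHom d a b) : pairHom d' a b :=
  ⟨fun x' y z => ∑ x, (show orbitHom d' d from ψ).1 x' x * e.1 x y z, fun x' y z => by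
    change ∑ x, (show orbitHom d' d from ψ).1 (x' + 1) x * e.1 x (y + 1) (z + 1) = _
    rw [← Equiv.sum_comp (Equiv.addRight (1 : ZMod d.size))]
    exact Finset.sum_congr rfl fun x _ => by
      rw [Equiv.coe_addRight, (show orbitHom d' d from ψ).2 x' x, e.2 x y z]⟩

/-- Postcomposition of `e : Θ_d → Θ_a × Θ_b` with `φ × id`, for `φ : Θ_a → Θ_a'`. -/
def pairLeft {d a a' b : Orbit n} (φ : a ⟶ a') (e : pairHom d a b) : pairHom d a' b :=
  ⟨fun x y' z => ∑ y, e.1 x y z * (show orbitHom a a' from φ).1 y y', fun x y' z => by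
    change ∑ y, e.1 (x + 1) y (z + 1) * (show orbitHom a a' from φ).1 y (y' + 1) = _
    rw [← Equiv.sum_comp (Equiv.addRight (1 : ZMod a.size))]
    exact Finset.sum_congr rfl fun y _ => by
      rw [Equiv.coe_addRight, (show orbitHom a a' from φ).2 y y', e.2 x y z]⟩

/-- Postcomposition of `e : Θ_d → Θ_a × Θ_b` with `id × φ`, for `φ : Θ_b → Θ_b'`. -/
def pairRight {d a b b' : Orbit n} (φ : b ⟶ b') (e : pairHom d a b) : pairHom d a b' :=
  ⟨fun x y z' => ∑ z, e.1 x y z * (show orbitHom b b' from φ).1 z z', fun x y z' => by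
    change ∑ z, e.1 (x + 1) (y + 1) z * (show orbitHom b b' from φ).1 z (z' + 1) = _
    rw [← Equiv.sum_comp (Equiv.addRight (1 : ZMod b.size))]
    exact Finset.sum_congr rfl fun z _ => by
      rw [Equiv.coe_addRight, (show orbitHom b b' from φ).2 z z', e.2 x y z]⟩

lemma pairPre_add {d' d a b : Orbit n} (ψ : d' ⟶ d) (e e' : pairHom d a b) :
    pairPre ψ (e + e') = pairPre ψ e + pairPre ψ e' := Subtype.ext <| by
  funext x y z
  change ∑ w, (show orbitHom d' d from ψ).1 x w * (e.1 w y z + e'.1 w y z) =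
    (∑ w, (show orbitHom d' d from ψ).1 x w * e.1 w y z) +
      ∑ w, (show orbitHom d' d from ψ).1 x w * e'.1 w y z
  simp only [mul_add, Finset.sum_add_distrib]

lemma add_pairPre {d' d a b : Orbit n} (ψ ψ' : d' ⟶ d) (e : pairHom d a b) :
    pairPre (ψ + ψ') e = pairPre ψ e + pairPre ψ' e := Subtype.ext <| by
  funext x y z
  change ∑ w, ((show orbitHom d' d from ψ).1 x w + (show orbitHom d' d from ψ').1 x w) * e.1 w y z =
    (∑ w, (show orbitHom d' d from ψ).1 x w * e.1 w y z) +
      ∑ w, (show orbitHom d' d from ψ').1 x w * e.1 w y z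
  simp only [add_mul, Finset.sum_add_distrib]

lemma pairPre_id {d a b : Orbit n} (e : pairHom d a b) : pairPre (𝟙 d) e = e := Subtype.ext <| by
  funext x y z
  change ∑ w, (if x = w then (1 : ℤ) else 0) * e.1 w y z = e.1 x y z
  simp

lemma pairPre_comp {d'' d' d a b : Orbit n} (ψ' : d'' ⟶ d') (ψ : d' ⟶ d) (e : pairHom d a b) :
    pairPre (ψ' ≫ ψ) e = pairPre ψ' (pairPre ψ e) := Subtype.ext <| by
  funext x y z
  change ∑ w, (∑ v, (show orbitHom d'' d' from ψ').1 x v * (show orbitHom d' d from ψ).1 v w) *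
      e.1 w y z = ∑ v, (show orbitHom d'' d' from ψ').1 x v *
        ∑ w, (show orbitHom d' d from ψ).1 v w * e.1 w y z
  simp only [Finset.sum_mul, Finset.mul_sum]
  rw [Finset.sum_comm]
  simp only [mul_assoc]

lemma pairPre_left {d' d a a' b : Orbit n} (ψ : d' ⟶ d) (φ : a ⟶ a') (e : pairHom d a b) :
    pairPre ψ (pairLeft φ e) = pairLeft φ (pairPre ψ e) := Subtype.ext <| by
  funext x y z
  change ∑ w, (show orbitHom d' d from ψ).1 x w *
      (∑ v, e.1 w v z * (show orbitHom a a' from φ).1 v y) =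
    ∑ v, (∑ w, (show orbitHom d' d from ψ).1 x w * e.1 w v z) * (show orbitHom a a' from φ).1 v y
  simp only [Finset.sum_mul, Finset.mul_sum]
  rw [Finset.sum_comm]
  simp only [mul_assoc]

lemma pairPre_right {d' d a b b' : Orbit n} (ψ : d' ⟶ d) (φ : b ⟶ b') (e : pairHom d a b) :
    pairPre ψ (pairRight φ e) = pairRight φ (pairPre ψ e) := Subtype.ext <| by
  funext x y z
  change ∑ w, (show orbitHom d' d from ψ).1 x w *
      (∑ v, e.1 w y v * (show orbitHom b b' from φ).1 v z) =
    ∑ v, (∑ w, (show orbitHom d' d from ψ).1 x w * e.1 w y v) * (show orbitHom b b' from φ).1 v z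
  simp only [Finset.sum_mul, Finset.mul_sum]
  rw [Finset.sum_comm]
  simp only [mul_assoc]

/-- The symbols `e ⊗ m ⊗ m'` with `e ∈ BZ(Θ_d, Θ_a × Θ_b)`, `m ∈ M(Θ_a)`, `m' ∈ N(Θ_b)`. -/
structure BoxSymbol (M N : MackeyMod n) (d : Orbit n) where
  a : Orbit n
  b : Orbit n
  e : pairHom d a b
  m : M.val a
  m' : N.val b

/-- The relations between the symbols: additivity in each variable, and
`(φ × id)_* e ⊗ m ⊗ m' = e ⊗ φ^* m ⊗ m'` and `(id × φ)_* e ⊗ m ⊗ m' = e ⊗ m ⊗ φ^* m'`. -/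
inductive BoxRel (M N : MackeyMod n) (d : Orbit n) : FreeAbelianGroup (BoxSymbol M N d) → Prop
  | add_e (a b : Orbit n) (e e' : pairHom d a b) (m : M.val a) (m' : N.val b) :
      BoxRel M N d (.of ⟨a, b, e + e', m, m'⟩ - .of ⟨a, b, e, m, m'⟩ - .of ⟨a, b, e', m, m'⟩)
  | add_m (a b : Orbit n) (e : pairHom d a b) (m₁ m₂ : M.val a) (m' : N.val b) :
      BoxRel M N d (.of ⟨a, b, e, m₁ + m₂, m'⟩ - .of ⟨a, b, e, m₁, m'⟩ - .of ⟨a, b, e, m₂, m'⟩)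
  | add_m' (a b : Orbit n) (e : pairHom d a b) (m : M.val a) (m₁ m₂ : N.val b) :
      BoxRel M N d (.of ⟨a, b, e, m, m₁ + m₂⟩ - .of ⟨a, b, e, m, m₁⟩ - .of ⟨a, b, e, m, m₂⟩)
  | left (a a' b : Orbit n) (φ : a ⟶ a') (e : pairHom d a b) (m : M.val a') (m' : N.val b) :
      BoxRel M N d (.of ⟨a', b, pairLeft φ e, m, m'⟩ - .of ⟨a, b, e, M.act φ m, m'⟩)
  | right (a b b' : Orbit n) (φ : b ⟶ b') (e : pairHom d a b) (m : M.val a) (m' : N.val b') :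
      BoxRel M N d (.of ⟨a, b', pairRight φ e, m, m'⟩ - .of ⟨a, b, e, m, N.act φ m'⟩)

/-- The group `(M □ N)(Θ_d)`: the coend of
`BZ(Θ_d, Θ_a × Θ_b) ⊗ M(Θ_a) ⊗ N(Θ_b)` over `Θ_a` and `Θ_b` in `BZ` (Day convolution). -/
def BoxGroup (M N : MackeyMod n) (d : Orbit n) : Type :=
  FreeAbelianGroup (BoxSymbol M N d) ⧸ AddSubgroup.closure {x | BoxRel M N d x}

instance (M N : MackeyMod n) (d : Orbit n) : AddCommGroup (BoxGroup M N d) :=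
  inferInstanceAs (AddCommGroup
    (FreeAbelianGroup (BoxSymbol M N d) ⧸ AddSubgroup.closure {x | BoxRel M N d x}))

/-- The class of `e ⊗ m ⊗ m'` in `(M □ N)(Θ_d)`. -/
def BoxGroup.mk {M N : MackeyMod n} {d a b : Orbit n} (e : pairHom d a b) (m : M.val a)
    (m' : N.val b) : BoxGroup M N d :=
  QuotientAddGroup.mk (.of ⟨a, b, e, m, m'⟩)

namespace BoxGroup

variable {M N : MackeyMod n} {d : Orbit n}

lemma mk_eq_of_rel {x y : FreeAbelianGroup (BoxSymbol M N d)} (h : BoxRel M N d (x - y)) :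
    (QuotientAddGroup.mk x : BoxGroup M N d) = QuotientAddGroup.mk y :=
  (QuotientAddGroup.eq_iff_sub_mem).2 (AddSubgroup.subset_closure h)

lemma add_e {a b : Orbit n} (e e' : pairHom d a b) (m : M.val a) (m' : N.val b) :
    mk (e + e') m m' = mk e m m' + mk e' m m' := by
  refine mk_eq_of_rel (y := FreeAbelianGroup.of (BoxSymbol.mk a b e m m') + FreeAbelianGroup.of (BoxSymbol.mk a b e' m m')) ?_
  rw [← sub_sub]
  exact .add_e ..

lemma add_m {a b : Orbit n} (e : pairHom d a b) (m₁ m₂ : M.val a) (m' : N.val b) :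
    mk e (m₁ + m₂) m' = mk e m₁ m' + mk e m₂ m' := by
  refine mk_eq_of_rel (y := FreeAbelianGroup.of (BoxSymbol.mk a b e m₁ m') + FreeAbelianGroup.of (BoxSymbol.mk a b e m₂ m')) ?_
  rw [← sub_sub]
  exact .add_m ..

lemma add_m' {a b : Orbit n} (e : pairHom d a b) (m : M.val a) (m₁ m₂ : N.val b) :
    mk e m (m₁ + m₂) = mk e m m₁ + mk e m m₂ := by
  refine mk_eq_of_rel (y := FreeAbelianGroup.of (BoxSymbol.mk a b e m m₁) + FreeAbelianGroup.of (BoxSymbol.mk a b e m m₂)) ?_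
  rw [← sub_sub]
  exact .add_m' ..

lemma left {a a' b : Orbit n} (φ : a ⟶ a') (e : pairHom d a b) (m : M.val a') (m' : N.val b) :
    mk (pairLeft φ e) m m' = mk e (M.act φ m) m' :=
  mk_eq_of_rel (.left ..)

lemma right {a b b' : Orbit n} (φ : b ⟶ b') (e : pairHom d a b) (m : M.val a) (m' : N.val b') :
    mk (pairRight φ e) m m' = mk e m (N.act φ m') :=
  mk_eq_of_rel (.right ..)

/-- Homomorphisms out of `(M □ N)(Θ_d)`. -/
def lift {A : Type*} [AddCommGroup A] (f : BoxSymbol M N d → A)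
    (add_e : ∀ (a b : Orbit n) (e e' : pairHom d a b) (m : M.val a) (m' : N.val b),
      f ⟨a, b, e + e', m, m'⟩ = f ⟨a, b, e, m, m'⟩ + f ⟨a, b, e', m, m'⟩)
    (add_m : ∀ (a b : Orbit n) (e : pairHom d a b) (m₁ m₂ : M.val a) (m' : N.val b),
      f ⟨a, b, e, m₁ + m₂, m'⟩ = f ⟨a, b, e, m₁, m'⟩ + f ⟨a, b, e, m₂, m'⟩)
    (add_m' : ∀ (a b : Orbit n) (e : pairHom d a b) (m : M.val a) (m₁ m₂ : N.val b),
      f ⟨a, b, e, m, m₁ + m₂⟩ = f ⟨a, b, e, m, m₁⟩ + f ⟨a, b, e, m, m₂⟩)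
    (left : ∀ (a a' b : Orbit n) (φ : a ⟶ a') (e : pairHom d a b) (m : M.val a') (m' : N.val b),
      f ⟨a', b, pairLeft φ e, m, m'⟩ = f ⟨a, b, e, M.act φ m, m'⟩)
    (right : ∀ (a b b' : Orbit n) (φ : b ⟶ b') (e : pairHom d a b) (m : M.val a) (m' : N.val b'),
      f ⟨a, b', pairRight φ e, m, m'⟩ = f ⟨a, b, e, m, N.act φ m'⟩) : BoxGroup M N d →+ A :=
  QuotientAddGroup.lift _ (FreeAbelianGroup.lift f) <| by
    rw [AddSubgroup.closure_le]
    rintro _ (⟨a, b, e, e', m, m'⟩ | ⟨a, b, e, m₁, m₂, m'⟩ | ⟨a, b, e, m, m₁, m₂⟩ |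
      ⟨a, a', b, φ, e, m, m'⟩ | ⟨a, b, b', φ, e, m, m'⟩)
    · simp [add_e]
    · simp [add_m]
    · simp [add_m']
    · simp [left]
    · simp [right]

@[ext]
lemma hom_ext {A : Type*} [AddCommGroup A] {f g : BoxGroup M N d →+ A}
    (h : ∀ (a b : Orbit n) (e : pairHom d a b) (m : M.val a) (m' : N.val b),
      f (mk e m m') = g (mk e m m')) : f = g := by
  refine QuotientAddGroup.addMonoidHom_ext _ (FreeAbelianGroup.lift_ext _ _ fun s => ?_)
  exact h s.a s.b s.e s.m s.m'

/-- The map `(M □ N)(Θ_d) → (M' □ N')(Θ_d')` induced by `f : M → M'`, `g : N → N'` and a morphism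
`ψ : Θ_d' → Θ_d` of `BZ`. -/
def map {M' N' : MackeyMod n} {d' : Orbit n} (f : M ⟶ M') (g : N ⟶ N') (ψ : d' ⟶ d) :
    BoxGroup M N d →+ BoxGroup M' N' d' :=
  lift (fun s => mk (pairPre ψ s.e) (MackeyMod.component f s.a s.m) (MackeyMod.component g s.b s.m'))
    (fun a b e e' m m' => by simp only [pairPre_add, add_e])
    (fun a b e m₁ m₂ m' => by simp only [map_add, add_m])
    (fun a b e m m₁ m₂ => by simp only [map_add, add_m'])
    (fun a a' b φ e m m' => by
      have h := ConcreteCategory.congr_hom (f.hom.naturality φ.op) m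
      simp only [pairPre_left, left]
      exact congrArg (fun w => mk _ w _) h.symm)
    (fun a b b' φ e m m' => by
      have h := ConcreteCategory.congr_hom (g.hom.naturality φ.op) m'
      simp only [pairPre_right, right]
      exact congrArg (fun w => mk _ _ w) h.symm)

lemma map_mk {M' N' : MackeyMod n} {d' a b : Orbit n} (f : M ⟶ M') (g : N ⟶ N') (ψ : d' ⟶ d)
    (e : pairHom d a b) (m : M.val a) (m' : N.val b) :
    map f g ψ (mk e m m') =
      mk (pairPre ψ e) (MackeyMod.component f a m) (MackeyMod.component g b m') := by
  change FreeAbelianGroup.lift _ (FreeAbelianGroup.of _) = _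
  rw [FreeAbelianGroup.lift_apply_of]

end BoxGroup

/-- The box product `M □ N` of two modules. -/
def boxObj (M N : MackeyMod n) : MackeyMod n :=
  ⟨{ obj := fun d => AddCommGrpCat.of (BoxGroup M N d.unop)
     map := fun ψ => AddCommGrpCat.ofHom (BoxGroup.map (𝟙 M) (𝟙 N) ψ.unop)
     map_id := fun d => by
       refine AddCommGrpCat.hom_ext (BoxGroup.hom_ext fun a b e m m' => ?_)
       refine (BoxGroup.map_mk ..).trans ?_
       rw [unop_id, pairPre_id]; rfl
     map_comp := fun ψ ψ' => by
       refine AddCommGrpCat.hom_ext (BoxGroup.hom_ext fun a b e m m' => ?_)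
       change BoxGroup.map (𝟙 M) (𝟙 N) (ψ'.unop ≫ ψ.unop) (BoxGroup.mk e m m') =
         BoxGroup.map (𝟙 M) (𝟙 N) ψ'.unop
           (BoxGroup.map (𝟙 M) (𝟙 N) ψ.unop (BoxGroup.mk e m m'))
       rw [BoxGroup.map_mk, BoxGroup.map_mk, BoxGroup.map_mk, pairPre_comp]; rfl },
   ⟨fun {d d' ψ ψ'} => by
     refine AddCommGrpCat.hom_ext (BoxGroup.hom_ext fun a b e m m' => ?_)
     change BoxGroup.map _ _ _ _ = BoxGroup.map _ _ _ _ + BoxGroup.map _ _ _ _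
     rw [BoxGroup.map_mk, BoxGroup.map_mk, BoxGroup.map_mk, unop_add, add_pairPre,
       BoxGroup.add_e]⟩⟩

/-- The map `M □ N → M' □ N'` induced by `M → M'` and `N → N'`. -/
def boxMap {M N M' N' : MackeyMod n} (f : M ⟶ M') (g : N ⟶ N') : boxObj M N ⟶ boxObj M' N' :=
  ObjectProperty.homMk
    { app := fun d => AddCommGrpCat.ofHom (BoxGroup.map f g (𝟙 d.unop))
      naturality := fun d d' ψ => by
        refine AddCommGrpCat.hom_ext (BoxGroup.hom_ext fun a b e m m' => ?_)
        change BoxGroup.map f g (𝟙 d'.unop)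
            (BoxGroup.map (𝟙 M) (𝟙 N) ψ.unop (BoxGroup.mk e m m')) =
          BoxGroup.map (𝟙 M') (𝟙 N') ψ.unop
            (BoxGroup.map f g (𝟙 d.unop) (BoxGroup.mk e m m'))
        rw [BoxGroup.map_mk, BoxGroup.map_mk, BoxGroup.map_mk, BoxGroup.map_mk, pairPre_id,
          pairPre_id]
        rfl }

/-- A map out of a box product is determined by its values on the symbols. -/
lemma box_hom_ext {M N P : MackeyMod n} {f g : boxObj M N ⟶ P}
    (h : ∀ (d a b : Orbit n) (e : pairHom d a b) (m : M.val a) (m' : N.val b),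
      MackeyMod.component f d (BoxGroup.mk e m m') =
        MackeyMod.component g d (BoxGroup.mk e m m')) : f = g := by
  refine ObjectProperty.hom_ext _ (NatTrans.ext (funext fun d => ?_))
  exact AddCommGrpCat.hom_ext (BoxGroup.hom_ext fun a b e m m' => h d.unop a b e m m')

lemma boxMap_mk {M N M' N' : MackeyMod n} (f : M ⟶ M') (g : N ⟶ N') {d a b : Orbit n}
    (e : pairHom d a b) (m : M.val a) (m' : N.val b) :
    MackeyMod.component (boxMap f g) d (BoxGroup.mk e m m') =
      BoxGroup.mk e (MackeyMod.component f a m) (MackeyMod.component g b m') := by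
  refine (BoxGroup.map_mk ..).trans ?_
  rw [pairPre_id]

/-- The box product, as a bifunctor. -/
def box (n : ℕ) : MackeyMod n ⥤ MackeyMod n ⥤ MackeyMod n where
  obj M :=
    { obj := fun N => boxObj M N
      map := fun g => boxMap (𝟙 M) g
      map_id := fun N => box_hom_ext fun d a b e m m' => boxMap_mk ..
      map_comp := fun g g' => box_hom_ext fun d a b e m m' => by
        change MackeyMod.component (boxMap (𝟙 M) (g ≫ g')) d (BoxGroup.mk e m m') =
          MackeyMod.component (boxMap (𝟙 M) g') d
            (MackeyMod.component (boxMap (𝟙 M) g) d (BoxGroup.mk e m m'))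
        rw [boxMap_mk, boxMap_mk, boxMap_mk]; rfl }
  map f :=
    { app := fun N => boxMap f (𝟙 N)
      naturality := fun N N' g => box_hom_ext fun d a b e m m' => by
        rename_i M M'
        change MackeyMod.component (boxMap f (𝟙 N')) d
            (MackeyMod.component (boxMap (𝟙 M) g) d (BoxGroup.mk e m m')) =
          MackeyMod.component (boxMap (𝟙 M') g) d
            (MackeyMod.component (boxMap f (𝟙 N)) d (BoxGroup.mk e m m'))
        rw [boxMap_mk, boxMap_mk, boxMap_mk, boxMap_mk]; rfl }
  map_id M := NatTrans.ext <| funext fun N => box_hom_ext fun d a b e m m' => boxMap_mk ..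
  map_comp f f' := NatTrans.ext <| funext fun N => box_hom_ext fun d a b e m m' => by
    change MackeyMod.component (boxMap (f ≫ f') (𝟙 N)) d (BoxGroup.mk e m m') =
      MackeyMod.component (boxMap f' (𝟙 N)) d
        (MackeyMod.component (boxMap f (𝟙 N)) d (BoxGroup.mk e m m'))
    rw [boxMap_mk, boxMap_mk, boxMap_mk]; rfl

instance : (box n).Additive where
  map_add {M M' f f'} := NatTrans.ext <| funext fun N => box_hom_ext fun d a b e m m' => by
    refine (boxMap_mk ..).trans ?_
    change _ = MackeyMod.component (boxMap _ _) d _ + MackeyMod.component (boxMap _ _) d _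
    rw [boxMap_mk, boxMap_mk]
    exact BoxGroup.add_m ..

instance (M : MackeyMod n) : ((box n).obj M).Additive where
  map_add {N N' g g'} := box_hom_ext fun d a b e m m' => by
    refine (boxMap_mk ..).trans ?_
    change _ = MackeyMod.component (boxMap _ _) d _ + MackeyMod.component (boxMap _ _) d _
    rw [boxMap_mk, boxMap_mk]
    exact BoxGroup.add_m' ..

/-- The pairing `M(Θ_1) × N(Θ_1) → (M □ N)(Θ_1)`, from the isomorphism `Θ_1 ≅ Θ_1 × Θ_1`. -/
def boxElt {M N : MackeyMod n} (x : M.val (Orbit.one n)) (y : N.val (Orbit.one n)) :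
    (((box n).obj M).obj N).val (Orbit.one n) :=
  BoxGroup.mk ⟨fun _ _ _ => 1, fun _ _ _ => rfl⟩ x y

/-! ## Spheres -/

/-- The box product of two chain complexes: the total complex of the double complex
`X_p □ Y_q`, with the usual sign `(-1)^p` on the second differential. -/
def boxComplex (X Y : ChainComplex (MackeyMod n) ℕ) : ChainComplex (MackeyMod n) ℕ :=
  HomologicalComplex.mapBifunctor X Y (box n) (ComplexShape.down ℕ)

/-- The modules in the complex `S^{λ_b}`. -/
def lambdaX (b : Orbit n) : ℕ → MackeyMod n
  | 0 => free.obj (Orbit.one n)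
  | 1 => free.obj b
  | 2 => free.obj b
  | _ => 0

/-- The differentials in the complex `S^{λ_b}`. -/
def lambdaD (b : Orbit n) : ∀ k : ℕ, lambdaX b (k + 1) ⟶ lambdaX b k
  | 0 => free.map (Rpi b)
  | 1 => 𝟙 _ - free.map (Rt b)
  | _ + 2 => 0

lemma Rt_comp_Rpi (b : Orbit n) : Rt b ≫ Rpi b = Rpi b := Subtype.ext <| by
  funext x z
  change ∑ y, (if x + 1 = y then (1 : ℤ) else 0) * (if (0 : ZMod (Orbit.one n).size) = z then 1 else 0)
    = if (0 : ZMod (Orbit.one n).size) = z then 1 else 0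
  simp

lemma lambdaD_comp (b : Orbit n) : (𝟙 (free.obj b) - free.map (Rt b)) ≫ free.map (Rpi b) = 0 := by
  rw [Preadditive.sub_comp, Category.id_comp, ← Functor.map_comp, Rt_comp_Rpi, sub_self]

/-- The complex `S^{λ_b}`: `0 → F_b → F_b → F_1 → 0`, with differentials `id - Rt` and `Rπ`
and with `F_1` in degree `0`. -/
def sphereLambda (b : Orbit n) : ChainComplex (MackeyMod n) ℕ :=
  ChainComplex.of (lambdaX b) (lambdaD b) fun
    | 0 => lambdaD_comp b
    | _ + 1 => zero_comp

/-- `S^{λ_{b_1}} □ ⋯ □ S^{λ_{b_s}}`; the empty product is the unit `F_1` in degree `0`. -/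
def sphere : List (Orbit n) → ChainComplex (MackeyMod n) ℕ
  | [] => (ChainComplex.single₀ (MackeyMod n)).obj (free.obj (Orbit.one n))
  | b :: bs => boxComplex (sphereLambda b) (sphere bs)

/-- The product of chains `x` and `y` in the `Θ_1` spot. -/
def chainMul {X Y : ChainComplex (MackeyMod n) ℕ} {p q k : ℕ} (h : p + q = k)
    (x : (X.X p).val (Orbit.one n)) (y : (Y.X q).val (Orbit.one n)) :
    ((boxComplex X Y).X k).val (Orbit.one n) :=
  MackeyMod.component
    (HomologicalComplex.ιMapBifunctor X Y (box n) (ComplexShape.down ℕ) p q k h) _ (boxElt x y)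

/-- The Euler class `a_b`, as a `0`-cycle of `S^{λ_b}` in the `Θ_1` spot: the generator
of `F_1`, that is, the inclusion of the degree `0` part. -/
def aChain (b : Orbit n) : ((sphereLambda b).X 0).val (Orbit.one n) :=
  free.elt (𝟙 (Orbit.one n))

/-- The orientation class `u_b`, as a `2`-cycle of `S^{λ_b}` in the `Θ_1` spot:
the image of the generator of `F_1` under `Iπ : F_1 → F_b`. -/
def uChain (b : Orbit n) : ((sphereLambda b).X 2).val (Orbit.one n) :=
  free.elt (Ipi b)

/-- The `au`-monomials, as chains: the products `x_1 ⋯ x_s` where each `x_i`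
is either `a_{b_i}` or `u_{b_i}`. -/
inductive IsAUChain : ∀ (bs : List (Orbit n)) (k : ℕ), ((sphere bs).X k).val (Orbit.one n) → Prop
  | nil : IsAUChain [] 0 (MackeyMod.component
      (HomologicalComplex.singleObjXSelf _ 0 (free.obj (Orbit.one n))).inv _ (free.elt (𝟙 (Orbit.one n))))
  | a {b bs k z} (hz : IsAUChain bs k z) : IsAUChain (b :: bs) k (chainMul (zero_add k) (aChain b) z)
  | u {b bs k z} (hz : IsAUChain bs k z) :
      IsAUChain (b :: bs) (k + 2) (chainMul (add_comm 2 k) (uChain b) z)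

/-- The homology class `c ∈ H_k(X)(Θ_1)` is represented by the cycle `z ∈ X_k(Θ_1)`. -/
def Represents (X : ChainComplex (MackeyMod n) ℕ) (k : ℕ) (z : (X.X k).val (Orbit.one n))
    (c : (X.homology k).val (Orbit.one n)) : Prop :=
  ∃ w : (X.cycles k).val (Orbit.one n),
    MackeyMod.component (X.iCycles k) _ w = z ∧ MackeyMod.component (X.homologyπ k) _ w = c

/-- The `au`-classes in `H_k(S^{λ_{b_1}} □ ⋯ □ S^{λ_{b_s}})(Θ_1)`. -/
def auClasses (bs : List (Orbit n)) (k : ℕ) : Set (((sphere bs).homology k).val (Orbit.one n)) :=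
  {c | ∃ z, IsAUChain bs k z ∧ Represents (sphere bs) k z c}

/-! ## The lcm-gcd sequence -/

/-- `(b; j)`: the greatest common divisor of all the `j`-fold least common multiples
`lcm(b_{i_1}, …, b_{i_j})` with `i_1 < ⋯ < i_j`. -/
def lcmGcd {s : ℕ} (b : Fin s → ℕ) (j : ℕ) : ℕ :=
  (Finset.univ.powersetCard j).gcd fun J : Finset (Fin s) => J.lcm b

lemma lcmGcd_dvd {s : ℕ} {b : Fin s → ℕ} (hb : ∀ i, b i ∣ n) {j : ℕ} (hj : j ≤ s) :
    lcmGcd b j ∣ n := by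
  obtain ⟨J, -, hJ⟩ := Finset.exists_subset_card_eq
    (s := (Finset.univ : Finset (Fin s))) (n := j) (by simpa using hj)
  exact (Finset.gcd_dvd (Finset.mem_powersetCard.2 ⟨Finset.subset_univ J, hJ⟩)).trans
    (Finset.lcm_dvd fun i _ => hb i)

end CyclicMackey

end

noncomputable section

namespace CyclicMackey

variable {n : ℕ}

/-! ## Greatest common divisors and least common multiples -/

/-! The proof replaces Mackey modules by fixed points. If `K` is a complex of abelian groups with an
endomorphism `t`, its `t ^ d`-fixed elements are the value at Θ_d of a complex of modules, `cplx`.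
The box product of F_b with the fixed points of `K` is the fixed points of the functions Θ_b → K,
because Θ_b × Θ_d is a union of gcd(b,d) copies of Θ_{lcm(b,d)} (`boxFree`). So the product of
spheres is the fixed point complex of an iterated construction `L` (`sphereIso`), and its homology
at Θ_e is cycles modulo boundaries among `t ^ e`-fixed elements.

The homology is computed by induction on the number of spheres. Suppose that `K` has no odd homology
and that its homology in degree 2j is ℤ/I_c with c the (j+1)-st term of the lcm-gcd sequence. The
cells of S^{λ_b} show that the odd homology of `L b K` vanishes (`L_acyclic`) and that the even
homology is generated by the a_b- and u_b-multiples of the old generators (`L_decomp`). The image of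
a_b at Θ_e is the old group in the same degree modulo b/gcd(b,e) (`aMul_mem_B_iff`); the quotient by
it is cyclic on the u_b-multiple, with the order of the homology of `K` two degrees lower at
Θ_{lcm(b,e)} (`uMul_mem_B_iff`). The product of the two orders is the order of (ℤ/I_{c'})(Θ_e),
where c' = gcd(c₁, lcm(b, c₀)) (`card_L_H`, `quotOrder_gcd_lcm`). This is the recursion obtained by
splitting index sets according to whether they contain the first index (`lcmGcd_succ`).

The extension must still be shown to be cyclic, and this is done one prime p at a time. The gold
relation (`gold_relation`) says that (c/g) a_c u_b = (b/g) u_c a_b with g = gcd(b,c), and p-locally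
one coefficient is a unit. Hence one of the two generators is redundant. If the b_i are sorted by
p-adic valuation, the local generator in degree 2j takes u from the first j spheres and a from the
others; adding a sphere is an insertion into the sorted list (`HasLocGens.L`). A finite abelian
group that is cyclic locally at each prime is cyclic (`isAddCyclic_of_forall_prime`).

A generator found at Θ_1 generates at every Θ_e, since the a_b- and u_b-multiples already live at
Θ_1 (`exists_gen_L`). A module generated at Θ_1 by one class with the orders c/gcd(c,e) is ℤ/I_c
(`nonempty_iso_quotI`); c = 0 gives ℤ in the top degree. Generation by au-classes is `L_decomp`
applied inductively (`ofList_generated`). -/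

lemma lcm_gcd_distrib (a b c : ℕ) : a.lcm (b.gcd c) = (a.lcm b).gcd (a.lcm c) := by
  rcases eq_or_ne a 0 with rfl | ha
  · simp
  rcases eq_or_ne b 0 with rfl | hb
  · simp
  rcases eq_or_ne c 0 with rfl | hc
  · simp
  have hbc : b.gcd c ≠ 0 := Nat.gcd_ne_zero_left hb
  have h1 : a.lcm b ≠ 0 := Nat.lcm_ne_zero ha hb
  have h2 : a.lcm c ≠ 0 := Nat.lcm_ne_zero ha hc
  refine Nat.eq_of_factorization_eq (Nat.lcm_ne_zero ha hbc) (Nat.gcd_ne_zero_left h1) fun p => ?_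
  rw [Nat.factorization_lcm ha hbc, Nat.factorization_gcd hb hc, Nat.factorization_gcd h1 h2,
    Nat.factorization_lcm ha hb, Nat.factorization_lcm ha hc]
  exact sup_inf_left _ _ _

lemma gcd_lcm_absorb {b c d : ℕ} (h : c ∣ d) : d.gcd (b.lcm c) = (d.gcd b).lcm c := by
  rw [Nat.lcm_comm (d.gcd b), lcm_gcd_distrib, Nat.lcm_comm c b]
  congr 1
  exact (Nat.lcm_eq_right h).symm

/-- The order `c / gcd(c, d)` of `(ℤ/I_c)(Θ_d)`. -/
def quotOrder (c d : ℕ) : ℕ := c / c.gcd d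

/-- Clears the division: after multiplication by `d`, identities between orders become identities
between least common multiples. -/
lemma quotOrder_mul (c d : ℕ) : quotOrder c d * d = c.lcm d := by
  rw [quotOrder, Nat.lcm, Nat.div_mul_right_comm (Nat.gcd_dvd_left c d)]

lemma quotOrder_one_left (d : ℕ) : quotOrder 1 d = 1 := by simp [quotOrder]

lemma quotOrder_zero (d : ℕ) : quotOrder 0 d = 0 := by simp [quotOrder]

lemma quotOrder_self_eq_one {c : ℕ} (hc : 0 < c) : quotOrder c c = 1 := by
  simp [quotOrder, Nat.div_self hc]

lemma quotOrder_pos {c : ℕ} (hc : 0 < c) (d : ℕ) : 0 < quotOrder c d :=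
  Nat.div_pos (Nat.le_of_dvd hc (Nat.gcd_dvd_left c d)) (Nat.gcd_pos_of_pos_left d hc)

/-- After multiplying by lcm(b,d), the hypothesis says that lcm(c,d) divides m · lcm(b,d). So does
lcm(b,d), hence also lcm(c, lcm(b,d)). In `L_acyclic` this turns a relation at Θ_d into one at
Θ_{lcm(b,d)}. -/
lemma quotOrder_lcm_dvd {b c d : ℕ} (hb : 0 < b) (hd : 0 < d) {m : ℤ}
    (h : (quotOrder c d : ℤ) ∣ quotOrder b d * m) : (quotOrder c (b.lcm d) : ℤ) ∣ m := by
  have hl : (0 : ℤ) < (b.lcm d : ℕ) := by exact_mod_cast Nat.lcm_pos hb hd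
  refine (mul_dvd_mul_iff_right hl.ne').1 ?_
  have h1 : ((c.lcm d : ℕ) : ℤ) ∣ m * (b.lcm d : ℕ) := by
    have := mul_dvd_mul_right h (d : ℤ)
    rw [← Nat.cast_mul, quotOrder_mul] at this
    rwa [← quotOrder_mul b d, Nat.cast_mul, ← mul_assoc, mul_comm m]
  have h2 : ((b.lcm d : ℕ) : ℤ) ∣ m * (b.lcm d : ℕ) := dvd_mul_left _ _
  rw [← Nat.cast_mul, quotOrder_mul, ← Int.dvd_natAbs, Int.natCast_dvd_natCast]
  rw [← Int.dvd_natAbs, Int.natCast_dvd_natCast] at h1 h2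
  exact Nat.lcm_dvd ((Nat.dvd_lcm_left _ _).trans h1) h2

/-- The right side is the order of the image of a_b times the order of the quotient by it. With
denominators cleared, the identity follows from the modular law `gcd_lcm_absorb` and gcd · lcm =
product. -/
lemma quotOrder_gcd_lcm {b c₀ c₁ d : ℕ} (hb : 0 < b) (hd : 0 < d) (h : c₀ ∣ c₁) :
    quotOrder (c₁.gcd (b.lcm c₀)) d =
      (quotOrder b d).gcd (quotOrder c₁ d) * quotOrder c₀ (b.lcm d) := by
  have hB : 0 < b.lcm d := Nat.lcm_pos hb hd
  refine Nat.eq_of_mul_eq_mul_right (Nat.mul_pos hd hB) ?_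
  rw [← mul_assoc, quotOrder_mul, mul_mul_mul_comm, ← Nat.gcd_mul_right, quotOrder_mul,
    quotOrder_mul, quotOrder_mul]
  set B := b.lcm d with hBdef
  have hE : c₀.lcm d ∣ c₁.lcm d :=
    Nat.lcm_dvd (h.trans (Nat.dvd_lcm_left _ _)) (Nat.dvd_lcm_right _ _)
  have h1 : (c₁.gcd (b.lcm c₀)).lcm d = (c₁.lcm d).gcd (B.lcm (c₀.lcm d)) := by
    rw [Nat.lcm_comm, lcm_gcd_distrib, Nat.lcm_comm d c₁]
    congr 1
    rw [hBdef, Nat.lcm_comm c₀ d, ← Nat.lcm_assoc, ← Nat.lcm_assoc, Nat.lcm_assoc b d d,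
      Nat.lcm_self, Nat.lcm_comm d]
  have h2 : c₀.lcm B = (c₀.lcm d).lcm B := by
    rw [hBdef, Nat.lcm_assoc, Nat.lcm_comm d, Nat.lcm_assoc, Nat.lcm_self]
  rw [h1, h2, gcd_lcm_absorb hE]
  set E₀ := c₀.lcm d
  set E₁ := c₁.lcm d
  have h3 : (E₁.gcd B).gcd E₀ = E₀.gcd B := by
    rw [Nat.gcd_comm _ E₀, ← Nat.gcd_assoc, Nat.gcd_eq_left hE]
  rcases Nat.eq_zero_or_pos E₀ with h0 | h0
  · simp [h0]
  -- The extra factor gcd(E₀, B) completes both least common multiples to products gcd · lcm.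
  refine Nat.eq_of_mul_eq_mul_right (Nat.gcd_pos_of_pos_left B h0) ?_
  calc (E₁.gcd B).lcm E₀ * B * E₀.gcd B
      = ((E₁.gcd B).gcd E₀ * (E₁.gcd B).lcm E₀) * B := by rw [h3]; ring
    _ = B.gcd E₁ * (E₀.gcd B * E₀.lcm B) := by
        rw [Nat.gcd_mul_lcm, Nat.gcd_mul_lcm, Nat.gcd_comm B]; ring
    _ = _ := by ring

/-- The lcm-gcd sequence of a list, by recursion. -/
def lcmGcdList : List ℕ → ℕ → ℕ
  | _, 0 => 1
  -- The gcd of an empty family; this value produces ℤ rather than a torsion quotient in the top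
  -- degree.
  | [], _ + 1 => 0
  | b :: bs, j + 1 => (lcmGcdList bs (j + 1)).gcd (b.lcm (lcmGcdList bs j))

lemma lcmGcdList_zero (bs : List ℕ) : lcmGcdList bs 0 = 1 := by cases bs <;> rfl

lemma lcmGcdList_dvd_succ (bs : List ℕ) (j : ℕ) : lcmGcdList bs j ∣ lcmGcdList bs (j + 1) := by
  induction bs generalizing j with
  | nil => simp [lcmGcdList]
  | cons b bs ih =>
    cases j with
    | zero => simp [lcmGcdList]
    | succ j =>
      refine Nat.dvd_gcd ((Nat.gcd_dvd_left _ _).trans (ih _)) ?_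
      refine (Nat.gcd_dvd_left _ _).trans (Nat.dvd_lcm_right _ _)

lemma lcmGcdList_eq_zero (bs : List ℕ) {j : ℕ} (hj : bs.length < j) : lcmGcdList bs j = 0 := by
  induction bs generalizing j with
  | nil => obtain ⟨j, rfl⟩ := Nat.exists_eq_succ_of_ne_zero hj.ne_bot; rfl
  | cons b bs ih =>
    obtain ⟨j, rfl⟩ := Nat.exists_eq_succ_of_ne_zero hj.ne_bot
    rw [List.length_cons, Nat.succ_lt_succ_iff] at hj
    simp [lcmGcdList, ih hj, ih (Nat.lt_succ_of_lt hj)]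

lemma lcmGcdList_pos {bs : List ℕ} (hbs : ∀ b ∈ bs, 0 < b) {j : ℕ} (hj : j ≤ bs.length) :
    0 < lcmGcdList bs j := by
  induction bs generalizing j with
  | nil => obtain rfl : j = 0 := by simpa using hj
           simp [lcmGcdList]
  | cons b bs ih =>
    cases j with
    | zero => simp [lcmGcdList]
    | succ j =>
      rw [List.length_cons, Nat.succ_le_succ_iff] at hj
      exact Nat.gcd_pos_of_pos_right _ (Nat.lcm_pos (hbs b (by simp))
        (ih (fun x hx => hbs x (by simp [hx])) hj))

lemma lcm_finset_gcd {ι : Type*} (a : ℕ) (s : Finset ι) (f : ι → ℕ) :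
    a.lcm (s.gcd f) = s.gcd fun i => a.lcm (f i) := by
  classical
  induction s using Finset.induction_on with
  | empty => simp
  | insert i s _ ih =>
    rw [Finset.gcd_insert, Finset.gcd_insert, ← ih]
    exact lcm_gcd_distrib ..

/-- Split the (j+1)-element index sets into those that omit 0 and those that contain it; for the
latter, lcm with `b 0` distributes over the gcd. -/
lemma lcmGcd_succ {s : ℕ} (b : Fin (s + 1) → ℕ) (j : ℕ) :
    lcmGcd b (j + 1) = (lcmGcd (fun i => b i.succ) (j + 1)).gcd
      ((b 0).lcm (lcmGcd (fun i => b i.succ) j)) := by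
  classical
  have hlcm (J : Finset (Fin s)) :
      (Finset.map (Fin.succEmb s) J).lcm b = J.lcm fun i => b i.succ := by
    rw [Finset.map_eq_image, Finset.lcm_image]; rfl
  rw [lcmGcd, lcmGcd, lcmGcd, Fin.univ_succ, Finset.cons_eq_insert,
    Finset.powersetCard_succ_insert (by simp), Finset.gcd_union]
  change Nat.gcd _ _ = _
  congr 1
  · rw [Finset.powersetCard_map, Finset.map_eq_image, Finset.gcd_image]
    exact Finset.gcd_congr rfl fun J _ => hlcm J
  · rw [lcm_finset_gcd, Finset.powersetCard_map, Finset.map_eq_image,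
      Finset.image_image, Finset.gcd_image]
    refine Finset.gcd_congr rfl fun J _ => ?_
    change (insert 0 (Finset.map (Fin.succEmb s) J)).lcm b = _
    rw [Finset.lcm_insert, hlcm]
    rfl

lemma lcmGcd_eq_lcmGcdList {s : ℕ} (b : Fin s → ℕ) (j : ℕ) :
    lcmGcd b j = lcmGcdList (List.ofFn b) j := by
  induction s generalizing j with
  | zero =>
    cases j with
    | zero => simp [lcmGcd, lcmGcdList]
    | succ j => rw [lcmGcd, Finset.powersetCard_eq_empty.2 (by simp)]; rfl
  | succ s ih =>
    cases j with
    | zero => simp [lcmGcd, lcmGcdList_zero]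
    | succ j => rw [lcmGcd_succ, List.ofFn_succ, lcmGcdList, ih, ih]

/-! ## Finite abelian groups -/

/-- Lagrange for the subgroup generated by `v`: it has order N₁, and the quotient is cyclic on the
image of `w`, of order N₂. -/
lemma card_eq_mul_of_generators {Q : Type*} [AddCommGroup Q] {v w : Q} {N₁ N₂ : ℕ}
    (hgen : ∀ q, ∃ α β : ℤ, q = α • v + β • w) (h₁ : ∀ α : ℤ, α • v = 0 ↔ (N₁ : ℤ) ∣ α)
    (h₂ : ∀ β : ℤ, (∃ α : ℤ, β • w = α • v) ↔ (N₂ : ℤ) ∣ β) : Nat.card Q = N₁ * N₂ := by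
  have key {G : Type _} [AddCommGroup G] {x : G} {N : ℕ} (h : ∀ α : ℤ, α • x = 0 ↔ (N : ℤ) ∣ α) :
      addOrderOf x = N := by
    refine Nat.dvd_antisymm (addOrderOf_dvd_iff_nsmul_eq_zero.2 ?_) ?_
    · rw [← natCast_zsmul]; exact (h N).2 dvd_rfl
    · have := (h (addOrderOf x)).1 (by rw [natCast_zsmul]; exact addOrderOf_nsmul_eq_zero x)
      exact Int.natCast_dvd_natCast.1 this
  have e₁ : Nat.card (AddSubgroup.zmultiples v) = N₁ := by
    rw [Nat.card_zmultiples]; exact key h₁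
  have e₂ : Nat.card (Q ⧸ AddSubgroup.zmultiples v) = N₂ := by
    have htop : AddSubgroup.zmultiples (w : Q ⧸ AddSubgroup.zmultiples v) = ⊤ := by
      refine (AddSubgroup.eq_top_iff' _).2 fun q => ?_
      obtain ⟨q, rfl⟩ := QuotientAddGroup.mk_surjective q
      obtain ⟨α, β, rfl⟩ := hgen q
      refine ⟨β, ?_⟩
      change β • (w : Q ⧸ AddSubgroup.zmultiples v) = _
      rw [← QuotientAddGroup.mk_zsmul, QuotientAddGroup.eq]
      exact ⟨α, by simp⟩
    rw [← AddSubgroup.card_top, ← htop, Nat.card_zmultiples]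
    refine key fun β => ?_
    rw [← h₂, ← QuotientAddGroup.mk_zsmul, QuotientAddGroup.eq_zero_iff]
    exact ⟨fun ⟨α, h⟩ => ⟨α, h.symm⟩, fun ⟨α, h⟩ => ⟨α, h.symm⟩⟩
  rw [AddSubgroup.card_eq_card_quotient_mul_card_addSubgroup (AddSubgroup.zmultiples v), e₁, e₂,
    mul_comm]

/-- A finite abelian group is cyclic once its exponent equals its order. For each p the index of ⟨z⟩
is prime to p: by Cauchy, the quotient would otherwise have an element of order p, which is killed
by some r prime to p. So the p-part of the order of the group divides the order of z. -/
lemma isAddCyclic_of_forall_prime {Q : Type*} [AddCommGroup Q] [Finite Q]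
    (h : ∀ p : ℕ, p.Prime → ∃ z : Q, ∀ w : Q, ∃ r : ℤ, ¬ (p : ℤ) ∣ r ∧
      r • w ∈ AddSubgroup.zmultiples z) : IsAddCyclic Q := by
  rw [IsAddCyclic.iff_exponent_eq_card]
  refine Nat.dvd_antisymm AddGroup.exponent_dvd_nat_card ?_
  rw [Nat.dvd_iff_prime_pow_dvd_dvd]
  intro p k hp hk
  obtain ⟨z, hz⟩ := h p hp
  have hnd : ¬ p ∣ Nat.card (Q ⧸ AddSubgroup.zmultiples z) := fun hd => by
    have := Fact.mk hp
    obtain ⟨q, hq⟩ := exists_prime_addOrderOf_dvd_card' p hd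
    obtain ⟨w, rfl⟩ := QuotientAddGroup.mk_surjective q
    obtain ⟨r, hr, hrw⟩ := hz w
    refine hr ?_
    rw [← hq, addOrderOf_dvd_iff_zsmul_eq_zero, ← QuotientAddGroup.mk_zsmul,
      QuotientAddGroup.eq_zero_iff]
    exact hrw
  rw [AddSubgroup.card_eq_card_quotient_mul_card_addSubgroup (AddSubgroup.zmultiples z),
    Nat.card_zmultiples] at hk
  have hc : Nat.Coprime (p ^ k) (Nat.card (Q ⧸ AddSubgroup.zmultiples z)) :=
    Nat.Coprime.pow_left _ ((Nat.Prime.coprime_iff_not_dvd hp).2 hnd)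
  exact (hc.dvd_of_dvd_mul_left hk).trans (AddMonoid.addOrder_dvd_exponent z)

/-! ## Equivariant functions on `ZMod b` -/

lemma iterate_eq_of_modEq {T : Type*} {σ : T → T} {l : ℕ} {x : T} (hx : σ^[l] x = x) {i j : ℕ}
    (h : i ≡ j [MOD l]) : σ^[i] x = σ^[j] x := by
  have hp : Function.IsPeriodicPt σ l x := hx
  rw [← hp.iterate_mod_apply i, ← hp.iterate_mod_apply j, h]

lemma modEq_lcm {a b i j : ℕ} (ha : i ≡ j [MOD a]) (hb : i ≡ j [MOD b]) : i ≡ j [MOD a.lcm b] := by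
  rw [Nat.modEq_iff_dvd, ← Int.dvd_natAbs, Int.natCast_dvd_natCast] at *
  exact Nat.lcm_dvd ha hb

lemma exists_natCast_mul_of_mem_zmultiples {b : ℕ} [NeZero b] {d : ℕ} {y : ZMod b}
    (h : y ∈ AddSubgroup.zmultiples (d : ZMod b)) : ∃ i : ℕ, y = i * d := by
  obtain ⟨i, rfl⟩ := h
  exact ⟨(i : ZMod b).val, by simp⟩

/-- Choose a value on one representative of each coset of ⟨d⟩ in `ZMod b` and translate it. The
translation is consistent exactly because the chosen value is fixed by `σ^[b.lcm d]`. Through this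
lemma a question about functions on Θ_b at Θ_d becomes a pointwise question at Θ_{lcm(b,d)}. -/
lemma exists_equivariant {T : Type*} (σ : T → T) {b d : ℕ} [NeZero b] (P : ZMod b → T → Prop)
    (hP : ∀ y x, P y x → P (y + d) (σ^[d] x)) (hex : ∀ y, ∃ x, σ^[b.lcm d] x = x ∧ P y x) :
    ∃ f : ZMod b → T, (∀ y, f (y + d) = σ^[d] (f y)) ∧ ∀ y, P y (f y) := by
  choose x hx hPx using hex
  let H := AddSubgroup.zmultiples (d : ZMod b)
  let rep (y : ZMod b) : ZMod b := (QuotientAddGroup.mk y : ZMod b ⧸ H).out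
  have hrep (y : ZMod b) : ∃ i : ℕ, y = rep y + i * d := by
    have : -rep y + y ∈ H := QuotientAddGroup.eq.1 (QuotientAddGroup.out_eq' _)
    obtain ⟨i, hi⟩ := exists_natCast_mul_of_mem_zmultiples this
    exact ⟨i, by rw [← hi]; abel⟩
  have hrep' (y : ZMod b) : rep (y + d) = rep y := by
    refine congrArg Quotient.out (QuotientAddGroup.eq.2 ?_)
    simpa using H.neg_mem (AddSubgroup.mem_zmultiples (d : ZMod b))
  choose i hi using hrep
  refine ⟨fun y => σ^[i y * d] (x (rep y)), fun y => ?_, fun y => ?_⟩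
  · change σ^[i (y + d) * d] (x (rep (y + d))) = σ^[d] (σ^[i y * d] (x (rep y)))
    rw [← Function.iterate_add_apply, hrep']
    refine iterate_eq_of_modEq (hx _) ?_
    -- The two exponents agree modulo b, since both carry the representative to `y + d`, and modulo
    -- d, since both are multiples of d.
    refine modEq_lcm ?_ ?_
    · rw [← ZMod.natCast_eq_natCast_iff]
      have := hi (y + d)
      rw [hrep'] at this
      push_cast
      have h2 := hi y
      linear_combination h2 - this
    · refine (Nat.modEq_zero_iff_dvd.2 (Dvd.intro_left _ rfl)).trans ?_
      exact (Nat.modEq_zero_iff_dvd.2 ⟨i y + 1, by ring⟩).symm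
  · have hj (j : ℕ) : P (rep y + j * d) (σ^[j * d] (x (rep y))) := by
      induction j with
      | zero => simpa using hPx _
      | succ j ih =>
        have := hP _ _ ih
        rw [← Function.iterate_add_apply] at this
        convert this using 1
        · push_cast; ring
        · congr 2; ring
    rw [hi y]
    have := hj (i y)
    rwa [← hi y] at this ⊢

lemma invariant_add_mul {T : Type*} {b d : ℕ} {m : ZMod b → T} (hm : ∀ y, m (y + d) = m y)
    (y : ZMod b) (i : ℕ) : m (y + i * d) = m y := by
  induction i with
  | zero => simp
  | succ i ih => rw [← ih, ← hm (y + i * d)]; congr 1; push_cast; ring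

lemma sum_zmod_eq_sum_range {b : ℕ} [NeZero b] {M : Type*} [AddCommMonoid M] (f : ZMod b → M) :
    ∑ y, f y = ∑ i ∈ Finset.range b, f i := by
  refine Finset.sum_nbij' (fun y => y.val) (fun i => (i : ZMod b)) ?_ ?_ ?_ ?_ ?_
  · intro y _; simpa using ZMod.val_lt y
  · simp
  · simp
  · intro i hi; exact ZMod.val_cast_of_lt (by simpa using hi)
  · simp

lemma sum_range_mul {M : Type*} [AddCommMonoid M] (f : ℕ → M) (q g : ℕ) :
    ∑ i ∈ Finset.range (q * g), f i = ∑ i ∈ Finset.range q, ∑ j ∈ Finset.range g, f (i * g + j) := by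
  induction q with
  | zero => simp
  | succ q ih => rw [Nat.succ_mul, Finset.sum_range_add, ih, Finset.sum_range_succ]

lemma sum_range_mul_of_periodic {M : Type*} [AddCommMonoid M] {f : ℕ → M} {g : ℕ}
    (hf : ∀ i, f (i + g) = f i) (q : ℕ) :
    ∑ i ∈ Finset.range (q * g), f i = q • ∑ i ∈ Finset.range g, f i := by
  have hfq (q i : ℕ) : f (q * g + i) = f i := by
    induction q with
    | zero => simp
    | succ q ih => rw [← ih, ← hf (q * g + i)]; congr 1; ring
  rw [sum_range_mul]
  simp only [hfq, Finset.sum_const, Finset.card_range]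

/-- By Bezout `m` has period gcd(b,d), so the sum over `ZMod b` is b/gcd(b,d) times the sum over one
period. -/
lemma quotOrder_dvd_sum {b d : ℕ} [NeZero b] {m : ZMod b → ℤ} (hm : ∀ y, m (y + d) = m y) :
    (quotOrder b d : ℤ) ∣ ∑ y, m y := by
  have hg : ∃ i : ℕ, ((b.gcd d : ℕ) : ZMod b) = i * d := by
    refine exists_natCast_mul_of_mem_zmultiples ⟨b.gcdB d, ?_⟩
    have := congrArg (fun z : ℤ => (z : ZMod b)) (Nat.gcd_eq_gcd_ab b d)
    push_cast at this
    simp only [CharP.cast_eq_zero, zero_mul, zero_add] at this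
    simp only [zsmul_eq_mul]
    rw [this, mul_comm]
  obtain ⟨i, hi⟩ := hg
  have hper (j : ℕ) : m ((j + b.gcd d : ℕ) : ZMod b) = m (j : ZMod b) := by
    rw [Nat.cast_add, hi, invariant_add_mul hm]
  have h := sum_range_mul_of_periodic (f := fun j => m (j : ZMod b)) hper (b / b.gcd d)
  rw [Nat.div_mul_cancel (Nat.gcd_dvd_left b d)] at h
  rw [sum_zmod_eq_sum_range, h, nsmul_eq_mul]
  exact dvd_mul_right _ _

/-- The indicator function of the subgroup generated by d; it shows that the divisibility in
`quotOrder_dvd_sum` is sharp. -/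
lemma exists_invariant_sum_eq (b d : ℕ) [NeZero b] :
    ∃ e : ZMod b → ℤ, (∀ y, e (y + d) = e y) ∧ ∑ y, e y = quotOrder b d := by
  classical
  refine ⟨fun y => if y ∈ AddSubgroup.zmultiples (d : ZMod b) then 1 else 0, fun y => ?_, ?_⟩
  · simp only [AddSubgroup.add_mem_cancel_right _ (AddSubgroup.mem_zmultiples (d : ZMod b))]
  · rw [Finset.sum_boole, quotOrder, ← ZMod.addOrderOf_coe d (NeZero.ne b), ← Nat.card_zmultiples,
      Nat.card_eq_fintype_card, Fintype.card_subtype]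

/-- Partial sums of `m` are a primitive. They are b-periodic because the total is 0. They are
d-periodic because adding up b·d consecutive values in two ways gives b · S d = d · S b = 0. -/
lemma exists_coboundary {b d : ℕ} [NeZero b] {m : ZMod b → ℤ} (hm : ∀ y, m (y + d) = m y)
    (h0 : ∑ y, m y = 0) :
    ∃ m' : ZMod b → ℤ, (∀ y, m' (y + d) = m' y) ∧ ∀ y, m y = m' y - m' (y - 1) := by
  let S (j : ℕ) : ℤ := ∑ i ∈ Finset.range j, m (i : ZMod b)
  have hb : S b = 0 := by rw [← h0, sum_zmod_eq_sum_range]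
  have hS {P : ℕ} (hP : ∀ j : ℕ, m ((j + P : ℕ) : ZMod b) = m (j : ZMod b)) (h : S P = 0) (j : ℕ) :
      S (j + P) = S j := by
    change ∑ i ∈ Finset.range (j + P), _ = _
    rw [add_comm, Finset.sum_range_add]
    change S P + _ = _
    rw [h, zero_add]
    exact Finset.sum_congr rfl fun i _ => by rw [add_comm P i, hP]
  have hmd (j : ℕ) : m ((j + d : ℕ) : ZMod b) = m (j : ZMod b) := by rw [Nat.cast_add, hm]
  have hmb (j : ℕ) : m ((j + b : ℕ) : ZMod b) = m (j : ZMod b) := by simp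
  have hd : S d = 0 := by
    have h1 := sum_range_mul_of_periodic (f := fun j => m (j : ZMod b)) hmd b
    have h2 := sum_range_mul_of_periodic (f := fun j => m (j : ZMod b)) hmb d
    rw [mul_comm b d] at h1
    rw [h1, nsmul_eq_mul, nsmul_eq_mul] at h2
    change (b : ℤ) * S d = d * S b at h2
    rw [hb, mul_zero] at h2
    exact (mul_eq_zero.1 h2).resolve_left (by exact_mod_cast NeZero.ne b)
  have hSb (j : ℕ) : S ((j : ZMod b).val + 1) = S (j + 1) := by
    rw [ZMod.val_natCast]
    conv_rhs => rw [← Nat.mod_add_div j b]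
    generalize j / b = q
    induction q with
    | zero => simp
    | succ q ih => rw [ih, ← hS hmb hb]; congr 1; ring
  -- The index is raised by one so that the partial sum at `y` includes the term `m y`.
  refine ⟨fun y => S (y.val + 1), fun y => ?_, fun y => ?_⟩
  · have := hSb (y.val + d)
    rw [Nat.cast_add, ZMod.natCast_zmod_val] at this
    change S ((y + d).val + 1) = _
    rw [this, add_right_comm, hS hmd hd]
  · obtain ⟨j, rfl⟩ : ∃ j : ℕ, ((j + 1 : ℕ) : ZMod b) = y :=
      ⟨(y - 1).val, by rw [Nat.cast_add, ZMod.natCast_zmod_val]; simp⟩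
    have : ((j + 1 : ℕ) : ZMod b) - 1 = (j : ZMod b) := by simp
    change _ = S (((j + 1 : ℕ) : ZMod b).val + 1) - S ((((j + 1 : ℕ) : ZMod b) - 1).val + 1)
    rw [this, hSb, hSb]
    change _ = (∑ i ∈ Finset.range (j + 1 + 1), m (i : ZMod b)) - _
    rw [Finset.sum_range_succ]
    simp [S]

/-! ## Complexes of groups with an endomorphism -/

/-- A chain complex of abelian groups, given as a single group with a differential `d`
and a grading, together with a compatible endomorphism `t`. -/
structure GComplex where
  /-- the underlying group -/
  A : Type
  [grp : AddCommGroup A]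
  /-- the action of the generator of the cyclic group -/
  t : A →+ A
  /-- the differential -/
  d : A →+ A
  /-- the homogeneous elements -/
  gr : ℤ → AddSubgroup A
  t_d : ∀ x, t (d x) = d (t x)
  d_d : ∀ x, d (d x) = 0
  t_mem : ∀ {k x}, x ∈ gr k → t x ∈ gr k
  d_mem : ∀ {k x}, x ∈ gr k → d x ∈ gr (k - 1)
  gr_neg : ∀ {k x}, k < 0 → x ∈ gr k → x = 0

namespace GComplex

attribute [instance] GComplex.grp

variable (K : GComplex)

lemma iterate_t_d (i : ℕ) (x : K.A) : K.t^[i] (K.d x) = K.d (K.t^[i] x) := by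
  induction i generalizing x with
  | zero => rfl
  | succ i ih => rw [Function.iterate_succ_apply, K.t_d, ih, Function.iterate_succ_apply]

lemma iterate_t_mem {k : ℤ} {x : K.A} (hx : x ∈ K.gr k) (i : ℕ) : K.t^[i] x ∈ K.gr k := by
  induction i with
  | zero => exact hx
  | succ i ih => rw [Function.iterate_succ_apply']; exact K.t_mem ih

/-- The elements of degree `k` fixed by `t ^ e`. -/
def F (k : ℤ) (e : ℕ) : AddSubgroup K.A where
  carrier := {x | x ∈ K.gr k ∧ K.t^[e] x = x}
  zero_mem' := ⟨zero_mem _, iterate_map_zero _ _⟩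
  add_mem' hx hy := ⟨add_mem hx.1 hy.1, by rw [iterate_map_add, hx.2, hy.2]⟩
  neg_mem' hx := ⟨neg_mem hx.1, by rw [iterate_map_neg, hx.2]⟩

/-- The cycles of degree `k` fixed by `t ^ e`. -/
def Z (k : ℤ) (e : ℕ) : AddSubgroup K.A := K.F k e ⊓ K.d.ker

/-- The boundaries of elements of degree `k + 1` fixed by `t ^ e`. -/
def B (k : ℤ) (e : ℕ) : AddSubgroup K.A := (K.F (k + 1) e).map K.d

variable {K} {k : ℤ} {e : ℕ} {x y : K.A}

lemma mem_Z : x ∈ K.Z k e ↔ x ∈ K.gr k ∧ K.t^[e] x = x ∧ K.d x = 0 :=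
  and_assoc

lemma mem_B : x ∈ K.B k e ↔ ∃ y ∈ K.gr (k + 1), K.t^[e] y = y ∧ K.d y = x :=
  ⟨fun ⟨y, hy, h⟩ => ⟨y, hy.1, hy.2, h⟩, fun ⟨y, h₁, h₂, h⟩ => ⟨y, ⟨h₁, h₂⟩, h⟩⟩

lemma B_le_Z : K.B k e ≤ K.Z k e := by
  rintro _ ⟨y, hy, rfl⟩
  refine mem_Z.2 ⟨by simpa using K.d_mem hy.1, ?_, K.d_d y⟩
  rw [iterate_t_d, hy.2]

lemma iterate_mul_fixed {i : ℕ} (h : K.t^[e] x = x) : K.t^[i * e] x = x :=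
  (show Function.IsPeriodicPt K.t e x from h).const_mul i

lemma F_le_F {e' : ℕ} (h : e ∣ e') : K.F k e ≤ K.F k e' := fun x hx => by
  obtain ⟨i, rfl⟩ := h
  exact ⟨hx.1, by rw [mul_comm]; exact iterate_mul_fixed hx.2⟩

lemma Z_le_Z {e' : ℕ} (h : e ∣ e') : K.Z k e ≤ K.Z k e' := inf_le_inf_right _ (F_le_F h)

lemma B_le_B {e' : ℕ} (h : e ∣ e') : K.B k e ≤ K.B k e' := AddSubgroup.map_mono (F_le_F h)

/-- The cycle `x` of degree `k` generates the homology at each `e`, which is cyclic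
of order `quotOrder c e`. -/
structure Gen (K : GComplex) (k : ℤ) (c : ℕ) (x : K.A) : Prop where
  mem : x ∈ K.Z k 1
  gen : ∀ e, 0 < e → ∀ z ∈ K.Z k e, ∃ m : ℤ, z - m • x ∈ K.B k e
  zsmul_mem : ∀ e, 0 < e → ∀ m : ℤ, m • x ∈ K.B k e ↔ (quotOrder c e : ℤ) ∣ m

/-- The homology in degree `k` vanishes at each `e`. -/
def Acyclic (K : GComplex) (k : ℤ) : Prop := ∀ e, 0 < e → K.Z k e ≤ K.B k e

/-- The zero group is treated as ℤ/I_1, so that degrees outside the range of `K` need no separate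
arguments. -/
lemma gen_zero (h : ∀ x ∈ K.gr k, x = 0) : Gen K k 1 0 where
  mem := zero_mem _
  gen e _ z hz := ⟨0, by rw [h z hz.1.1]; simp⟩
  zsmul_mem e _ m := by simp [quotOrder_one_left]

lemma acyclic_of_eq_zero (h : ∀ x ∈ K.gr k, x = 0) : Acyclic K k := fun e _ z hz => by
  rw [h z hz.1.1]; exact zero_mem _

/-! ### Equivariant functions -/

/-- Functions `f` on `ZMod b` with `f (y + e) = t ^ e f(y)`. -/
def Eqv (K : GComplex) (b e : ℕ) : AddSubgroup (ZMod b → K.A) where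
  carrier := {f | ∀ y, f (y + e) = K.t^[e] (f y)}
  zero_mem' _ := (iterate_map_zero _ _).symm
  add_mem' hf hg y := by rw [Pi.add_apply, Pi.add_apply, hf, hg, iterate_map_add]
  neg_mem' hf y := by rw [Pi.neg_apply, Pi.neg_apply, hf, iterate_map_neg]

variable {b : ℕ}

/-- Translation by lcm(b,e), a multiple of e, is the identity on `ZMod b`. So the values of an
equivariant function at level e live at level lcm(b,e). -/
lemma eqv_fixed {f : ZMod b → K.A} (hf : f ∈ Eqv K b e) (y : ZMod b) :
    K.t^[b.lcm e] (f y) = f y := by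
  obtain ⟨i, hi⟩ := Nat.dvd_lcm_right b e
  have h (i : ℕ) : f (y + i * e) = K.t^[i * e] (f y) := by
    induction i with
    | zero => simp
    | succ i ih =>
      have := hf (y + i * e)
      rw [ih, ← Function.iterate_add_apply] at this
      convert this using 2
      · push_cast; ring
      · ring
  have h2 := h i
  rw [← Nat.cast_mul, mul_comm i, ← hi,
    (ZMod.natCast_eq_zero_iff _ _).2 (Nat.dvd_lcm_left b e), add_zero] at h2
  exact h2.symm

lemma eqv_shift {f : ZMod b → K.A} (hf : f ∈ Eqv K b e) :
    (fun y => f (y - 1)) ∈ Eqv K b e := fun y => by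
  change f (y + e - 1) = K.t^[e] (f (y - 1))
  rw [← hf, sub_add_eq_add_sub]

lemma eqv_const (hx : K.t^[e] x = x) : (fun _ => x) ∈ Eqv K b e := fun _ => hx.symm

lemma eqv_smul {m : ZMod b → ℤ} (hm : ∀ y, m (y + e) = m y) (hx : K.t^[e] x = x) :
    (fun y => m y • x) ∈ Eqv K b e := fun y => by
  change m (y + e) • x = K.t^[e] (m y • x)
  rw [hm, iterate_map_zsmul, hx]

variable [NeZero b]

lemma eqv_sum {f : ZMod b → K.A} (hf : f ∈ Eqv K b e) : K.t^[e] (∑ y, f y) = ∑ y, f y := by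
  have h : K.t^[e] (∑ y, f y) = ∑ y, K.t^[e] (f y) := by
    exact map_sum (⟨⟨K.t^[e], iterate_map_zero _ _⟩, iterate_map_add _ _⟩ : K.A →+ K.A) f _
  rw [h, ← Equiv.sum_comp (Equiv.addRight (e : ZMod b)) f]
  exact Finset.sum_congr rfl fun y _ => (hf y).symm

/-- Pointwise primitives at level lcm(b,e) can be chosen equivariantly by `exists_equivariant`. -/
lemma eqv_lift {f : ZMod b → K.A} (hf : f ∈ Eqv K b e) (hB : ∀ y, f y ∈ K.B k (b.lcm e)) :
    ∃ f' ∈ Eqv K b e, (∀ y, f' y ∈ K.gr (k + 1)) ∧ ∀ y, K.d (f' y) = f y := by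
  obtain ⟨f', h, h'⟩ := exists_equivariant (K.t) (b := b) (d := e)
    (fun y x => x ∈ K.gr (k + 1) ∧ K.d x = f y)
    (fun y x hx => ⟨iterate_t_mem K hx.1 _, by rw [← iterate_t_d, hx.2, hf]⟩)
    (fun y => by
      obtain ⟨x, hx, hx', hx''⟩ := mem_B.1 (hB y)
      exact ⟨x, hx', hx, hx''⟩)
  exact ⟨f', h, fun y => (h' y).1, fun y => (h' y).2⟩

lemma eqv_lift_gen {c : ℕ} (hx : Gen K k c x) (he : 0 < e) {f : ZMod b → K.A} (hf : f ∈ Eqv K b e)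
    (hgr : ∀ y, f y ∈ K.gr k) (hd : ∀ y, K.d (f y) = 0) :
    ∃ m : ZMod b → ℤ, (∀ y, m (y + e) = m y) ∧ ∃ f' ∈ Eqv K b e, (∀ y, f' y ∈ K.gr (k + 1)) ∧
      ∀ y, f y = m y • x + K.d (f' y) := by
  have ht : K.t^[e] x = x := (mem_Z.1 (Z_le_Z (one_dvd e) hx.mem)).2.1
  have hit (q : ℤ × K.A) (i : ℕ) : (Prod.map id K.t)^[i] q = (q.1, K.t^[i] q.2) := by
    rw [Prod.map_iterate, Function.iterate_id]; rfl
  -- The coefficient and the correction are chosen together as a pair, with trivial action on the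
  -- coefficient, so that both come out equivariant.
  obtain ⟨f', h, h'⟩ := exists_equivariant (Prod.map id K.t : ℤ × K.A → _) (b := b) (d := e)
    (fun y q => q.2 ∈ K.gr (k + 1) ∧ f y = q.1 • x + K.d q.2)
    (fun y q hq => by
      rw [hit]
      refine ⟨iterate_t_mem K hq.1 _, ?_⟩
      rw [hf, hq.2, iterate_map_add, iterate_map_zsmul, ht, iterate_t_d])
    (fun y => by
      obtain ⟨m, hm⟩ := hx.gen _ (Nat.lcm_pos (NeZero.pos b) he) (f y)
        (mem_Z.2 ⟨hgr y, eqv_fixed hf y, hd y⟩)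
      obtain ⟨w, hw, hw', hw''⟩ := mem_B.1 hm
      exact ⟨(m, w), by rw [hit, hw'], hw, by rw [hw'']; abel⟩)
  refine ⟨fun y => (f' y).1, fun y => ?_, fun y => (f' y).2, fun y => ?_, fun y => (h' y).1,
    fun y => (h' y).2⟩
  · change (f' (y + e)).1 = _
    rw [h, hit]
  · change (f' (y + e)).2 = _
    rw [h, hit]

/-! ### The product with the sphere -/

/-- The action of `t` on functions. -/
def funT (K : GComplex) (b : ℕ) : (ZMod b → K.A) →+ (ZMod b → K.A) where
  toFun f y := K.t (f (y - 1))
  map_zero' := by ext; simp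
  map_add' f g := by ext; simp

omit [NeZero b] in
lemma funT_iterate (f : ZMod b → K.A) (i : ℕ) (y : ZMod b) :
    (funT K b)^[i] f y = K.t^[i] (f (y - i)) := by
  induction i generalizing y with
  | zero => simp
  | succ i ih =>
    rw [Function.iterate_succ_apply', Function.iterate_succ_apply']
    change K.t ((funT K b)^[i] f (y - 1)) = _
    rw [ih]
    congr 3
    push_cast; ring

omit [NeZero b] in
lemma funT_iterate_eq (f : ZMod b → K.A) : (funT K b)^[e] f = f ↔ f ∈ Eqv K b e := by
  constructor
  · intro h y
    conv_lhs => rw [← h]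
    rw [funT_iterate, add_sub_cancel_right]
  · intro h
    ext y
    rw [funT_iterate, ← h, sub_add_cancel]

/-- The complex `S^{λ_b} □ K`. -/
def L (b : ℕ) [NeZero b] (K : GComplex) : GComplex where
  A := K.A × (ZMod b → K.A) × (ZMod b → K.A)
  t := K.t.prodMap ((funT K b).prodMap (funT K b))
  d :=
    -- The sum over `ZMod b` is the pushforward along π, the difference of shifts is `id - Rt`, and
    -- the minus sign in the middle is the sign (-1)^p for p = 1.
    { toFun := fun x => (K.d x.1 + ∑ y, x.2.1 y, fun y => - K.d (x.2.1 y) + (x.2.2 y - x.2.2 (y - 1)),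
        fun y => K.d (x.2.2 y))
      map_zero' := by ext <;> simp
      map_add' := fun x y => by
        ext
        · simp only [Prod.fst_add, Prod.snd_add, Pi.add_apply, map_add, Finset.sum_add_distrib]
          abel
        · simp only [Prod.fst_add, Prod.snd_add, Pi.add_apply, map_add]
          abel
        · simp only [Prod.snd_add, Pi.add_apply, map_add] }
  gr k :=
    { carrier := {x | x.1 ∈ K.gr k ∧ (∀ y, x.2.1 y ∈ K.gr (k - 1)) ∧ ∀ y, x.2.2 y ∈ K.gr (k - 2)}
      zero_mem' := ⟨zero_mem _, fun _ => zero_mem _, fun _ => zero_mem _⟩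
      add_mem' := fun hx hy => ⟨add_mem hx.1 hy.1, fun y => add_mem (hx.2.1 y) (hy.2.1 y),
        fun y => add_mem (hx.2.2 y) (hy.2.2 y)⟩
      neg_mem' := fun hx => ⟨neg_mem hx.1, fun y => neg_mem (hx.2.1 y),
        fun y => neg_mem (hx.2.2 y)⟩ }
  t_d x := by
    refine Prod.ext ?_ (Prod.ext (funext fun y => ?_) (funext fun y => ?_))
    · change K.t (K.d x.1 + ∑ y, x.2.1 y) = K.d (K.t x.1) + ∑ y, K.t (x.2.1 (y - 1))
      rw [map_add, K.t_d, map_sum, ← Equiv.sum_comp (Equiv.subRight (1 : ZMod b))]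
      rfl
    · change K.t (- K.d (x.2.1 (y - 1)) + (x.2.2 (y - 1) - x.2.2 (y - 1 - 1))) =
        - K.d (K.t (x.2.1 (y - 1))) + (K.t (x.2.2 (y - 1)) - K.t (x.2.2 (y - 1 - 1)))
      simp [K.t_d]
    · exact K.t_d _
  d_d x := by
    refine Prod.ext ?_ (Prod.ext (funext fun y => ?_) (funext fun y => ?_))
    · change K.d (K.d x.1 + ∑ y, x.2.1 y) +
        ∑ y, (- K.d (x.2.1 y) + (x.2.2 y - x.2.2 (y - 1))) = 0
      have h := Equiv.sum_comp (Equiv.subRight (1 : ZMod b)) x.2.2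
      simp only [Equiv.subRight_apply] at h
      rw [map_add, K.d_d, map_sum, Finset.sum_add_distrib, Finset.sum_sub_distrib, h]
      simp
    · change - K.d (- K.d (x.2.1 y) + (x.2.2 y - x.2.2 (y - 1))) +
        (K.d (x.2.2 y) - K.d (x.2.2 (y - 1))) = 0
      simp [K.d_d]
    · exact K.d_d _
  t_mem hx := ⟨K.t_mem hx.1, fun _ => K.t_mem (hx.2.1 _), fun _ => K.t_mem (hx.2.2 _)⟩
  d_mem {k x} hx := ⟨add_mem (K.d_mem hx.1) (sum_mem fun y _ => hx.2.1 y),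
    fun y => add_mem (neg_mem (K.d_mem (hx.2.1 y))) (by
      rw [sub_sub, one_add_one_eq_two]; exact sub_mem (hx.2.2 y) (hx.2.2 _)),
    fun y => by rw [sub_right_comm]; exact K.d_mem (hx.2.2 y)⟩
  gr_neg hk hx := Prod.ext (K.gr_neg hk hx.1) (Prod.ext
    (funext fun y => K.gr_neg (by omega) (hx.2.1 y)) (funext fun y => K.gr_neg (by omega) (hx.2.2 y)))

/-- The element of `S^{λ_b} □ K` with given components. -/
def tri (a : K.A) (f h : ZMod b → K.A) : (L b K).A := (a, f, h)

lemma exists_eq_tri (x : (L b K).A) : ∃ a f h, x = tri a f h := ⟨x.1, x.2.1, x.2.2, rfl⟩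

lemma tri_congr {a a' : K.A} {f f' h h' : ZMod b → K.A} (h₁ : a = a') (h₂ : ∀ y, f y = f' y)
    (h₃ : ∀ y, h y = h' y) : (tri a f h : (L b K).A) = tri a' f' h' := by
  rw [h₁, funext h₂, funext h₃]

lemma tri_eq_tri {a a' : K.A} {f f' h h' : ZMod b → K.A} :
    (tri a f h : (L b K).A) = tri a' f' h' ↔ a = a' ∧ f = f' ∧ h = h' :=
  ⟨fun h => ⟨congrArg (fun x : K.A × (ZMod b → K.A) × (ZMod b → K.A) => x.1) h,
    congrArg (fun x : K.A × (ZMod b → K.A) × (ZMod b → K.A) => x.2.1) h,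
    congrArg (fun x : K.A × (ZMod b → K.A) × (ZMod b → K.A) => x.2.2) h⟩,
    fun ⟨h₁, h₂, h₃⟩ => by rw [h₁, h₂, h₃]⟩

lemma tri_add (a a' : K.A) (f f' h h' : ZMod b → K.A) :
    (tri a f h + tri a' f' h' : (L b K).A) = tri (a + a') (f + f') (h + h') := rfl

lemma tri_sub (a a' : K.A) (f f' h h' : ZMod b → K.A) :
    (tri a f h - tri a' f' h' : (L b K).A) = tri (a - a') (f - f') (h - h') := rfl

lemma tri_zsmul (m : ℤ) (a : K.A) (f h : ZMod b → K.A) :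
    (m • tri a f h : (L b K).A) = tri (m • a) (m • f) (m • h) := rfl

lemma L_d (a : K.A) (f h : ZMod b → K.A) : (L b K).d (tri a f h) =
    tri (K.d a + ∑ y, f y) (fun y => - K.d (f y) + (h y - h (y - 1))) (fun y => K.d (h y)) := rfl

lemma L_t_iterate (a : K.A) (f h : ZMod b → K.A) :
    (L b K).t^[e] (tri a f h) = tri (K.t^[e] a) ((funT K b)^[e] f) ((funT K b)^[e] h) := by
  change (Prod.map K.t (Prod.map (funT K b) (funT K b)))^[e] _ = _
  rw [Prod.map_iterate, Prod.map_iterate]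
  rfl

lemma mem_F_L {a : K.A} {f h : ZMod b → K.A} : tri a f h ∈ (L b K).F k e ↔
    (a ∈ K.F k e) ∧ (f ∈ Eqv K b e ∧ ∀ y, f y ∈ K.gr (k - 1)) ∧
      (h ∈ Eqv K b e ∧ ∀ y, h y ∈ K.gr (k - 2)) := by
  have h₁ : tri a f h ∈ (L b K).F k e ↔ (a ∈ K.gr k ∧ (∀ y, f y ∈ K.gr (k - 1)) ∧
    ∀ y, h y ∈ K.gr (k - 2)) ∧ (L b K).t^[e] (tri a f h) = tri a f h := Iff.rfl
  have h₂ : a ∈ K.F k e ↔ a ∈ K.gr k ∧ K.t^[e] a = a := Iff.rfl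
  rw [h₁, h₂, L_t_iterate, tri_eq_tri, funT_iterate_eq, funT_iterate_eq]
  tauto

/-- Multiplication by the Euler class. -/
def aMul (b : ℕ) [NeZero b] (K : GComplex) : K.A →+ (L b K).A where
  toFun x := tri x 0 0
  map_zero' := rfl
  map_add' _ _ := by rw [tri_add, add_zero]

/-- Multiplication by the orientation class. -/
def uMul (b : ℕ) [NeZero b] (K : GComplex) : K.A →+ (L b K).A where
  toFun x := tri 0 0 fun _ => x
  map_zero' := rfl
  map_add' _ _ := by rw [tri_add, add_zero, add_zero]; rfl

lemma aMul_apply : aMul b K x = tri x 0 0 := rfl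

lemma uMul_apply : uMul b K x = tri 0 0 fun _ => x := rfl

lemma d_aMul : (L b K).d (aMul b K x) = aMul b K (K.d x) := by
  rw [aMul_apply, L_d, aMul_apply]
  exact tri_congr (by simp) (by simp) (by simp)

lemma d_uMul : (L b K).d (uMul b K x) = uMul b K (K.d x) := by
  rw [uMul_apply, L_d, uMul_apply]
  exact tri_congr (by simp) (by simp) (by simp)

lemma aMul_mem_F (hx : x ∈ K.F k e) : aMul b K x ∈ (L b K).F k e :=
  mem_F_L.2 ⟨hx, ⟨zero_mem _, fun _ => zero_mem _⟩, ⟨zero_mem _, fun _ => zero_mem _⟩⟩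

lemma uMul_mem_F (hx : x ∈ K.F (k - 2) e) : uMul b K x ∈ (L b K).F k e :=
  mem_F_L.2 ⟨zero_mem _, ⟨zero_mem _, fun _ => zero_mem _⟩, ⟨eqv_const hx.2, fun _ => hx.1⟩⟩

lemma aMul_mem_Z (hx : x ∈ K.Z k e) : aMul b K x ∈ (L b K).Z k e :=
  ⟨aMul_mem_F hx.1, by
    change (L b K).d _ = 0
    rw [d_aMul, show K.d x = 0 from hx.2, map_zero]⟩

lemma uMul_mem_Z (hx : x ∈ K.Z (k - 2) e) : uMul b K x ∈ (L b K).Z k e :=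
  ⟨uMul_mem_F hx.1, by
    change (L b K).d _ = 0
    rw [d_uMul, show K.d x = 0 from hx.2, map_zero]⟩

lemma aMul_mem_B (hx : x ∈ K.B k e) : aMul b K x ∈ (L b K).B k e := by
  obtain ⟨w, hw, rfl⟩ := hx
  exact ⟨_, aMul_mem_F hw, d_aMul⟩

lemma uMul_mem_B (hx : x ∈ K.B (k - 2) e) : uMul b K x ∈ (L b K).B k e := by
  obtain ⟨w, hw, rfl⟩ := hx
  exact ⟨_, uMul_mem_F (by rwa [sub_add_eq_add_sub] at hw), d_uMul⟩

end GComplex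

namespace GComplex

variable {K : GComplex} {k : ℤ} {b e : ℕ} [NeZero b] {x y : K.A} {c : ℕ}

/-! ### The homology of the product with the sphere -/

lemma aMul_mem_Z_iff : aMul b K x ∈ (L b K).Z k e ↔ x ∈ K.Z k e := by
  refine ⟨fun h => ⟨(mem_F_L.1 h.1).1, ?_⟩, aMul_mem_Z⟩
  have h2 : (L b K).d (aMul b K x) = 0 := h.2
  rw [d_aMul] at h2
  exact (tri_eq_tri.1 h2).1

lemma d_tri_mem_B {p : K.A} {q r : ZMod b → K.A} (hp : p ∈ K.F (k + 1) e) (hq : q ∈ Eqv K b e)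
    (hq' : ∀ y, q y ∈ K.gr k) (hr : r ∈ Eqv K b e) (hr' : ∀ y, r y ∈ K.gr (k - 1)) :
    (L b K).d (tri p q r) ∈ (L b K).B k e := by
  refine ⟨_, mem_F_L.2 ⟨hp, ⟨hq, fun y => ?_⟩, ⟨hr, fun y => ?_⟩⟩, rfl⟩
  · simpa using hq' y
  · rw [show k + 1 - 2 = k - 1 by ring]; exact hr' y

lemma tri_mem_Z {a : K.A} {f h : ZMod b → K.A} (H : tri a f h ∈ (L b K).Z k e) :
    (a ∈ K.F k e ∧ (f ∈ Eqv K b e ∧ ∀ y, f y ∈ K.gr (k - 1)) ∧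
      (h ∈ Eqv K b e ∧ ∀ y, h y ∈ K.gr (k - 2))) ∧ K.d a + ∑ y, f y = 0 ∧
      (∀ y, K.d (f y) = h y - h (y - 1)) ∧ ∀ y, K.d (h y) = 0 := by
  refine ⟨mem_F_L.1 H.1, ?_⟩
  have h2 : (L b K).d (tri a f h) = tri 0 0 0 := H.2
  rw [L_d, tri_eq_tri] at h2
  refine ⟨h2.1, fun y => ?_, fun y => congrFun h2.2.2 y⟩
  have := congrFun h2.2.1 y
  exact (neg_add_eq_zero.1 this)

lemma sum_sub_shift (f : ZMod b → K.A) : ∑ y, (f y - f (y - 1)) = 0 := by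
  have h := Equiv.sum_comp (Equiv.subRight (1 : ZMod b)) f
  simp only [Equiv.subRight_apply] at h
  rw [Finset.sum_sub_distrib, h, sub_self]

lemma sum_mem_F {f : ZMod b → K.A} (hf : f ∈ Eqv K b e) (h : ∀ y, f y ∈ K.gr k) :
    ∑ y, f y ∈ K.F k e := ⟨sum_mem fun y _ => h y, eqv_sum hf⟩

lemma Gen.iterate_eq (hx : Gen K k c x) (e : ℕ) : K.t^[e] x = x :=
  (mem_Z.1 (Z_le_Z (one_dvd e) hx.mem)).2.1

lemma Gen.mem_gr (hx : Gen K k c x) : x ∈ K.gr k := hx.mem.1.1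

lemma Gen.d_eq (hx : Gen K k c x) : K.d x = 0 := hx.mem.2

/-- Clear a cycle (a, f, h) from the right. The component h bounds because degree k - 2 is acyclic.
The component f then has classes m(y)x in degree k - 1, and the first component of the cycle
equation shows that (∑ m)x bounds at level e. By `quotOrder_lcm_dvd` the function m may be changed,
modulo multiples of x that bound at level lcm(b,e), to have sum 0; it is then a coboundary and comes
from the 2-cell. What remains is a_b times a cycle of degree k in `K`, which bounds. -/
theorem L_acyclic (h₀ : Acyclic K k) (h₂ : Acyclic K (k - 2)) (hx : Gen K (k - 1) c x) :
    Acyclic (L b K) k := by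
  intro e he w hw
  obtain ⟨a, f, h, rfl⟩ := exists_eq_tri w
  obtain ⟨⟨ha, ⟨hf, hf'⟩, ⟨hh, hh'⟩⟩, hda, hdf, hdh⟩ := tri_mem_Z hw
  have hl : 0 < b.lcm e := Nat.lcm_pos (NeZero.pos b) he
  obtain ⟨r, hr, hr', hdr⟩ := eqv_lift hh fun y =>
    h₂ _ hl (mem_Z.2 ⟨hh' y, eqv_fixed hh y, hdh y⟩)
  replace hr' (y) : r y ∈ K.gr (k - 1) := by
    rw [show k - 1 = k - 2 + 1 by ring]; exact hr' y
  obtain ⟨m, hm, q, hq, hq', hdq⟩ := eqv_lift_gen hx he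
    (f := fun y => f y - (r y - r (y - 1))) (sub_mem hf (sub_mem hr (eqv_shift hr)))
    (fun y => sub_mem (hf' y) (sub_mem (hr' _) (hr' _)))
    (fun y => by rw [map_sub, map_sub, hdr, hdr, hdf, sub_self])
  replace hq' (y) : q y ∈ K.gr k := by rw [show k = k - 1 + 1 by ring]; exact hq' y
  have hsum : (∑ y, m y) • x ∈ K.B (k - 1) e := by
    refine mem_B.2 ⟨-(a + ∑ y, q y), ?_, ?_, ?_⟩
    · rw [sub_add_cancel]; exact neg_mem (add_mem ha.1 (sum_mem fun y _ => hq' y))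
    · rw [iterate_map_neg, iterate_map_add, ha.2, eqv_sum hq]
    · have h1 : ∑ y, f y = (∑ y, m y) • x + K.d (∑ y, q y) := by
        have := Finset.sum_congr (rfl : Finset.univ = Finset.univ) fun y _ => hdq y
        rw [Finset.sum_sub_distrib, sum_sub_shift, sub_zero, Finset.sum_add_distrib,
          ← Finset.sum_smul, ← map_sum] at this
        exact this
      rw [h1] at hda
      rw [map_neg, map_add, neg_eq_iff_add_eq_zero, ← hda]
      abel
  obtain ⟨M, hM⟩ := quotOrder_dvd_sum hm
  rw [hx.zsmul_mem e he, hM] at hsum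
  have hMx := (hx.zsmul_mem _ hl _).2 (quotOrder_lcm_dvd (NeZero.pos b) he hsum)
  -- Since ∑ i = `quotOrder b e` and ∑ m = `quotOrder b e` · M, the function m - iM has sum 0, while
  -- (iM)x bounds pointwise because Mx does.
  obtain ⟨i, hi, hi'⟩ := exists_invariant_sum_eq b e
  obtain ⟨m', hm', hmm'⟩ := exists_coboundary (m := fun y => m y - i y * M)
    (fun y => by rw [hm, hi]) (by rw [Finset.sum_sub_distrib, ← Finset.sum_mul, hi', hM, sub_self])
  obtain ⟨q₂, hq₂, hq₂', hdq₂⟩ := eqv_lift (f := fun y => (i y * M) • x)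
    (eqv_smul (fun y => by rw [hi]) (hx.iterate_eq e))
    (fun y => by
      rw [mul_zsmul]; exact zsmul_mem hMx _)
  replace hq₂' (y) : q₂ y ∈ K.gr k := by rw [show k = k - 1 + 1 by ring]; exact hq₂' y
  have hB := d_tri_mem_B (zero_mem _) (neg_mem (add_mem hq hq₂))
    (fun y => neg_mem (add_mem (hq' y) (hq₂' y)))
    (add_mem hr (eqv_smul hm' (hx.iterate_eq e)))
    (fun y => add_mem (hr' y) (zsmul_mem hx.mem_gr (m' y)))
  have key : tri a f h - (L b K).d (tri 0 (-(q + q₂)) (r + fun y => m' y • x)) =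
      aMul b K (a + ∑ y, (q y + q₂ y)) := by
    rw [L_d, tri_sub, aMul_apply]
    refine tri_congr ?_ (fun y => ?_) (fun y => ?_)
    · simp only [Pi.neg_apply, Pi.add_apply, Finset.sum_neg_distrib, map_zero]
      abel
    · have h1 := hdq y
      have h2 := hmm' y
      have h3 : (m y - i y * M) • x = m' y • x - m' (y - 1) • x := by rw [h2, sub_smul]
      simp only [Pi.sub_apply, Pi.add_apply, Pi.neg_apply, map_neg, map_add, Pi.zero_apply,
        neg_neg, hdq₂]
      rw [sub_smul] at h3
      rw [sub_eq_iff_eq_add] at h1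
      rw [h1, sub_eq_iff_eq_add.1 h3]
      abel
    · simp [hdr, hx.d_eq]
  have hZ : aMul b K (a + ∑ y, (q y + q₂ y)) ∈ (L b K).Z k e := by
    rw [← key]; exact sub_mem hw (B_le_Z hB)
  have := aMul_mem_B (b := b) (h₀ e he (aMul_mem_Z_iff.1 hZ))
  rw [← key] at this
  simpa using add_mem this hB

/-- The last component h of a cycle has classes m(y)x at level lcm(b,e). The middle component shows
that h y and h (y - 1) are homologous, so these classes are constant and h contributes m(0) u_b x.
After that the middle component is a cycle in the acyclic degree k - 1, and only an a_b-multiple is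
left. -/
theorem L_decomp (h₁ : Acyclic K (k - 1)) (hx : Gen K (k - 2) c x) (he : 0 < e) {w : (L b K).A}
    (hw : w ∈ (L b K).Z k e) :
    ∃ m : ℤ, ∃ a ∈ K.Z k e, w - (m • uMul b K x + aMul b K a) ∈ (L b K).B k e := by
  obtain ⟨a, f, h, rfl⟩ := exists_eq_tri w
  obtain ⟨⟨ha, ⟨hf, hf'⟩, ⟨hh, hh'⟩⟩, hda, hdf, hdh⟩ := tri_mem_Z hw
  have hl : 0 < b.lcm e := Nat.lcm_pos (NeZero.pos b) he
  have hk : k - 2 + 1 = k - 1 := by ring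
  obtain ⟨m, hm, r, hr, hr', hdr⟩ := eqv_lift_gen hx he hh hh' hdh
  rw [hk] at hr'
  have hstep (y) : (quotOrder c (b.lcm e) : ℤ) ∣ m y - m (y - 1) := by
    rw [← hx.zsmul_mem _ hl]
    refine mem_B.2 ⟨f y - (r y - r (y - 1)), ?_, ?_, ?_⟩
    · rw [hk]; exact sub_mem (hf' y) (sub_mem (hr' _) (hr' _))
    · exact eqv_fixed (sub_mem hf (sub_mem hr (eqv_shift hr))) y
    · rw [map_sub, map_sub, hdf, hdr, hdr, sub_smul]; abel
  have hconst (y) : (quotOrder c (b.lcm e) : ℤ) ∣ m y - m 0 := by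
    obtain ⟨j, rfl⟩ : ∃ j : ℕ, (j : ZMod b) = y := ⟨y.val, ZMod.natCast_zmod_val y⟩
    induction j with
    | zero => simp
    | succ j ih =>
      have := hstep ((j + 1 : ℕ) : ZMod b)
      rw [show ((j + 1 : ℕ) : ZMod b) - 1 = j by simp] at this
      simpa using dvd_add this ih
  obtain ⟨r₂, hr₂, hr₂', hdr₂⟩ := eqv_lift (k := k - 2) (f := fun y => (m y - m 0) • x)
    (eqv_smul (fun y => by rw [hm]) (hx.iterate_eq e))
    (fun y => (hx.zsmul_mem _ hl _).2 (hconst y))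
  rw [hk] at hr₂'
  have hR := add_mem hr hr₂
  have hR' (y) := add_mem (hr' y) (hr₂' y)
  obtain ⟨q, hq, hq', hdq⟩ := eqv_lift (k := k - 1)
    (f := fun y => f y - ((r + r₂) y - (r + r₂) (y - 1)))
    (sub_mem hf (sub_mem hR (eqv_shift hR)))
    (fun y => h₁ _ hl (mem_Z.2 ⟨sub_mem (hf' y) (sub_mem (hR' _) (hR' _)),
      eqv_fixed (sub_mem hf (sub_mem hR (eqv_shift hR))) y, by
        simp only [Pi.add_apply, map_sub, map_add, hdf, hdr, hdr₂, sub_smul]; abel⟩))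
  rw [sub_add_cancel] at hq'
  have hB := d_tri_mem_B (zero_mem _) (neg_mem hq) (fun y => neg_mem (hq' y)) hR hR'
  have key : tri a f h - m 0 • uMul b K x - (L b K).d (tri 0 (-q) (r + r₂)) =
      aMul b K (a + ∑ y, q y) := by
    rw [L_d, uMul_apply, tri_zsmul, tri_sub, tri_sub, aMul_apply]
    refine tri_congr ?_ (fun y => ?_) (fun y => ?_)
    · simp
    · simp only [Pi.sub_apply, Pi.neg_apply, Pi.zero_apply, map_neg, hdq, smul_zero,
        neg_neg]
      abel
    · simp only [Pi.sub_apply, Pi.add_apply, Pi.smul_apply, Pi.zero_apply, map_add, hdr₂, sub_smul,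
        hdr y]
      abel
  have hZ : aMul b K (a + ∑ y, q y) ∈ (L b K).Z k e := by
    rw [← key]
    exact sub_mem (sub_mem hw (zsmul_mem (uMul_mem_Z (Z_le_Z (one_dvd e) hx.mem)) _)) (B_le_Z hB)
  refine ⟨m 0, _, aMul_mem_Z_iff.1 hZ, ?_⟩
  rw [← sub_sub, ← key, sub_sub_cancel]
  exact hB

/-- An a_b-multiple becomes a boundary through the 1-cell, that is, through the sum over Θ_b of an
equivariant function with classes m(z)y. The possible sums of m are exactly the multiples of
`quotOrder b e`. -/
theorem aMul_mem_B_iff (h₁ : Acyclic K (k - 1)) (hy : Gen K k c y) (he : 0 < e) {a : K.A} :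
    aMul b K a ∈ (L b K).B k e ↔ ∃ m : ℤ, a - (quotOrder b e * m) • y ∈ K.B k e := by
  have hl : 0 < b.lcm e := Nat.lcm_pos (NeZero.pos b) he
  have hk : k - 1 + 1 = k := by ring
  constructor
  · rintro ⟨w, hw, hwa⟩
    obtain ⟨p, q, r, rfl⟩ := exists_eq_tri w
    obtain ⟨hp, ⟨hq, hq'⟩, ⟨hr, hr'⟩⟩ := mem_F_L.1 hw
    rw [add_sub_cancel_right] at hq'
    rw [show k + 1 - 2 = k - 1 by ring] at hr'
    rw [L_d, aMul_apply, tri_eq_tri] at hwa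
    obtain ⟨ha, hdq, hdr⟩ := hwa
    replace hdq (y) : K.d (q y) = r y - r (y - 1) := neg_add_eq_zero.1 (congrFun hdq y)
    obtain ⟨s, hs, hs', hds⟩ := eqv_lift hr fun y =>
      h₁ _ hl (mem_Z.2 ⟨hr' y, eqv_fixed hr y, congrFun hdr y⟩)
    rw [hk] at hs'
    obtain ⟨m, hm, q', hq₁, hq₁', hdq'⟩ := eqv_lift_gen hy he
      (f := fun y => q y - (s y - s (y - 1))) (sub_mem hq (sub_mem hs (eqv_shift hs)))
      (fun y => sub_mem (hq' y) (sub_mem (hs' _) (hs' _)))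
      (fun y => by rw [map_sub, map_sub, hds, hds, hdq, sub_self])
    obtain ⟨M, hM⟩ := quotOrder_dvd_sum hm
    refine ⟨M, p + ∑ y, q' y, add_mem hp (sum_mem_F hq₁ hq₁'), ?_⟩
    have h1 : ∑ y, q y = (∑ y, m y) • y + K.d (∑ y, q' y) := by
      have := Finset.sum_congr (rfl : Finset.univ = Finset.univ) fun y _ => hdq' y
      rw [Finset.sum_sub_distrib, sum_sub_shift, sub_zero, Finset.sum_add_distrib,
        ← Finset.sum_smul, ← map_sum] at this
      exact this
    rw [← hM, ← ha, h1, map_add]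
    abel
  · rintro ⟨m, p, hp, hpa⟩
    obtain ⟨i, hi, hi'⟩ := exists_invariant_sum_eq b e
    have hB := d_tri_mem_B (b := b) (q := fun z => (i z * m) • y) hp
      (eqv_smul (fun z => by rw [hi]) (hy.iterate_eq e)) (fun z => zsmul_mem hy.mem_gr _)
      (zero_mem _) (fun y => zero_mem _)
    convert hB using 1
    rw [L_d, aMul_apply, hpa, ← Finset.sum_smul, ← Finset.sum_mul, hi']
    exact tri_congr (by simp) (by simp [hy.d_eq]) (by simp)

/-- The component on the 2-cell shows that m • x must bound at level lcm(b,e). Conversely, let r be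
an equivariant function of primitives of m • x. Its differences r y - r (y - 1) are cycles in an
acyclic degree; primitives q of these differences give the correction v = -∑ q. -/
theorem uMul_mem_B_iff (h₁ : Acyclic K (k - 1)) (hx : Gen K (k - 2) c x) (he : 0 < e) {m : ℤ} :
    (∃ v ∈ K.Z k e, m • uMul b K x - aMul b K v ∈ (L b K).B k e) ↔
      (quotOrder c (b.lcm e) : ℤ) ∣ m := by
  have hl : 0 < b.lcm e := Nat.lcm_pos (NeZero.pos b) he
  rw [← hx.zsmul_mem _ hl]
  constructor
  · rintro ⟨v, -, w, hw, hwa⟩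
    obtain ⟨p, q, r, rfl⟩ := exists_eq_tri w
    obtain ⟨hp, ⟨hq, hq'⟩, ⟨hr, hr'⟩⟩ := mem_F_L.1 hw
    rw [L_d, aMul_apply, uMul_apply, tri_zsmul, tri_sub, tri_eq_tri] at hwa
    refine mem_B.2 ⟨r 0, ?_, eqv_fixed hr 0, ?_⟩
    · rw [show k - 2 + 1 = k + 1 - 2 by ring]; exact hr' 0
    · have := congrFun hwa.2.2 0
      simpa using this
  · intro h
    obtain ⟨r, hr, hr', hdr⟩ := eqv_lift (b := b) (e := e) (k := k - 2) (f := fun _ => m • x)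
      (eqv_const (by rw [iterate_map_zsmul, hx.iterate_eq])) (fun _ => h)
    rw [show k - 2 + 1 = k - 1 by ring] at hr'
    have hR := sub_mem hr (eqv_shift hr)
    obtain ⟨q, hq, hq', hdq⟩ := eqv_lift (k := k - 1) hR fun y =>
      h₁ _ hl (mem_Z.2 ⟨sub_mem (hr' _) (hr' _), eqv_fixed hR y, by
        simp only [Pi.sub_apply, map_sub, hdr, sub_self]⟩)
    rw [sub_add_cancel] at hq'
    refine ⟨- ∑ y, q y, neg_mem ⟨sum_mem_F hq hq', ?_⟩, ?_⟩
    · change K.d _ = 0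
      rw [map_sum]
      simp only [hdq]
      exact sum_sub_shift r
    · have hB := d_tri_mem_B (zero_mem _) hq hq' hr hr'
      convert hB using 1
      rw [L_d, aMul_apply, uMul_apply, tri_zsmul, tri_sub]
      exact tri_congr (by simp) (by simp [hdq]) (by simp [hdr])

end GComplex

lemma exists_dvd_sub_mul_iff {p q : ℕ} {α : ℤ} :
    (∃ m : ℤ, (p : ℤ) ∣ α - q * m) ↔ ((q.gcd p : ℕ) : ℤ) ∣ α := by
  constructor
  · rintro ⟨m, hm⟩
    have h₁ : ((q.gcd p : ℕ) : ℤ) ∣ q := Int.natCast_dvd_natCast.2 (Nat.gcd_dvd_left _ _)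
    have h₂ : ((q.gcd p : ℕ) : ℤ) ∣ p := Int.natCast_dvd_natCast.2 (Nat.gcd_dvd_right _ _)
    exact (dvd_sub_left (h₁.mul_right m)).1 (h₂.trans hm)
  · rintro ⟨s, rfl⟩
    refine ⟨q.gcdA p * s, q.gcdB p * s, ?_⟩
    rw [Nat.gcd_eq_gcd_ab]; ring

namespace GComplex

variable {K : GComplex} {k : ℤ} {b e : ℕ} [NeZero b] {x y : K.A} {c : ℕ}

/-! ### Generators of the homology of the product with the sphere -/

/-- The homology in degree `k` at `e`. -/
abbrev H (K : GComplex) (k : ℤ) (e : ℕ) : Type := K.Z k e ⧸ (K.B k e).addSubgroupOf (K.Z k e)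

/-- The homology class of a cycle. -/
def H.mk (x : K.Z k e) : K.H k e := QuotientAddGroup.mk x

lemma H.mk_eq_mk {x y : K.Z k e} : H.mk x = H.mk y ↔ (x : K.A) - y ∈ K.B k e := by
  rw [H.mk, H.mk, QuotientAddGroup.eq_iff_sub_mem]
  rfl

lemma H.mk_surjective (q : K.H k e) : ∃ x, H.mk x = q := QuotientAddGroup.mk_surjective q

lemma H.mk_zsmul (m : ℤ) (x : K.Z k e) : H.mk (m • x) = m • H.mk x := rfl

lemma L_generated (h₁ : Acyclic K (k - 1)) {c₀ c₁ : ℕ} (hy : Gen K k c₁ y)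
    (hx : Gen K (k - 2) c₀ x) (he : 0 < e) {w : (L b K).A} (hw : w ∈ (L b K).Z k e) :
    ∃ α β : ℤ, w - (α • aMul b K y + β • uMul b K x) ∈ (L b K).B k e := by
  obtain ⟨β, a, ha, h⟩ := L_decomp h₁ hx he hw
  obtain ⟨α, hα⟩ := hy.gen e he a ha
  refine ⟨α, β, ?_⟩
  have := add_mem h (aMul_mem_B (b := b) hα)
  rw [map_sub, map_zsmul] at this
  convert this using 1
  abel

/-- The class of a_b y has order gcd(`quotOrder b e`, `quotOrder c₁ e`), and u_b x has order
`quotOrder c₀ (b.lcm e)` modulo it. -/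
lemma card_L_H (h₁ : Acyclic K (k - 1)) {c₀ c₁ : ℕ} (hy : Gen K k c₁ y) (hx : Gen K (k - 2) c₀ x)
    (h : c₀ ∣ c₁) (he : 0 < e) :
    Nat.card ((L b K).H k e) = quotOrder (c₁.gcd (b.lcm c₀)) e := by
  rw [quotOrder_gcd_lcm (NeZero.pos b) he h]
  have hye := Z_le_Z (one_dvd e) hy.mem
  refine card_eq_mul_of_generators (v := H.mk ⟨aMul b K y, aMul_mem_Z hye⟩)
    (w := H.mk ⟨uMul b K x, uMul_mem_Z (Z_le_Z (one_dvd e) hx.mem)⟩) (fun q => ?_) (fun α => ?_)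
    (fun β => ?_)
  · obtain ⟨w, rfl⟩ := H.mk_surjective q
    obtain ⟨α, β, h⟩ := L_generated h₁ hy hx he w.2
    exact ⟨α, β, H.mk_eq_mk.2 h⟩
  · rw [← H.mk_zsmul]
    refine (H.mk_eq_mk (y := 0)).trans ?_
    change α • aMul b K y - 0 ∈ _ ↔ _
    rw [sub_zero, ← map_zsmul, aMul_mem_B_iff h₁ hy he, ← exists_dvd_sub_mul_iff]
    refine exists_congr fun m => ?_
    rw [← sub_smul, hy.zsmul_mem e he]
  · rw [← uMul_mem_B_iff h₁ hx he]
    constructor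
    · rintro ⟨α, hα⟩
      refine ⟨α • y, zsmul_mem hye _, ?_⟩
      rw [map_zsmul]
      exact H.mk_eq_mk.1 hα
    · rintro ⟨v, hv, h⟩
      obtain ⟨α, hα⟩ := hy.gen e he v hv
      refine ⟨α, H.mk_eq_mk.2 ?_⟩
      change β • uMul b K x - α • aMul b K y ∈ _
      have := add_mem h (aMul_mem_B (b := b) hα)
      rw [map_sub, map_zsmul] at this
      convert this using 1
      abel

/-- The homology in degree `k` at `1` is cyclic locally at the prime `p`,
with generator `z`. -/
def LocGen (K : GComplex) (p : ℕ) (k : ℤ) (z : K.A) : Prop :=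
  z ∈ K.Z k 1 ∧ ∀ w ∈ K.Z k 1, ∃ r : ℤ, ¬ (p : ℤ) ∣ r ∧ ∃ m : ℤ, r • w - m • z ∈ K.B k 1

/-- At level 1 the group is finite and locally cyclic, hence cyclic. A generator there also
generates at every level e, since the generators a_b y and u_b x at level e already exist at level
1. Its order at level e is therefore the cardinality from `card_L_H`. -/
theorem exists_gen_L (h₁ : Acyclic K (k - 1)) {c₀ c₁ : ℕ} (hy : Gen K k c₁ y)
    (hx : Gen K (k - 2) c₀ x) (h : c₀ ∣ c₁) (hc₀ : 0 < c₀)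
    (hloc : ∀ p : ℕ, p.Prime → ∃ z, LocGen (L b K) p k z) :
    ∃ x', Gen (L b K) k (c₁.gcd (b.lcm c₀)) x' := by
  have hcard (e : ℕ) (he : 0 < e) := card_L_H (b := b) h₁ hy hx h he
  have hfin : Finite ((L b K).H k 1) := by
    refine Nat.finite_of_card_ne_zero ?_
    rw [hcard 1 one_pos]
    exact (quotOrder_pos (Nat.gcd_pos_of_pos_right _ (Nat.lcm_pos (NeZero.pos b) hc₀)) _).ne'
  have hcyc : IsAddCyclic ((L b K).H k 1) := isAddCyclic_of_forall_prime fun p hp => by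
    obtain ⟨z, hz, hz'⟩ := hloc p hp
    refine ⟨H.mk ⟨z, hz⟩, fun q => ?_⟩
    obtain ⟨w, rfl⟩ := H.mk_surjective q
    obtain ⟨r, hr, m, hm⟩ := hz' w.1 w.2
    exact ⟨r, hr, m, (H.mk_eq_mk.2 hm).symm⟩
  obtain ⟨g, hg⟩ := hcyc.exists_zsmul_surjective
  obtain ⟨⟨x', hx'⟩, rfl⟩ := H.mk_surjective g
  have hone (w) (hw : w ∈ (L b K).Z k 1) : ∃ m : ℤ, w - m • x' ∈ (L b K).B k 1 := by
    obtain ⟨m, hm⟩ := hg (H.mk ⟨w, hw⟩)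
    exact ⟨m, H.mk_eq_mk.1 hm.symm⟩
  have hgen (e : ℕ) (he : 0 < e) (w) (hw : w ∈ (L b K).Z k e) :
      ∃ m : ℤ, w - m • x' ∈ (L b K).B k e := by
    obtain ⟨α, β, h⟩ := L_generated h₁ hy hx he hw
    obtain ⟨m, hm⟩ := hone _ (add_mem (zsmul_mem (aMul_mem_Z hy.mem) α)
      (zsmul_mem (uMul_mem_Z hx.mem) β))
    exact ⟨m, by simpa using add_mem h (B_le_B (one_dvd e) hm)⟩
  refine ⟨x', hx', hgen, fun e he m => ?_⟩
  have hxe := Z_le_Z (one_dvd e) hx'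
  have hord : addOrderOf (H.mk ⟨x', hxe⟩) = Nat.card ((L b K).H k e) :=
    addOrderOf_eq_card_of_forall_mem_zmultiples fun q => by
      obtain ⟨w, rfl⟩ := H.mk_surjective q
      obtain ⟨m, hm⟩ := hgen e he w.1 w.2
      exact ⟨m, (H.mk_eq_mk.2 hm).symm⟩
  rw [← hcard e he, ← hord, addOrderOf_dvd_iff_zsmul_eq_zero, ← H.mk_zsmul]
  refine Iff.trans ?_ (H.mk_eq_mk (y := 0)).symm
  change _ ↔ m • x' - 0 ∈ _
  rw [sub_zero]

/-- In the new top degree there are no a_b-multiples, so u_b x alone generates, and it has infinite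
order because x does. -/
theorem gen_L_uMul (hgr : ∀ z ∈ K.gr k, z = 0) (h₁ : Acyclic K (k - 1)) (hx : Gen K (k - 2) 0 x) :
    Gen (L b K) k 0 (uMul b K x) where
  mem := uMul_mem_Z hx.mem
  gen e he w hw := by
    obtain ⟨m, a, ha, h⟩ := L_decomp h₁ hx he hw
    rw [hgr a ha.1.1, map_zero, add_zero] at h
    exact ⟨m, h⟩
  zsmul_mem e he m := by
    refine ⟨fun h => ?_, fun h => ?_⟩
    · rw [quotOrder_zero, ← quotOrder_zero (b.lcm e), ← uMul_mem_B_iff h₁ hx he]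
      exact ⟨0, zero_mem _, by simpa using h⟩
    · rw [quotOrder_zero, Nat.cast_zero, zero_dvd_iff] at h
      rw [h, zero_smul]
      exact zero_mem _

/-! ### The gold relation -/

/-- The cycle `x` extends to a map from a suspension of `S^{λ_c}` that sends the orientation
class to `y`. -/
def Linked (K : GComplex) (c : ℕ) (k : ℤ) (x y : K.A) : Prop :=
  ∃ η ∈ K.F (k + 1) c, ∃ ζ ∈ K.F (k + 2) c, K.d η = x ∧ K.d ζ = η - K.t η ∧
    y = ∑ i ∈ Finset.range c, K.t^[i] ζ

lemma t_aMul : (L b K).t (aMul b K x) = aMul b K (K.t x) := by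
  have h := L_t_iterate (b := b) (e := 1) x 0 0
  simp only [Function.iterate_one, map_zero] at h
  exact h

lemma t_uMul : (L b K).t (uMul b K x) = uMul b K (K.t x) := by
  have h := L_t_iterate (b := b) (e := 1) 0 0 fun _ => x
  simp only [Function.iterate_one, map_zero] at h
  exact h

lemma Linked.aMul (h : Linked K c k x y) : Linked (L b K) c k (aMul b K x) (aMul b K y) := by
  obtain ⟨η, hη, ζ, hζ, rfl, hd, rfl⟩ := h
  refine ⟨_, aMul_mem_F hη, _, aMul_mem_F hζ, d_aMul, ?_, ?_⟩
  · rw [d_aMul, hd, map_sub, t_aMul]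
  · rw [map_sum]
    exact Finset.sum_congr rfl fun i _ =>
      ((Function.Semiconj.iterate_right (fun _ => t_aMul.symm) i) ζ)

lemma Linked.uMul (h : Linked K c (k - 2) x y) : Linked (L b K) c k (uMul b K x) (uMul b K y) := by
  obtain ⟨η, hη, ζ, hζ, rfl, hd, rfl⟩ := h
  refine ⟨_, uMul_mem_F (by rwa [sub_add_eq_add_sub] at hη), _,
    uMul_mem_F (by rwa [sub_add_eq_add_sub] at hζ), d_uMul, ?_, ?_⟩
  · rw [d_uMul, hd, map_sub, t_uMul]
  · rw [map_sum]
    exact Finset.sum_congr rfl fun i _ =>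
      ((Function.Semiconj.iterate_right (fun _ => t_uMul.symm) i) ζ)

lemma iterate_eq_self (hx : K.t x = x) (i : ℕ) : K.t^[i] x = x := Function.iterate_fixed hx i

/-- The basic link comes from the cells of S^{λ_b}: take η and ζ to be x supported at the point 0 of
the 1-cell and of the 2-cell. The translates of ζ add up to the constant function x, which is u_b x.
-/
lemma linked_aMul_uMul (hx : x ∈ K.Z k 1) : Linked (L b K) b k (aMul b K x) (uMul b K x) := by
  classical
  have ht : K.t x = x := (mem_Z.1 hx).2.1
  have hs : Pi.single 0 x ∈ Eqv K b b := fun y => by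
    rw [CharP.cast_eq_zero, add_zero]
    by_cases hy : y = 0
    · rw [hy, Pi.single_eq_same, iterate_eq_self ht]
    · rw [Pi.single_eq_of_ne hy, iterate_map_zero]
  have hgr {j : ℤ} (hj : j = k) (y : ZMod b) : Pi.single (M := fun _ => K.A) 0 x y ∈ K.gr j := by
    by_cases hy : y = 0
    · rw [hy, Pi.single_eq_same, hj]; exact hx.1.1
    · rw [Pi.single_eq_of_ne hy]; exact zero_mem _
  have hd (y : ZMod b) : K.d (Pi.single (M := fun _ => K.A) 0 x y) = 0 := by
    by_cases hy : y = 0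
    · rw [hy, Pi.single_eq_same]; exact hx.2
    · rw [Pi.single_eq_of_ne hy, map_zero]
  have hts (i : ℕ) (y : ZMod b) : (funT K b)^[i] (Pi.single 0 x) y = if y = i then x else 0 := by
    rw [funT_iterate]
    by_cases hy : y = i
    · rw [if_pos hy, hy, sub_self, Pi.single_eq_same, iterate_eq_self ht]
    · rw [if_neg hy, Pi.single_eq_of_ne (sub_ne_zero.2 hy), iterate_map_zero]
  have ht0 (i : ℕ) : (funT K b)^[i] 0 = 0 := iterate_map_zero _ i
  refine ⟨tri 0 (Pi.single 0 x) 0, mem_F_L.2 ⟨zero_mem _, ⟨hs, hgr (by ring)⟩,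
    ⟨zero_mem _, fun _ => zero_mem _⟩⟩, tri 0 0 (Pi.single 0 x), mem_F_L.2 ⟨zero_mem _,
    ⟨zero_mem _, fun _ => zero_mem _⟩, ⟨hs, hgr (by ring)⟩⟩, ?_, ?_, ?_⟩
  · rw [L_d, aMul_apply]
    exact tri_congr (by simp) (by simp [hd]) (by simp)
  · have h1 := L_t_iterate (b := b) (e := 1) (K := K) 0 (Pi.single 0 x) 0
    rw [Function.iterate_one] at h1
    rw [L_d, h1, tri_sub]
    refine tri_congr (by simp) (fun y => ?_) (fun y => by rw [hd, ht0]; simp)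
    rw [Pi.sub_apply, hts]
    have : Pi.single (M := fun _ => K.A) 0 x (y - 1) = if y = (1 : ℕ) then x else 0 := by
      simp only [Pi.single_apply, sub_eq_zero, Nat.cast_one]
    rw [this]
    simp
  · let φ : (ZMod b → K.A) →+ (L b K).A := AddMonoidHom.mk' (fun h => tri 0 0 h) fun _ _ => by
      rw [tri_add, add_zero, add_zero]
    have h1 (i : ℕ) : (L b K).t^[i] (tri 0 0 (Pi.single 0 x)) =
        φ ((funT K b)^[i] (Pi.single 0 x)) := by
      rw [L_t_iterate, iterate_map_zero, ht0]; rfl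
    rw [Finset.sum_congr rfl fun i _ => h1 i, ← map_sum]
    refine congrArg φ (funext fun y => ?_)
    rw [Finset.sum_apply, Finset.sum_congr rfl fun i _ => hts i y,
      ← sum_zmod_eq_sum_range (fun j : ZMod b => if y = j then x else 0)]
    simp

/-- The equivariant function with value `z` at `0`. -/
def spread (K : GComplex) (b : ℕ) (z : K.A) (y : ZMod b) : K.A := K.t^[y.val] z

lemma spread_mem_eqv {z : K.A} (hz : K.t^[b] z = z) : spread K b z ∈ Eqv K b 1 := fun y => by
  rw [spread, spread, ← Function.iterate_add_apply]
  refine iterate_eq_of_modEq hz ?_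
  rw [← ZMod.natCast_eq_natCast_iff]
  simp [add_comm]

/-- Make the linking chains η, ζ invariant under `t ^ b` by adding q = c/gcd(b,c) translates, and
spread them over the 1- and 2-cells of S^{λ_b}. The boundary on the 2-cell is q x, the contributions
on the 1-cell cancel, and on the 0-cell one gets minus the sum of lcm(b,c) translates of ζ, which is
-(b/gcd(b,c)) y. -/
theorem gold_relation (hx : x ∈ K.Z k 1) (h : Linked K c k x y) :
    (c / b.gcd c) • uMul b K x - (b / b.gcd c) • aMul b K y ∈ (L b K).B (k + 2) 1 := by
  obtain ⟨η, hη, ζ, hζ, hdη, hdζ, rfl⟩ := h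
  have ht : K.t x = x := (mem_Z.1 hx).2.1
  set q := c / b.gcd c with hq
  have hqb : q * b = b / b.gcd c * c := by
    have h1 := Nat.div_mul_right_comm (Nat.gcd_dvd_right b c) b
    have h2 := Nat.div_mul_right_comm (Nat.gcd_dvd_left b c) c
    rw [hq, h1, h2, mul_comm]
  -- On elements fixed by `t ^ c` this sum is fixed by `t ^ b`, because q · b is a multiple of c and
  -- the sum therefore closes up.
  let S (z : K.A) : K.A := ∑ i ∈ Finset.range q, K.t^[i * b] z
  have hSt (z : K.A) (j : ℕ) : K.t^[j] (S z) = S (K.t^[j] z) := by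
    have : K.t^[j] (S z) = ∑ i ∈ Finset.range q, K.t^[j] (K.t^[i * b] z) :=
      map_sum (⟨⟨K.t^[j], iterate_map_zero _ _⟩, iterate_map_add _ _⟩ : K.A →+ K.A) _ _
    rw [this]
    exact Finset.sum_congr rfl fun i _ => by
      rw [← Function.iterate_add_apply, ← Function.iterate_add_apply, add_comm]
  have hSd (z : K.A) : K.d (S z) = S (K.d z) := by
    rw [map_sum]
    exact Finset.sum_congr rfl fun i _ => (iterate_t_d K _ _).symm
  have hSb {z : K.A} (hz : K.t^[c] z = z) : K.t^[b] (S z) = S z := by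
    have h1 := Finset.sum_range_succ (fun i => K.t^[i * b] z) q
    rw [Finset.sum_range_succ', zero_mul, hqb, iterate_mul_fixed hz] at h1
    rw [hSt]
    refine Eq.trans ?_ (add_right_cancel h1)
    exact Finset.sum_congr rfl fun i _ => by rw [← Function.iterate_add_apply]; congr 1; ring
  have hSgr {j : ℤ} {z : K.A} (hz : z ∈ K.gr j) : S z ∈ K.gr j :=
    sum_mem fun i _ => iterate_t_mem K hz _
  have hSx : S x = q • x := by
    simp only [S, iterate_eq_self ht, Finset.sum_const, Finset.card_range]
  have hr := spread_mem_eqv (hSb hη.2)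
  have hz := spread_mem_eqv (hSb hζ.2)
  have hB := d_tri_mem_B (k := k + 2) (zero_mem _) (neg_mem (eqv_shift hz))
    (fun y => neg_mem (iterate_t_mem K (hSgr hζ.1) _)) hr
    (fun y => by
      rw [show k + 2 - 1 = k + 1 by ring]
      exact iterate_t_mem K (hSgr hη.1) _)
  convert hB using 1
  rw [L_d, uMul_apply, aMul_apply, ← natCast_zsmul, ← natCast_zsmul, tri_zsmul, tri_zsmul, tri_sub]
  refine tri_congr ?_ (fun y => ?_) (fun y => ?_)
  · have h1 : ∑ y : ZMod b, spread K b (S ζ) (y - 1) = ∑ y : ZMod b, spread K b (S ζ) y :=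
      Equiv.sum_comp (Equiv.subRight (1 : ZMod b)) (spread K b (S ζ))
    have h2 : ∑ y : ZMod b, spread K b (S ζ) y = ∑ j ∈ Finset.range (q * b), K.t^[j] ζ := by
      rw [sum_zmod_eq_sum_range, sum_range_mul, Finset.sum_comm]
      refine Finset.sum_congr rfl fun j hj => ?_
      rw [spread, ZMod.val_cast_of_lt (Finset.mem_range.1 hj), hSt]
      exact Finset.sum_congr rfl fun i _ => by rw [← Function.iterate_add_apply]
    have h3 : ∑ j ∈ Finset.range (q * b), K.t^[j] ζ =
        (b / b.gcd c) • ∑ j ∈ Finset.range c, K.t^[j] ζ := by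
      rw [hqb]
      exact sum_range_mul_of_periodic (fun i => by
        rw [Function.iterate_add_apply, show K.t^[c] ζ = ζ from hζ.2]) _
    simp only [Pi.neg_apply, Finset.sum_neg_distrib, map_zero, h1, h2, h3, natCast_zsmul,
      smul_zero, zero_sub, zero_add]
  · have h1 := hr (y - 1)
    rw [Nat.cast_one, sub_add_cancel, Function.iterate_one] at h1
    have h2 : K.d (spread K b (S ζ) (y - 1)) =
        spread K b (S η) (y - 1) - K.t (spread K b (S η) (y - 1)) := by
      rw [spread, spread, ← iterate_t_d, hSd, hdζ, ← Function.iterate_succ_apply' K.t,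
        Function.iterate_succ_apply, ← iterate_map_sub]
      congr 1
      have := hSt η 1
      rw [Function.iterate_one] at this
      rw [this]
      simp only [S, iterate_map_sub, Finset.sum_sub_distrib]
    simp only [Pi.neg_apply, map_neg, h1, h2]
    simp
  · simp only [spread, Pi.sub_apply, Pi.smul_apply, Pi.zero_apply]
    rw [← iterate_t_d, hSd, hdη, hSx, iterate_map_nsmul, iterate_eq_self ht]
    simp

end GComplex

namespace GComplex

variable {K : GComplex} {k : ℤ} {b e : ℕ} [NeZero b] {x y : K.A} {c : ℕ} {p : ℕ}

/-! ### Local generators -/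

/-- The valuation hypothesis puts the full p-part of c into gcd(b,c). -/
lemma not_dvd_div_gcd {p b c : ℕ} (hp : p.Prime) (hb : 0 < b) (hc : 0 < c)
    (h : c.factorization p ≤ b.factorization p) : ¬ p ∣ c / b.gcd c := by
  intro hd
  have hg : 0 < b.gcd c := Nat.gcd_pos_of_pos_left c hb
  have h1 : p ^ c.factorization p ∣ b.gcd c :=
    Nat.dvd_gcd ((pow_dvd_pow p h).trans (Nat.ordProj_dvd b p)) (Nat.ordProj_dvd c p)
  have h2 : p ^ c.factorization p * p ∣ c := by
    rw [← Nat.mul_div_cancel' (Nat.gcd_dvd_right b c)]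
    exact mul_dvd_mul (by simpa [Nat.mul_div_cancel' (Nat.gcd_dvd_right b c)] using h1) hd
  rw [← pow_succ] at h2
  exact Nat.pow_succ_factorization_not_dvd hc.ne' hp h2

/-- If `α a + β u` is a combination of two cycles, `γ u` is homologous to `δ a` and `γ` is
prime to `p`, then the combination is locally at `p` a multiple of `a`. -/
lemma exists_smul_of_relation {a u w : K.A} {α β γ δ r : ℤ} (hp : p.Prime) (hr : ¬ (p : ℤ) ∣ r)
    (hγ : ¬ (p : ℤ) ∣ γ) (hw : r • w - (α • a + β • u) ∈ K.B k e)
    (hrel : γ • u - δ • a ∈ K.B k e) :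
    ∃ r : ℤ, ¬ (p : ℤ) ∣ r ∧ ∃ m : ℤ, r • w - m • a ∈ K.B k e := by
  refine ⟨γ * r, fun h => ((Nat.prime_iff_prime_int.1 hp).dvd_or_dvd h).elim hγ hr,
    γ * α + β * δ, ?_⟩
  convert add_mem (zsmul_mem hw γ) (zsmul_mem hrel β) using 1
  module

/-- `L_decomp` with the actual cycles replaced by multiples of local generators, at the cost of the
factor r₁ r₂ prime to p. -/
lemma L_loc_generated (hp : p.Prime) (h₁ : Acyclic K (k - 1)) (hx : Gen K (k - 2) c x) {y z : K.A}
    (hy : LocGen K p k y) (hz : LocGen K p (k - 2) z) {w : (L b K).A} (hw : w ∈ (L b K).Z k 1) :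
    ∃ α β r : ℤ, ¬ (p : ℤ) ∣ r ∧ r • w - (α • aMul b K y + β • uMul b K z) ∈ (L b K).B k 1 := by
  obtain ⟨m, a, ha, h⟩ := L_decomp h₁ hx one_pos hw
  obtain ⟨r₁, hr₁, m₁, hm₁⟩ := hy.2 a ha
  obtain ⟨r₂, hr₂, m₂, hm₂⟩ := hz.2 x hx.mem
  refine ⟨r₂ * m₁, r₁ * m * m₂, r₁ * r₂,
    fun h => ((Nat.prime_iff_prime_int.1 hp).dvd_or_dvd h).elim hr₁ hr₂, ?_⟩
  have e₁ := aMul_mem_B (b := b) hm₁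
  have e₂ := uMul_mem_B (b := b) hm₂
  rw [map_sub, map_zsmul, map_zsmul] at e₁ e₂
  convert add_mem (zsmul_mem h (r₁ * r₂)) (add_mem (zsmul_mem e₁ r₂) (zsmul_mem e₂ (r₁ * m)))
    using 1
  module

/-- r is the position at which v is inserted into a sorted sequence. -/
lemma exists_threshold {s v : ℕ} {c : ℕ → ℕ} (hmono : ∀ i j, i ≤ j → j < s → c i ≤ c j) :
    ∃ r ≤ s, ∀ i < s, i < r ↔ c i < v := by
  induction s with
  | zero => exact ⟨0, le_rfl, by simp⟩
  | succ s ih =>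
    by_cases h : c s < v
    · exact ⟨s + 1, le_rfl, fun i hi =>
        ⟨fun _ => (hmono i s (by omega) (by omega)).trans_lt h, fun _ => hi⟩⟩
    · obtain ⟨r, hr, hr'⟩ := ih fun i j hij hj => hmono i j hij (by omega)
      refine ⟨r, by omega, fun i hi => ?_⟩
      rcases Nat.lt_succ_iff_lt_or_eq.1 hi with hi | rfl
      · exact hr' i hi
      · exact ⟨fun h => by omega, fun h' => (h h').elim⟩

/-- A sequence of local generators in the even degrees, in which consecutive ones are linked. -/
def HasLocGens (K : GComplex) (p s : ℕ) : Prop :=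
  ∃ (z : ℕ → K.A) (c : ℕ → ℕ), (∀ j : ℕ, LocGen K p (2 * j) (z j)) ∧
    (∀ j < s, 0 < c j ∧ Linked K (c j) (2 * j) (z j) (z (j + 1))) ∧
    ∀ i j, i ≤ j → j < s → (c i).factorization p ≤ (c j).factorization p

/-- Insert b at its place r in the sequence c sorted by p-adic valuation. In degree 2(j+1) the
candidates are a_b z_{j+1} and u_b z_j, related by `gold_relation`. If c_j has smaller valuation
than b, the coefficient of u_b z_j is prime to p and the a_b-multiple suffices; otherwise the
u_b-multiple does. Old links survive multiplication by a_b or u_b, and the new link at r is the one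
between a_b z_r and u_b z_r. -/
theorem HasLocGens.L {s : ℕ} (h : HasLocGens K p s) (hp : p.Prime)
    (hgr : ∀ k : ℤ, 2 * s < k → ∀ x ∈ K.gr k, x = 0)
    (hodd : ∀ k : ℤ, Odd k → Acyclic K k) (hgen : ∀ j : ℤ, ∃ c x, Gen K (2 * j) c x) :
    HasLocGens (L b K) p (s + 1) := by
  obtain ⟨z, c, hz, hc, hmono⟩ := h
  obtain ⟨r, hr, hr'⟩ := exists_threshold (v := b.factorization p) hmono
  have hzu (j : ℕ) : LocGen K p (2 * ((j + 1 : ℕ) : ℤ) - 2) (z j) := by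
    rw [show (2 * ((j + 1 : ℕ) : ℤ) - 2) = 2 * j by push_cast; ring]; exact hz j
  have hgold (j : ℕ) (hj : j < s) : ((c j / b.gcd (c j) : ℕ) : ℤ) • uMul b K (z j) -
      ((b / b.gcd (c j) : ℕ) : ℤ) • aMul b K (z (j + 1)) ∈
        (GComplex.L b K).B (2 * ((j + 1 : ℕ) : ℤ)) 1 := by
    have := gold_relation (b := b) (hz j).1 (hc j hj).2
    rw [natCast_zsmul, natCast_zsmul,
      show (2 * ((j + 1 : ℕ) : ℤ)) = 2 * j + 2 by push_cast; ring]
    exact this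
  have hdec (j : ℕ) {w : (GComplex.L b K).A}
      (hw : w ∈ (GComplex.L b K).Z (2 * ((j + 1 : ℕ) : ℤ)) 1) :
      ∃ α β r : ℤ, ¬ (p : ℤ) ∣ r ∧ r • w - (α • aMul b K (z (j + 1)) + β • uMul b K (z j)) ∈
        (GComplex.L b K).B (2 * ((j + 1 : ℕ) : ℤ)) 1 := by
    obtain ⟨c', x, hx⟩ := hgen j
    rw [show (2 * (j : ℤ)) = 2 * ((j + 1 : ℕ) : ℤ) - 2 by push_cast; ring] at hx
    exact L_loc_generated hp (hodd _ ⟨j, by push_cast; ring⟩) hx (hz (j + 1)) (hzu j) hw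
  have hone := (Nat.prime_iff_prime_int.1 hp).not_dvd_one
  refine ⟨fun j => if j ≤ r then aMul b K (z j) else uMul b K (z (j - 1)),
    fun j => if j < r then c j else if j = r then b else c (j - 1), fun j => ?_, fun j hj => ?_,
    fun i j hij hj => ?_⟩
  · beta_reduce
    rcases j with _ | j
    · rw [if_pos (Nat.zero_le _)]
      refine ⟨aMul_mem_Z (hz 0).1, fun w hw => ?_⟩
      -- In degree 0 there are no u_b-multiples, since `K` vanishes in degree -2.
      have h0 : ∀ x ∈ K.gr (2 * ((0 : ℕ) : ℤ) - 2), x = 0 := fun x => K.gr_neg (by simp)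
      obtain ⟨m, a, ha, hma⟩ := L_decomp (hodd _ ⟨-1, by simp⟩) (gen_zero h0) one_pos hw
      obtain ⟨r, hr, m', hm'⟩ := (hz 0).2 a ha
      refine ⟨r, hr, m', ?_⟩
      have e₁ := aMul_mem_B (b := b) hm'
      rw [map_zero, smul_zero, zero_add] at hma
      rw [map_sub, map_zsmul, map_zsmul] at e₁
      convert add_mem (zsmul_mem hma r) e₁ using 1
      module
    · by_cases hjr : j + 1 ≤ r
      · rw [if_pos hjr]
        refine ⟨aMul_mem_Z (hz _).1, fun w hw => ?_⟩
        obtain ⟨α, β, q, hq, hw'⟩ := hdec j hw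
        have hjs : j < s := by omega
        refine exists_smul_of_relation hp hq ?_ hw' (hgold j hjs)
        rw [Int.natCast_dvd_natCast]
        exact not_dvd_div_gcd hp (NeZero.pos b) (hc j hjs).1 ((hr' j hjs).1 hjr).le
      · rw [if_neg hjr]
        refine ⟨uMul_mem_Z (hzu j).1, fun w hw => ?_⟩
        obtain ⟨α, β, q, hq, hw'⟩ := hdec j hw
        rw [add_comm (α • _)] at hw'
        by_cases hjs : j < s
        · refine exists_smul_of_relation hp hq (γ := (b / b.gcd (c j) : ℕ)) ?_ hw'
            (by rw [← neg_sub]; exact neg_mem (hgold j hjs))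
          rw [Int.natCast_dvd_natCast, Nat.gcd_comm]
          exact not_dvd_div_gcd hp (hc j hjs).1 (NeZero.pos b)
            (not_lt.1 fun h => hjr ((hr' j hjs).2 h))
        -- Here `z (j + 1)` lies above the top degree 2s of `K`, so its a_b-multiple is 0 and the
        -- relation is trivial.
        · refine exists_smul_of_relation hp hq (γ := 1) (δ := 0) hone hw' ?_
          rw [hgr _ (by push_cast; omega) _ (hz (j + 1)).1.1.1]
          simp
  · beta_reduce
    rcases lt_trichotomy j r with hjr | rfl | hjr
    · rw [if_pos hjr, if_pos hjr.le, if_pos (by omega : j + 1 ≤ r)]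
      exact ⟨(hc j (by omega)).1, (hc j (by omega)).2.aMul⟩
    · rw [if_neg (lt_irrefl _), if_pos rfl, if_pos le_rfl, if_neg (by omega), Nat.add_sub_cancel]
      exact ⟨NeZero.pos b, linked_aMul_uMul (hz j).1⟩
    · obtain ⟨i, rfl⟩ : ∃ i, j = i + 1 := ⟨j - 1, by omega⟩
      rw [if_neg (by omega), if_neg (by omega), if_neg (by omega), if_neg (by omega),
        Nat.add_sub_cancel, Nat.add_sub_cancel]
      refine ⟨(hc i (by omega)).1, Linked.uMul ?_⟩
      rw [show (2 * ((i + 1 : ℕ) : ℤ) - 2) = 2 * i by push_cast; ring]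
      exact (hc i (by omega)).2
  · beta_reduce
    rcases lt_trichotomy i r with hir | rfl | hir
    · rw [if_pos hir]
      rcases lt_trichotomy j r with hjr | rfl | hjr
      · rw [if_pos hjr]; exact hmono i j hij (by omega)
      · rw [if_neg (lt_irrefl _), if_pos rfl]
        exact ((hr' i (by omega)).1 hir).le
      · rw [if_neg (by omega), if_neg (by omega)]
        exact hmono i (j - 1) (by omega) (by omega)
    · rw [if_neg (lt_irrefl _), if_pos rfl]
      rcases eq_or_lt_of_le hij with rfl | hjr
      · rw [if_neg (lt_irrefl _), if_pos rfl]
      · rw [if_neg (by omega), if_neg (by omega)]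
        exact not_lt.1 fun h => absurd ((hr' (j - 1) (by omega)).2 h) (by omega)
    · rw [if_neg (by omega), if_neg (by omega), if_neg (by omega), if_neg (by omega)]
      exact hmono _ _ (by omega) (by omega)

/-! ### The complex of a product of spheres -/

/-- The integers in degree `0`. -/
def point : GComplex where
  A := ℤ
  t := AddMonoidHom.id ℤ
  d := 0
  gr k := if k = 0 then ⊤ else ⊥
  t_d _ := rfl
  d_d _ := rfl
  t_mem hx := hx
  d_mem _ := zero_mem _
  gr_neg {k x} hk hx := by rw [if_neg hk.ne] at hx; exact hx

lemma point_gr_eq_zero (hk : k ≠ 0) (x : point.A) (hx : x ∈ point.gr k) : x = 0 := by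
  change x ∈ (if k = 0 then ⊤ else ⊥ : AddSubgroup ℤ) at hx
  rw [if_neg hk] at hx
  exact hx

lemma mem_point_gr_zero (x : point.A) : x ∈ point.gr 0 := AddSubgroup.mem_top _

lemma mem_point_Z_zero (x : point.A) : x ∈ point.Z 0 e :=
  mem_Z.2 ⟨mem_point_gr_zero x, by
    change (id : ℤ → ℤ)^[e] _ = _
    rw [Function.iterate_id]; rfl, rfl⟩

lemma mem_point_B_zero {x : point.A} : x ∈ point.B 0 e ↔ x = 0 :=
  ⟨fun ⟨_, _, h⟩ => h.symm, by rintro rfl; exact zero_mem _⟩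

/-- The generator of the integers in degree `0`. -/
def pointOne : point.A := (1 : ℤ)

lemma zsmul_pointOne_eq_zero {m : ℤ} : m • pointOne = 0 ↔ m = 0 := by
  rw [show m • pointOne = (m : ℤ) from mul_one (M := ℤ) m]
  rfl

lemma exists_eq_zsmul_pointOne (x : point.A) : ∃ m : ℤ, x = m • pointOne :=
  ⟨x, (mul_one (M := ℤ) x).symm⟩

lemma gen_point : Gen point 0 0 pointOne where
  mem := mem_point_Z_zero _
  gen e _ z _ := by
    obtain ⟨m, rfl⟩ := exists_eq_zsmul_pointOne z
    exact ⟨m, by rw [sub_self]; exact zero_mem _⟩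
  zsmul_mem e _ m := by
    rw [mem_point_B_zero, zsmul_pointOne_eq_zero, quotOrder_zero, Nat.cast_zero, zero_dvd_iff]

lemma hasLocGens_point (hp : p.Prime) : HasLocGens point p 0 := by
  refine ⟨fun j => if j = 0 then pointOne else 0, fun _ => 1, fun j => ?_, fun _ h => ?_,
    fun _ _ _ _ => le_rfl⟩
  · beta_reduce
    have hone := (Nat.prime_iff_prime_int.1 hp).not_dvd_one
    rcases j with _ | j
    · rw [if_pos rfl]
      refine ⟨mem_point_Z_zero _, fun w _ => ?_⟩
      obtain ⟨m, rfl⟩ := exists_eq_zsmul_pointOne w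
      refine ⟨1, hone, m, ?_⟩
      rw [one_zsmul, sub_self]
      exact zero_mem _
    · rw [if_neg (by omega)]
      refine ⟨zero_mem _, fun w hw => ⟨1, hone, 0, ?_⟩⟩
      rw [point_gr_eq_zero (by push_cast; omega) w hw.1.1]
      simp
  · simp at h


/-- The complex of a product of spheres. -/
def ofList : List (Orbit n) → GComplex
  | [] => point
  | b :: bs => L b.size (ofList bs)

lemma ofList_gr_eq_zero (bs : List (Orbit n)) {k : ℤ} (hk : 2 * bs.length < k) :
    ∀ x ∈ (ofList bs).gr k, x = 0 := by
  induction bs generalizing k with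
  | nil => exact point_gr_eq_zero (by simp at hk; omega)
  | cons b bs ih =>
    rw [List.length_cons] at hk
    push_cast at hk
    rintro x hx
    obtain ⟨a, f, h, rfl⟩ := exists_eq_tri x
    exact tri_congr (ih (by omega) _ hx.1) (fun y => ih (by omega) _ (hx.2.1 y))
      (fun y => ih (by omega) _ (hx.2.2 y))

/-- The three statements go through one induction: generators for `b :: bs` come from those for `bs`
together with cyclicity, which in turn needs the local generators for `b :: bs`. -/
theorem ofList_homology (bs : List (Orbit n)) :
    (∀ k : ℤ, Odd k → Acyclic (ofList bs) k) ∧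
    (∀ j ≤ bs.length, ∃ x, Gen (ofList bs) (2 * j)
      (lcmGcdList (bs.map Orbit.size) (j + 1)) x) ∧
    ∀ p : ℕ, p.Prime → HasLocGens (ofList bs) p bs.length := by
  induction bs with
  | nil =>
    refine ⟨fun k hk => acyclic_of_eq_zero (point_gr_eq_zero ?_), fun j hj => ?_,
      fun p hp => hasLocGens_point hp⟩
    · rintro rfl; simp at hk
    · obtain rfl : j = 0 := by simpa using hj
      exact ⟨_, gen_point⟩
  | cons b bs ih =>
    obtain ⟨hodd, hgen, hloc⟩ := ih
    have hgen' (j : ℤ) : ∃ c x, Gen (ofList bs) (2 * j) c x := by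
      rcases lt_or_ge j 0 with hj | hj
      · exact ⟨_, _, gen_zero fun x => gr_neg _ (by omega)⟩
      obtain ⟨i, rfl⟩ := Int.eq_ofNat_of_zero_le hj
      by_cases hi : i ≤ bs.length
      · exact ⟨_, hgen i hi⟩
      · exact ⟨_, _, gen_zero (ofList_gr_eq_zero bs (by omega))⟩
    have hloc' (p : ℕ) (hp : p.Prime) : HasLocGens (ofList (b :: bs)) p (b :: bs).length :=
      (hloc p hp).L hp (fun k => ofList_gr_eq_zero bs) hodd hgen'
    refine ⟨fun k hk => ?_, fun j hj => ?_, hloc'⟩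
    · obtain ⟨i, rfl⟩ := hk
      obtain ⟨c, x, hx⟩ := hgen' i
      exact L_acyclic (hodd _ ⟨i, rfl⟩) (hodd _ ⟨i - 1, by ring⟩)
        (by rw [add_sub_cancel_right]; exact hx)
    · have hodd' : Acyclic (ofList bs) (2 * (j : ℤ) - 1) := hodd _ ⟨j - 1, by ring⟩
      have hprev : ∃ x, Gen (ofList bs) (2 * (j : ℤ) - 2) (lcmGcdList (bs.map Orbit.size) j) x := by
        rcases j with _ | j
        · exact ⟨0, by rw [lcmGcdList_zero]; exact gen_zero fun x => gr_neg _ (by simp)⟩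
        · rw [show 2 * ((j + 1 : ℕ) : ℤ) - 2 = 2 * j by push_cast; ring]
          exact hgen j (by simpa using hj)
      obtain ⟨x, hx⟩ := hprev
      -- The new top degree is separate: there the homology is infinite cyclic, and the counting
      -- argument of `exists_gen_L` does not apply.
      rcases Nat.lt_or_ge bs.length j with hj' | hj'
      · obtain rfl : j = bs.length + 1 := le_antisymm hj hj'
        rw [lcmGcdList_eq_zero _ (by simp)] at hx ⊢
        exact ⟨_, gen_L_uMul (ofList_gr_eq_zero bs (by push_cast; omega)) hodd' hx⟩
      · obtain ⟨y, hy⟩ := hgen j hj'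
        exact exists_gen_L hodd' hy hx (lcmGcdList_dvd_succ _ _)
          (lcmGcdList_pos (by simp [Orbit.pos]) (by simpa using hj'))
          fun p hp => by
            obtain ⟨z, _, hz, -⟩ := hloc' p hp
            exact ⟨_, hz j⟩

/-! ### The products of Euler and orientation classes -/

/-- The products of Euler and orientation classes in degree `k`. -/
def auSet : ∀ bs : List (Orbit n), ℤ → Set (ofList bs).A
  | [], k => {x | k = 0 ∧ x = pointOne}
  | b :: bs, k => aMul b.size (ofList bs) '' auSet bs k ∪
      uMul b.size (ofList bs) '' auSet bs (k - 2)

lemma auSet_subset_Z (bs : List (Orbit n)) (k : ℤ) : auSet bs k ⊆ (ofList bs).Z k 1 := by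
  induction bs generalizing k with
  | nil => rintro _ ⟨rfl, rfl⟩; exact mem_point_Z_zero _
  | cons b bs ih =>
    rintro _ (⟨x, hx, rfl⟩ | ⟨x, hx, rfl⟩)
    · exact aMul_mem_Z (ih _ hx)
    · exact uMul_mem_Z (ih _ hx)

/-- By `L_decomp` a cycle is a combination of u_b x and an a_b-multiple of a cycle at the same level
e. The generator x lives at level 1, so induction applies to it there and the outcome is valid at
level e. No transfers are needed: at each level the au-products generate the homology as a group. -/
theorem ofList_generated (bs : List (Orbit n)) (k : ℤ) (e : ℕ) (he : 0 < e) :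
    (ofList bs).Z k e ≤ AddSubgroup.closure (auSet bs k) ⊔ (ofList bs).B k e := by
  induction bs generalizing k e with
  | nil =>
    intro x hx
    by_cases hk : k = 0
    · obtain ⟨m, rfl⟩ := exists_eq_zsmul_pointOne x
      exact AddSubgroup.mem_sup_left (zsmul_mem (AddSubgroup.subset_closure
        (show pointOne ∈ auSet ([] : List (Orbit n)) k from ⟨hk, rfl⟩)) m)
    · rw [point_gr_eq_zero hk x hx.1.1]; exact zero_mem _
  | cons b bs ih =>
    intro w hw
    obtain ⟨hodd, hgen, -⟩ := ofList_homology bs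
    rcases Int.even_or_odd k with hk | hk
    · obtain ⟨j, hj⟩ := hk
      have hprev : ∃ c x, Gen (ofList bs) (k - 2) c x := by
        rcases lt_or_ge k 2 with hk | hk
        · exact ⟨_, _, gen_zero fun x => gr_neg _ (by omega)⟩
        by_cases hk' : k - 2 ≤ 2 * bs.length
        · obtain ⟨x, hx⟩ := hgen (j - 1).toNat (by omega)
          rw [show (2 * ((j - 1).toNat : ℤ)) = k - 2 by omega] at hx
          exact ⟨_, x, hx⟩
        · exact ⟨_, _, gen_zero (ofList_gr_eq_zero bs (by omega))⟩
      obtain ⟨c, x, hx⟩ := hprev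
      obtain ⟨m, a, ha, h⟩ := L_decomp (b := b.size) (hodd _ ⟨j - 1, by omega⟩) hx he hw
      have ha' : aMul b.size _ a ∈ AddSubgroup.closure (auSet (b :: bs) k) ⊔
          (L b.size (ofList bs)).B k e := by
        obtain ⟨a₁, h₁, a₂, h₂, rfl⟩ := AddSubgroup.mem_sup.1 (ih k e he ha)
        rw [map_add]
        refine AddSubgroup.add_mem_sup ?_ (aMul_mem_B h₂)
        have := AddSubgroup.mem_map_of_mem (aMul b.size (ofList bs)) h₁
        rw [AddMonoidHom.map_closure] at this
        exact AddSubgroup.closure_mono Set.subset_union_left this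
      have hx' : uMul b.size _ x ∈ AddSubgroup.closure (auSet (b :: bs) k) ⊔
          (L b.size (ofList bs)).B k e := by
        obtain ⟨a₁, h₁, a₂, h₂, rfl⟩ := AddSubgroup.mem_sup.1 (ih (k - 2) 1 one_pos hx.mem)
        rw [map_add]
        refine AddSubgroup.add_mem_sup ?_ (B_le_B (one_dvd e) (uMul_mem_B h₂))
        have := AddSubgroup.mem_map_of_mem (uMul b.size (ofList bs)) h₁
        rw [AddMonoidHom.map_closure] at this
        exact AddSubgroup.closure_mono Set.subset_union_right this
      have := add_mem (AddSubgroup.mem_sup_right h) (add_mem (zsmul_mem hx' m) ha')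
      exact (sub_add_cancel w _) ▸ this
    · exact AddSubgroup.mem_sup_right ((ofList_homology (b :: bs)).1 k hk e he hw)

end GComplex

/-! ## Maps of modules -/

namespace MackeyMod

variable {M N P : MackeyMod n}

lemma hom_ext' {f g : M ⟶ N} (h : ∀ d x, component f d x = component g d x) : f = g :=
  ObjectProperty.hom_ext _ (NatTrans.ext (funext fun d =>
    AddCommGrpCat.hom_ext (AddMonoidHom.ext fun x => h d.unop x)))

lemma component_comp (f : M ⟶ N) (g : N ⟶ P) (d : Orbit n) (x : M.val d) :
    component (f ≫ g) d x = component g d (component f d x) := rfl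

lemma component_act (f : M ⟶ N) {a b : Orbit n} (φ : a ⟶ b) (x : M.val b) :
    component f a (M.act φ x) = N.act φ (component f b x) :=
  ConcreteCategory.congr_hom (f.hom.naturality φ.op) x

lemma isIso_of_bijective (f : M ⟶ N) (h : ∀ d, Function.Bijective (component f d)) : IsIso f := by
  have : IsIso f.hom := by
    rw [NatTrans.isIso_iff_isIso_app]
    intro d
    rw [ConcreteCategory.isIso_iff_bijective]
    exact h d.unop
  have : IsIso ((ObjectProperty.ι _).map f) := this
  exact isIso_of_reflects_iso f (ObjectProperty.ι _)

lemma isZero_of_eq_zero (h : ∀ (d : Orbit n) (x : M.val d), x = 0) : IsZero M := by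
  rw [IsZero.iff_id_eq_zero]
  exact hom_ext' fun d x => (h d _).trans (h d _).symm

end MackeyMod

/-! ## Fixed point modules -/

section fixMod

variable {A A' : Type} [AddCommGroup A] [AddCommGroup A'] (t : A →+ A) (P : AddSubgroup A)

/-- Equivariant functions on `Θ_d` with values in `P`. -/
def eqvFun (d : ℕ) : AddSubgroup (ZMod d → A) where
  carrier := {m | ∀ x, m (x + 1) = t (m x) ∧ m x ∈ P}
  zero_mem' x := ⟨(map_zero t).symm, zero_mem _⟩
  add_mem' hf hg x := ⟨by rw [Pi.add_apply, Pi.add_apply, (hf x).1, (hg x).1, map_add],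
    add_mem (hf x).2 (hg x).2⟩
  neg_mem' hf x := ⟨by rw [Pi.neg_apply, Pi.neg_apply, (hf x).1, map_neg], neg_mem (hf x).2⟩

variable {t P}

/-- The action of an invariant matrix on equivariant functions. -/
def eqvAct {a b : Orbit n} (φ : orbitHom a b) : eqvFun t P b.size →+ eqvFun t P a.size where
  toFun m := ⟨fun x => ∑ y, φ.1 x y • m.1 y, fun x => by
    refine ⟨?_, sum_mem fun y _ => zsmul_mem (m.2 y).2 _⟩
    beta_reduce
    rw [map_sum]
    refine (Equiv.sum_comp (Equiv.addRight (1 : ZMod b.size)) _).symm.trans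
      (Finset.sum_congr rfl fun y _ => ?_)
    rw [Equiv.coe_addRight, φ.2, (m.2 y).1, map_zsmul]⟩
  map_zero' := Subtype.ext (funext fun x => by simp)
  map_add' m m' := Subtype.ext (funext fun x => by
    change ∑ y, φ.1 x y • (m.1 y + m'.1 y) = ∑ y, φ.1 x y • m.1 y + ∑ y, φ.1 x y • m'.1 y
    simp only [smul_add, Finset.sum_add_distrib])

lemma eqvAct_apply {a b : Orbit n} (φ : orbitHom a b) (m : eqvFun t P b.size) (x : ZMod a.size) :
    (eqvAct φ m).1 x = ∑ y, φ.1 x y • m.1 y := rfl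

variable (n t P) in
/-- The module of equivariant functions with values in `P`. -/
def fixMod : MackeyMod n :=
  ⟨{ obj := fun d => AddCommGrpCat.of (eqvFun t P d.unop.size)
     map := fun φ => AddCommGrpCat.ofHom (eqvAct (show orbitHom _ _ from φ.unop))
     map_id := fun a => by
       refine AddCommGrpCat.hom_ext (AddMonoidHom.ext fun m => Subtype.ext (funext fun x => ?_))
       change ∑ y, (if x = y then (1 : ℤ) else 0) • m.1 y = m.1 x
       simp
     map_comp := fun {a b c} φ ψ => by
       refine AddCommGrpCat.hom_ext (AddMonoidHom.ext fun m => Subtype.ext (funext fun x => ?_))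
       change ∑ z, (∑ y, (show orbitHom c.unop b.unop from ψ.unop).1 x y *
           (show orbitHom b.unop a.unop from φ.unop).1 y z) • m.1 z =
         ∑ y, (show orbitHom c.unop b.unop from ψ.unop).1 x y •
           ∑ z, (show orbitHom b.unop a.unop from φ.unop).1 y z • m.1 z
       simp only [Finset.sum_smul, Finset.smul_sum, mul_smul]
       rw [Finset.sum_comm] },
   ⟨fun {a b φ ψ} => by
     refine AddCommGrpCat.hom_ext (AddMonoidHom.ext fun m => Subtype.ext (funext fun x => ?_))
     change ∑ y, ((show orbitHom b.unop a.unop from φ.unop).1 x y +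
         (show orbitHom b.unop a.unop from ψ.unop).1 x y) • m.1 y =
       (∑ y, (show orbitHom b.unop a.unop from φ.unop).1 x y • m.1 y) +
         ∑ y, (show orbitHom b.unop a.unop from ψ.unop).1 x y • m.1 y
     simp only [add_smul, Finset.sum_add_distrib]⟩⟩

/-- The map of equivariant functions induced by an equivariant homomorphism. -/
def eqvMap {t' : A' →+ A'} {P' : AddSubgroup A'} (f : A →+ A') (hf : ∀ x, f (t x) = t' (f x))
    (hP : ∀ x ∈ P, f x ∈ P') (d : ℕ) : eqvFun t P d →+ eqvFun t' P' d where
  toFun m := ⟨fun x => f (m.1 x), fun x => ⟨by beta_reduce; rw [(m.2 x).1, hf], hP _ (m.2 x).2⟩⟩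
  map_zero' := Subtype.ext (funext fun _ => map_zero f)
  map_add' _ _ := Subtype.ext (funext fun _ => map_add f _ _)

/-- The map of fixed point modules induced by an equivariant homomorphism. -/
def fixMod.map {t' : A' →+ A'} {P' : AddSubgroup A'} (f : A →+ A') (hf : ∀ x, f (t x) = t' (f x))
    (hP : ∀ x ∈ P, f x ∈ P') : fixMod n t P ⟶ fixMod n t' P' :=
  ObjectProperty.homMk
    { app := fun d => AddCommGrpCat.ofHom (eqvMap f hf hP d.unop.size)
      naturality := fun a b φ => by
        refine AddCommGrpCat.hom_ext (AddMonoidHom.ext fun m => Subtype.ext (funext fun x => ?_))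
        change f (∑ y, (show orbitHom b.unop a.unop from φ.unop).1 x y • m.1 y) =
          ∑ y, (show orbitHom b.unop a.unop from φ.unop).1 x y • f (m.1 y)
        simp only [map_sum, map_zsmul] }

end fixMod

/-! ## The box product of a free module and a fixed point module -/

section boxFree

variable {K : GComplex} {q : ℤ} {a b c d : Orbit n}

/-- Functions with values of degree `q`. -/
def funGr (K : GComplex) (b : ℕ) (q : ℤ) : AddSubgroup (ZMod b → K.A) where
  carrier := {f | ∀ y, f y ∈ K.gr q}
  zero_mem' _ := zero_mem _
  add_mem' hf hg y := add_mem (hf y) (hg y)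
  neg_mem' hf y := neg_mem (hf y)

/-- The element of `Map(Θ_b, K)` at `Θ_d` given by a symbol `e ⊗ φ ⊗ m`. -/
def boxFun (e : pairHom d a c) (φ : orbitHom a b) (m : eqvFun K.t (K.gr q) c.size) :
    eqvFun (K.funT b.size) (funGr K b.size q) d.size :=
  ⟨fun x w => ∑ y, ∑ z, (e.1 x y z * φ.1 y w) • m.1 z, fun x => by
    refine ⟨funext fun w => ?_, fun w => sum_mem fun y _ => sum_mem fun z _ =>
      zsmul_mem (m.2 z).2 _⟩
    change _ = K.t (∑ y, ∑ z, (e.1 x y z * φ.1 y (w - 1)) • m.1 z)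
    rw [map_sum]
    refine (Equiv.sum_comp (Equiv.addRight (1 : ZMod a.size)) _).symm.trans
      (Finset.sum_congr rfl fun y _ => ?_)
    rw [map_sum]
    refine (Equiv.sum_comp (Equiv.addRight (1 : ZMod c.size)) _).symm.trans
      (Finset.sum_congr rfl fun z _ => ?_)
    have h := φ.2 y (w - 1)
    rw [sub_add_cancel] at h
    rw [Equiv.coe_addRight, Equiv.coe_addRight, e.2, h, (m.2 z).1, map_zsmul]⟩

lemma boxFun_apply (e : pairHom d a c) (φ : orbitHom a b) (m : eqvFun K.t (K.gr q) c.size)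
    (x : ZMod d.size) (w : ZMod b.size) :
    (boxFun e φ m).1 x w = ∑ y, ∑ z, (e.1 x y z * φ.1 y w) • m.1 z := rfl

lemma boxFun_ext {f g : eqvFun (K.funT b.size) (funGr K b.size q) d.size}
    (h : ∀ x w, f.1 x w = g.1 x w) : f = g :=
  Subtype.ext (funext fun x => funext fun w => h x w)

lemma boxFun_pairPre {d' : Orbit n} (ψ : d' ⟶ d) (e : pairHom d a c) (φ : orbitHom a b)
    (m : eqvFun K.t (K.gr q) c.size) :
    boxFun (pairPre ψ e) φ m = eqvAct (show orbitHom d' d from ψ) (boxFun e φ m) :=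
  boxFun_ext fun x w => by
    rw [eqvAct_apply, Finset.sum_apply]
    change ∑ y, ∑ z, ((∑ v, (show orbitHom d' d from ψ).1 x v * e.1 v y z) * φ.1 y w) • m.1 z =
      ∑ v, (show orbitHom d' d from ψ).1 x v • ∑ y, ∑ z, (e.1 v y z * φ.1 y w) • m.1 z
    simp only [Finset.smul_sum, Finset.sum_mul, Finset.sum_smul, smul_smul, mul_assoc]
    rw [Finset.sum_comm' (t' := Finset.univ) (s' := fun _ => Finset.univ) (by simp)]
    rw [Finset.sum_comm]
    simp only [Finset.sum_comm (γ := ZMod d.size)]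

/-- The map `F_b □ K_q → Map(Θ_b, K_q)` at `Θ_d`. -/
def boxFreeHom (K : GComplex) (q : ℤ) (b d : Orbit n) :
    BoxGroup (free.obj b) (fixMod n K.t (K.gr q)) d →+
      eqvFun (K.funT b.size) (funGr K b.size q) d.size :=
  BoxGroup.lift (fun s => boxFun s.e (show orbitHom s.a b from s.m)
      (show eqvFun K.t (K.gr q) s.b.size from s.m'))
    (fun a c e e' φ m => boxFun_ext fun x w => by
      change ∑ y, ∑ z, ((e.1 x y z + e'.1 x y z) * (show orbitHom a b from φ).1 y w) •
          (show eqvFun K.t (K.gr q) c.size from m).1 z =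
        (∑ y, ∑ z, (e.1 x y z * (show orbitHom a b from φ).1 y w) •
          (show eqvFun K.t (K.gr q) c.size from m).1 z) +
        ∑ y, ∑ z, (e'.1 x y z * (show orbitHom a b from φ).1 y w) •
          (show eqvFun K.t (K.gr q) c.size from m).1 z
      simp only [add_mul, add_smul, Finset.sum_add_distrib])
    (fun a c e φ φ' m => boxFun_ext fun x w => by
      change ∑ y, ∑ z, (e.1 x y z * ((show orbitHom a b from φ).1 y w +
          (show orbitHom a b from φ').1 y w)) • (show eqvFun K.t (K.gr q) c.size from m).1 z =
        (∑ y, ∑ z, (e.1 x y z * (show orbitHom a b from φ).1 y w) •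
          (show eqvFun K.t (K.gr q) c.size from m).1 z) +
        ∑ y, ∑ z, (e.1 x y z * (show orbitHom a b from φ').1 y w) •
          (show eqvFun K.t (K.gr q) c.size from m).1 z
      simp only [mul_add, add_smul, Finset.sum_add_distrib])
    (fun a c e φ m m' => boxFun_ext fun x w => by
      change ∑ y, ∑ z, (e.1 x y z * (show orbitHom a b from φ).1 y w) •
          ((show eqvFun K.t (K.gr q) c.size from m).1 z +
            (show eqvFun K.t (K.gr q) c.size from m').1 z) =
        (∑ y, ∑ z, (e.1 x y z * (show orbitHom a b from φ).1 y w) •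
          (show eqvFun K.t (K.gr q) c.size from m).1 z) +
        ∑ y, ∑ z, (e.1 x y z * (show orbitHom a b from φ).1 y w) •
          (show eqvFun K.t (K.gr q) c.size from m').1 z
      simp only [smul_add, Finset.sum_add_distrib])
    (fun a a' c ψ e φ m => boxFun_ext fun x w => by
      change ∑ y', ∑ z, ((∑ y, e.1 x y z * (show orbitHom a a' from ψ).1 y y') *
          (show orbitHom a' b from φ).1 y' w) • (show eqvFun K.t (K.gr q) c.size from m).1 z =
        ∑ y, ∑ z, (e.1 x y z * ∑ y', (show orbitHom a a' from ψ).1 y y' *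
          (show orbitHom a' b from φ).1 y' w) • (show eqvFun K.t (K.gr q) c.size from m).1 z
      simp only [Finset.sum_mul, Finset.mul_sum, Finset.sum_smul, mul_assoc]
      rw [Finset.sum_comm]
      conv_rhs => rw [Finset.sum_comm]
      refine Finset.sum_congr rfl fun z _ => ?_
      rw [Finset.sum_comm])
    (fun a c c' ψ e φ m => boxFun_ext fun x w => by
      change ∑ y, ∑ z', ((∑ z, e.1 x y z * (show orbitHom c c' from ψ).1 z z') *
          (show orbitHom a b from φ).1 y w) • (show eqvFun K.t (K.gr q) c'.size from m).1 z' =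
        ∑ y, ∑ z, (e.1 x y z * (show orbitHom a b from φ).1 y w) •
          ∑ z', (show orbitHom c c' from ψ).1 z z' •
            (show eqvFun K.t (K.gr q) c'.size from m).1 z'
      refine Finset.sum_congr rfl fun y _ => ?_
      simp only [Finset.sum_mul, Finset.smul_sum, Finset.sum_smul, smul_smul]
      rw [Finset.sum_comm]
      refine Finset.sum_congr rfl fun z _ => Finset.sum_congr rfl fun z' _ => ?_
      congr 1; ring)

lemma boxFreeHom_mk (e : pairHom d a c) (φ : a ⟶ b) (m : eqvFun K.t (K.gr q) c.size) :
    boxFreeHom K q b d (BoxGroup.mk (N := fixMod n K.t (K.gr q)) e (free.elt φ) m) =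
      boxFun e (show orbitHom a b from φ) m := by
  change FreeAbelianGroup.lift _ (FreeAbelianGroup.of _) = _
  rw [FreeAbelianGroup.lift_apply_of]
  rfl

/-- The map `F_b □ K_q → Map(Θ_b, K_q)`. -/
def boxFree (K : GComplex) (q : ℤ) (b : Orbit n) :
    ((box n).obj (free.obj b)).obj (fixMod n K.t (K.gr q)) ⟶
      fixMod n (K.funT b.size) (funGr K b.size q) :=
  ObjectProperty.homMk
    { app := fun d => AddCommGrpCat.ofHom (boxFreeHom K q b d.unop)
      naturality := fun d d' ψ => by
        refine AddCommGrpCat.hom_ext (BoxGroup.hom_ext fun a c e φ m => ?_)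
        change boxFreeHom K q b d'.unop (BoxGroup.map (𝟙 _) (𝟙 _) ψ.unop (BoxGroup.mk e φ m)) =
          eqvAct (show orbitHom d'.unop d.unop from ψ.unop)
            (boxFreeHom K q b d.unop (BoxGroup.mk e φ m))
        rw [BoxGroup.map_mk]
        exact (boxFreeHom_mk ..).trans ((boxFun_pairPre ..).trans
          (congrArg _ (boxFreeHom_mk ..).symm)) }

end boxFree

/-! ### The orbits of a product of two orbits -/

section boxFree

variable {K : GComplex} {q : ℤ} {b d : Orbit n}

/-- The least common multiple of two orbits. -/
def Orbit.lcm (b d : Orbit n) : Orbit n :=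
  ⟨b.size.lcm d.size, Nat.lcm_dvd b.dvd d.dvd, Nat.lcm_pos b.pos d.pos⟩

/-- The projection `Θ_l → Θ_b` for `l = lcm(b, d)`. -/
def Orbit.lcmLeft (b d : Orbit n) : ZMod (b.lcm d).size →+* ZMod b.size :=
  ZMod.castHom (Nat.dvd_lcm_left b.size d.size) _

/-- The projection `Θ_l → Θ_d` for `l = lcm(b, d)`. -/
def Orbit.lcmRight (b d : Orbit n) : ZMod (b.lcm d).size →+* ZMod d.size :=
  ZMod.castHom (Nat.dvd_lcm_right b.size d.size) _

/-- The set of orbits of `Θ_b × Θ_d`. -/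
abbrev Orbit.Idx (b d : Orbit n) : Type := Fin (b.size.gcd d.size)

/-- Each orbit of Θ_d × Θ_b is a copy of Θ_{lcm(b,d)} through exactly one point (0, j) with 0 ≤ j <
gcd(b,d). Injectivity is a comparison of congruences, and gcd · lcm = bd gives equal cardinalities.
-/
lemma Orbit.cover_bijective (b d : Orbit n) :
    Function.Bijective fun p : b.Idx d × ZMod (b.lcm d).size =>
      (b.lcmRight d p.2, b.lcmLeft d p.2 + ((p.1 : ℕ) : ZMod b.size)) := by
  rw [Fintype.bijective_iff_injective_and_card]
  constructor
  · rintro ⟨j, z⟩ ⟨j', z'⟩ h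
    obtain ⟨z, rfl⟩ := ZMod.natCast_zmod_surjective z
    obtain ⟨z', rfl⟩ := ZMod.natCast_zmod_surjective z'
    simp only [Prod.mk.injEq, map_natCast] at h
    obtain ⟨h₁, h₂⟩ := h
    rw [← Nat.cast_add, ← Nat.cast_add, ZMod.natCast_eq_natCast_iff] at h₂
    rw [ZMod.natCast_eq_natCast_iff] at h₁
    have h₃ : (j : ℕ) ≡ j' [MOD b.size.gcd d.size] :=
      Nat.ModEq.add_left_cancel (h₁.of_dvd (Nat.gcd_dvd_right _ _))
        (h₂.of_dvd (Nat.gcd_dvd_left _ _))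
    have h₄ : (j : ℕ) = j' := h₃.eq_of_lt_of_lt j.2 j'.2
    rw [h₄] at h₂
    have h₅ := modEq_lcm (Nat.ModEq.add_right_cancel' _ h₂) h₁
    exact Prod.ext (Fin.ext h₄) ((ZMod.natCast_eq_natCast_iff _ _ _).2 h₅)
  · rw [Fintype.card_prod, Fintype.card_prod, Fintype.card_fin, ZMod.card, ZMod.card, ZMod.card]
    exact (Nat.gcd_mul_lcm _ _).trans (mul_comm _ _)

lemma Orbit.sum_cover {M : Type*} [AddCommGroup M] (x : ZMod d.size) (w : ZMod b.size) (v : M) :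
    ∑ j : b.Idx d, ∑ z, (if b.lcmRight d z = x ∧ b.lcmLeft d z + ((j : ℕ) : ZMod b.size) = w
      then v else 0) = v := by
  obtain ⟨p, hp⟩ := (Orbit.cover_bijective b d).2 (x, w)
  rw [← Fintype.sum_prod_type'
    (f := fun (j : b.Idx d) z => if b.lcmRight d z = x ∧ b.lcmLeft d z + ((j : ℕ) : ZMod b.size) = w
      then v else 0), Finset.sum_eq_single p]
  · rw [if_pos]
    exact ⟨congrArg Prod.fst hp, congrArg Prod.snd hp⟩
  · intro p' _ hne
    rw [if_neg]
    rintro ⟨h₁, h₂⟩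
    exact hne ((Orbit.cover_bijective b d).1 ((Prod.ext h₁ h₂).trans hp.symm))
  · simp

/-- The inclusion of an orbit of `Θ_d × Θ_b`. -/
def coverPair (b d : Orbit n) (j : b.Idx d) : pairHom d b (b.lcm d) :=
  ⟨fun x w z => if b.lcmRight d z = x ∧ b.lcmLeft d z + ((j : ℕ) : ZMod b.size) = w then 1 else 0,
    fun x w z => by
      simp only [map_add, map_one, add_left_inj, add_right_comm _ (1 : ZMod b.size)]⟩

/-- The restriction of a function to an orbit of `Θ_d × Θ_b`. -/
def coverFun (b d : Orbit n) (j : b.Idx d) :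
    eqvFun (K.funT b.size) (funGr K b.size q) d.size →+ eqvFun K.t (K.gr q) (b.lcm d).size where
  toFun f := ⟨fun z => f.1 (b.lcmRight d z) (b.lcmLeft d z + ((j : ℕ) : ZMod b.size)), fun z => by
    refine ⟨?_, (f.2 _).2 _⟩
    beta_reduce
    rw [map_add, map_one, (f.2 _).1, map_add, map_one]
    change K.t (f.1 _ _) = _
    rw [add_right_comm, add_sub_cancel_right]⟩
  map_zero' := rfl
  map_add' _ _ := rfl

/-- The inverse of `boxFreeHom`. -/
def boxFreeInv (K : GComplex) (q : ℤ) (b d : Orbit n) :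
    eqvFun (K.funT b.size) (funGr K b.size q) d.size →+
      BoxGroup (free.obj b) (fixMod n K.t (K.gr q)) d :=
  ∑ j : b.Idx d, (AddMonoidHom.mk' (fun m : eqvFun K.t (K.gr q) (b.lcm d).size =>
      BoxGroup.mk (N := fixMod n K.t (K.gr q)) (coverPair b d j) (free.elt (𝟙 b)) m)
    fun m m' => BoxGroup.add_m' (N := fixMod n K.t (K.gr q)) _ _ m m').comp (coverFun b d j)

lemma boxFreeInv_apply (f : eqvFun (K.funT b.size) (funGr K b.size q) d.size) :
    boxFreeInv K q b d f = ∑ j : b.Idx d, BoxGroup.mk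
      (N := fixMod n K.t (K.gr q)) (coverPair b d j) (free.elt (𝟙 b)) (coverFun b d j f) := by
  rw [boxFreeInv, AddMonoidHom.finsetSum_apply]; rfl

lemma boxFreeHom_inv (f : eqvFun (K.funT b.size) (funGr K b.size q) d.size) :
    boxFreeHom K q b d (boxFreeInv K q b d f) = f := by
  have hj (j : b.Idx d) := boxFreeHom_mk (coverPair b d j) (𝟙 b) (coverFun b d j f)
  rw [boxFreeInv_apply, map_sum, Finset.sum_congr rfl fun j _ => hj j]
  refine boxFun_ext fun x w => ?_
  rw [AddSubgroup.val_finsetSum, Finset.sum_apply, Finset.sum_apply]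
  refine Eq.trans (Finset.sum_congr rfl fun j _ => ?_) (Orbit.sum_cover x w (f.1 x w))
  rw [boxFun_apply, Finset.sum_comm]
  refine Finset.sum_congr rfl fun z _ => ?_
  change ∑ y, ((if b.lcmRight d z = x ∧ b.lcmLeft d z + ((j : ℕ) : ZMod b.size) = y then (1 : ℤ)
    else 0) * if y = w then 1 else 0) •
      f.1 (b.lcmRight d z) (b.lcmLeft d z + ((j : ℕ) : ZMod b.size)) = _
  rw [Finset.sum_eq_single w (fun y _ hy => by rw [if_neg hy]; simp) (by simp), if_pos rfl, mul_one]
  split_ifs with h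
  · rw [h.1, h.2, one_smul]
  · rw [zero_smul]

/-- The symbol of `M □ N` as a function of its first argument. -/
def BoxGroup.mkHom {M N : MackeyMod n} {a c d : Orbit n} (m : M.val a) (m' : N.val c) :
    pairHom d a c →+ BoxGroup M N d :=
  AddMonoidHom.mk' (fun e => BoxGroup.mk e m m') fun e e' => BoxGroup.add_e e e' m m'

/-- The restriction of `e` to the j-th orbit is a morphism ψ_j : Θ_{lcm(b,d)} → Θ_c. The relation
`BoxGroup.right` moves ψ_j from `m` back to the matrix, and the pieces over all orbits add up to
`e`. -/
lemma boxFreeInv_hom_mk {c : Orbit n} (e : pairHom d b c) (m : eqvFun K.t (K.gr q) c.size) :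
    boxFreeInv K q b d (boxFun e (show orbitHom b b from 𝟙 b) m) =
      BoxGroup.mk (N := fixMod n K.t (K.gr q)) e (free.elt (𝟙 b)) m := by
  let ψ (j : b.Idx d) : orbitHom (b.lcm d) c :=
    ⟨fun z z' => e.1 (b.lcmRight d z) (b.lcmLeft d z + ((j : ℕ) : ZMod b.size)) z', fun z z' => by
      beta_reduce
      rw [map_add, map_add, map_one, map_one, add_right_comm, e.2]⟩
  have hψ (j : b.Idx d) : coverFun b d j (boxFun e (show orbitHom b b from 𝟙 b) m) =
      eqvAct (ψ j) m := Subtype.ext <| funext fun z => by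
    rw [eqvAct_apply]
    change ∑ y, ∑ z', (e.1 (b.lcmRight d z) y z' *
      if y = b.lcmLeft d z + ((j : ℕ) : ZMod b.size) then 1 else 0) • m.1 z' = _
    rw [Finset.sum_eq_single (b.lcmLeft d z + ((j : ℕ) : ZMod b.size))
      (fun y _ hy => by simp [if_neg hy]) (by simp)]
    simp only [if_true, mul_one]
    rfl
  rw [boxFreeInv_apply]
  refine (Finset.sum_congr rfl fun j _ => ?_).trans
    ((map_sum (BoxGroup.mkHom (M := free.obj b) (N := fixMod n K.t (K.gr q)) (free.elt (𝟙 b)) m)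
    (fun j : b.Idx d => pairRight (show b.lcm d ⟶ c from ψ j) (coverPair b d j))
      Finset.univ).symm.trans ?_)
  · rw [hψ]
    exact (BoxGroup.right (N := fixMod n K.t (K.gr q)) (show b.lcm d ⟶ c from ψ j)
      (coverPair b d j) (free.elt (𝟙 b)) m).symm
  · refine congrArg (BoxGroup.mkHom (M := free.obj b) (N := fixMod n K.t (K.gr q))
      (free.elt (𝟙 b)) m) ?_
    refine Subtype.ext (funext fun x => funext fun w => funext fun z' => ?_)
    rw [AddSubgroup.val_finsetSum, Finset.sum_apply, Finset.sum_apply, Finset.sum_apply]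
    refine Eq.trans (Finset.sum_congr rfl fun j _ => ?_) (Orbit.sum_cover x w (e.1 x w z'))
    refine Finset.sum_congr rfl fun z _ => ?_
    change (if b.lcmRight d z = x ∧ b.lcmLeft d z + ((j : ℕ) : ZMod b.size) = w then (1 : ℤ)
      else 0) * e.1 (b.lcmRight d z) (b.lcmLeft d z + ((j : ℕ) : ZMod b.size)) z' = _
    split_ifs with h
    · rw [h.1, h.2, one_mul]
    · rw [zero_mul]

/-- Co-Yoneda: every element φ of F_b is φ^* of the generator, so the relation `BoxGroup.left`
reduces to symbols whose first entry is the identity. -/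
lemma boxFreeInv_hom (g : BoxGroup (free.obj b) (fixMod n K.t (K.gr q)) d) :
    boxFreeInv K q b d (boxFreeHom K q b d g) = g := by
  refine DFunLike.congr_fun (f := (boxFreeInv K q b d).comp (boxFreeHom K q b d))
    (g := AddMonoidHom.id _) (BoxGroup.hom_ext fun a c e φ m => ?_) g
  have h := BoxGroup.left (N := fixMod n K.t (K.gr q)) (show a ⟶ b from φ) e
    (free.elt (𝟙 b)) m
  have h' : (free.obj b).act (show a ⟶ b from φ) (free.elt (𝟙 b)) = φ :=
    Category.comp_id (show a ⟶ b from φ)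
  rw [h'] at h
  rw [← h]
  change boxFreeInv K q b d (boxFreeHom K q b d _) = _
  refine (congrArg _ (boxFreeHom_mk ..)).trans (boxFreeInv_hom_mk ..)

instance (K : GComplex) (q : ℤ) (b : Orbit n) : IsIso (boxFree K q b) :=
  MackeyMod.isIso_of_bijective _ fun d =>
    ⟨Function.LeftInverse.injective (g := boxFreeInv K q b d) boxFreeInv_hom,
      Function.RightInverse.surjective (g := boxFreeInv K q b d) boxFreeHom_inv⟩

end boxFree

/-! ## The total complex of a box product with a sphere -/

section fixMod

variable {A A' A'' : Type} [AddCommGroup A] [AddCommGroup A'] [AddCommGroup A'']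
  {t : A →+ A} {P : AddSubgroup A} {t' : A' →+ A'} {P' : AddSubgroup A'}
  {t'' : A'' →+ A''} {P'' : AddSubgroup A''}

lemma fixMod.hom_ext {M : MackeyMod n} {f g : M ⟶ fixMod n t P}
    (h : ∀ (d : Orbit n) (m : M.val d) (x : ZMod d.size),
      (show eqvFun t P d.size from MackeyMod.component f d m).1 x =
        (show eqvFun t P d.size from MackeyMod.component g d m).1 x) : f = g :=
  MackeyMod.hom_ext' fun d m => Subtype.ext (funext fun x => h d m x)

lemma fixMod.map_comp (f : A →+ A') (hf : ∀ x, f (t x) = t' (f x)) (hP : ∀ x ∈ P, f x ∈ P')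
    (g : A' →+ A'') (hg : ∀ x, g (t' x) = t'' (g x)) (hP' : ∀ x ∈ P', g x ∈ P'') :
    fixMod.map (n := n) f hf hP ≫ fixMod.map g hg hP' =
      fixMod.map (g.comp f) (fun x => (congrArg g (hf x)).trans (hg _))
        (fun x hx => hP' _ (hP x hx)) := rfl

lemma fixMod.isZero (h : ∀ x ∈ P, x = 0) : IsZero (fixMod n t P) :=
  MackeyMod.isZero_of_eq_zero fun _ m => Subtype.ext (funext fun x => h _ (m.2 x).2)

end fixMod

namespace GComplex

variable (K : GComplex)

/-- The differential of a graded group with differential, as a map of modules. -/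
def diff (n : ℕ) {q q' : ℤ} (h : q' = q - 1) :
    fixMod n K.t (K.gr q) ⟶ fixMod n K.t (K.gr q') :=
  fixMod.map K.d (fun x => (K.t_d x).symm) fun _ hx => h ▸ K.d_mem hx

lemma diff_comp_diff {q q' q'' : ℤ} (h : q' = q - 1) (h' : q'' = q' - 1) :
    K.diff n h ≫ K.diff n h' = 0 :=
  fixMod.hom_ext fun _ _ _ => K.d_d _

/-- The chain complex of modules whose value at `Θ_d` consists of the equivariant functions
on `Θ_d`. -/
def cplx (n : ℕ) : ChainComplex (MackeyMod n) ℕ :=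
  ChainComplex.of (fun k => fixMod n K.t (K.gr k)) (fun k => K.diff n (by push_cast; ring))
    fun _ => K.diff_comp_diff _ _

lemma cplx_d (k : ℕ) : (K.cplx n).d (k + 1) k = K.diff n (by push_cast; ring) :=
  ChainComplex.of_d (fun k : ℕ => fixMod n K.t (K.gr k)) (fun k => K.diff n (by push_cast; ring)) k

end GComplex

section boxFree

variable {K : GComplex} {q q' : ℤ} {b b' : Orbit n}

/-- Pushforward of functions along an invariant matrix. -/
def pushFun (K : GComplex) (ψ : orbitHom b b') :
    (ZMod b.size → K.A) →+ (ZMod b'.size → K.A) where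
  toFun f w' := ∑ w, ψ.1 w w' • f w
  map_zero' := funext fun w' => by simp
  map_add' f g := funext fun w' => by simp [Finset.sum_add_distrib]

lemma pushFun_funT (ψ : orbitHom b b') (f : ZMod b.size → K.A) :
    pushFun K ψ (K.funT b.size f) = K.funT b'.size (pushFun K ψ f) := funext fun w' => by
  change ∑ w, ψ.1 w w' • K.t (f (w - 1)) = K.t (∑ w, ψ.1 w (w' - 1) • f w)
  rw [map_sum, ← Equiv.sum_comp (Equiv.addRight (1 : ZMod b.size))]
  refine Finset.sum_congr rfl fun w _ => ?_
  have h := ψ.2 w (w' - 1)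
  rw [sub_add_cancel] at h
  rw [Equiv.coe_addRight, add_sub_cancel_right, map_zsmul, h]

lemma pushFun_mem (ψ : orbitHom b b') {f : ZMod b.size → K.A} (hf : f ∈ funGr K b.size q) :
    pushFun K ψ f ∈ funGr K b'.size q :=
  fun _ => sum_mem fun w _ => zsmul_mem (hf w) _

lemma boxFree_left (ψ : orbitHom b b') :
    ((box n).map (free.map (show b ⟶ b' from ψ))).app (fixMod n K.t (K.gr q)) ≫ boxFree K q b' =
      boxFree K q b ≫ fixMod.map (pushFun K ψ) (pushFun_funT ψ) fun _ => pushFun_mem ψ :=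
  box_hom_ext fun d a c e φ m => boxFun_ext fun x w' => by
    have h : MackeyMod.component (((box n).map (free.map (show b ⟶ b' from ψ))).app
        (fixMod n K.t (K.gr q))) d (BoxGroup.mk e φ m) =
      BoxGroup.mk (N := fixMod n K.t (K.gr q)) e
        (free.elt (show a ⟶ b' from orbitComp (show orbitHom a b from φ) ψ)) m := boxMap_mk ..
    have h₁ := (congrArg (boxFreeHom K q b' d) h).trans (boxFreeHom_mk ..)
    have h₂ := boxFreeHom_mk (K := K) (q := q) (b := b) e (show a ⟶ b from φ) m
    refine (congrArg (fun f : eqvFun (K.funT b'.size) (funGr K b'.size q) d.size => f.1 x w')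
      h₁).trans (Eq.trans ?_ (congrArg (fun f : eqvFun (K.funT b.size) (funGr K b.size q) d.size =>
        pushFun K ψ (f.1 x) w') h₂.symm))
    change ∑ y, ∑ z, (e.1 x y z * ∑ w, (show orbitHom a b from φ).1 y w * ψ.1 w w') •
        (show eqvFun K.t (K.gr q) c.size from m).1 z =
      ∑ w, ψ.1 w w' • ∑ y, ∑ z, (e.1 x y z * (show orbitHom a b from φ).1 y w) •
        (show eqvFun K.t (K.gr q) c.size from m).1 z
    simp only [Finset.mul_sum, Finset.sum_smul, Finset.smul_sum, smul_smul]
    conv_rhs => rw [Finset.sum_comm]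
    refine Finset.sum_congr rfl fun y _ => ?_
    rw [Finset.sum_comm]
    refine Finset.sum_congr rfl fun w _ => Finset.sum_congr rfl fun z _ => ?_
    congr 1; ring

/-- The differential on functions. -/
def funD (K : GComplex) (b : ℕ) : (ZMod b → K.A) →+ (ZMod b → K.A) where
  toFun f w := K.d (f w)
  map_zero' := funext fun _ => map_zero K.d
  map_add' _ _ := funext fun _ => map_add K.d _ _

lemma boxFree_right (h : q' = q - 1) :
    ((box n).obj (free.obj b)).map (K.diff n h) ≫ boxFree K q' b =
      boxFree K q b ≫ fixMod.map (funD K b.size) (fun _ => funext fun _ => (K.t_d _).symm)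
        (P' := funGr K b.size q') fun _ hf w => h ▸ K.d_mem (hf w) :=
  box_hom_ext fun d a c e φ m => boxFun_ext fun x w => by
    have h₀ : MackeyMod.component (((box n).obj (free.obj b)).map (K.diff n h)) d
        (BoxGroup.mk e φ m) = BoxGroup.mk (N := fixMod n K.t (K.gr q')) e
          (free.elt (show a ⟶ b from φ)) (MackeyMod.component (K.diff n h) c m) := boxMap_mk ..
    have h₁ := (congrArg (boxFreeHom K q' b d) h₀).trans (boxFreeHom_mk ..)
    have h₂ := boxFreeHom_mk (K := K) (q := q) (b := b) e (show a ⟶ b from φ) m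
    refine (congrArg (fun f : eqvFun (K.funT b.size) (funGr K b.size q') d.size => f.1 x w)
      h₁).trans (Eq.trans ?_ (congrArg (fun f : eqvFun (K.funT b.size) (funGr K b.size q) d.size =>
        funD K b.size (f.1 x) w) h₂.symm))
    change ∑ y, ∑ z, (e.1 x y z * (show orbitHom a b from φ).1 y w) •
        K.d ((show eqvFun K.t (K.gr q) c.size from m).1 z) =
      K.d (∑ y, ∑ z, (e.1 x y z * (show orbitHom a b from φ).1 y w) •
        (show eqvFun K.t (K.gr q) c.size from m).1 z)
    simp only [map_sum, map_zsmul]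

end boxFree

/-! ### The comparison map -/

section compare

variable {K : GComplex} {b : Orbit n}

namespace GComplex

/-- The inclusion of the summand in position `0`. -/
def incl₀ (K : GComplex) (b : Orbit n) :
    (ZMod (Orbit.one n).size → K.A) →+ (L b.size K).A where
  toFun f := tri (f 0) 0 0
  map_zero' := rfl
  map_add' _ _ := by rw [tri_add, add_zero]; rfl

/-- The inclusion of the summand in position `1`. -/
def incl₁ (K : GComplex) (b : Orbit n) : (ZMod b.size → K.A) →+ (L b.size K).A where
  toFun f := tri 0 f 0
  map_zero' := rfl
  map_add' _ _ := by rw [tri_add, add_zero, add_zero]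

/-- The inclusion of the summand in position `2`. -/
def incl₂ (K : GComplex) (b : Orbit n) : (ZMod b.size → K.A) →+ (L b.size K).A where
  toFun f := tri 0 0 f
  map_zero' := rfl
  map_add' _ _ := by rw [tri_add, add_zero, add_zero]

/-- The projection to the summand in position `0`. -/
def proj₀ (K : GComplex) (b : Orbit n) :
    (L b.size K).A →+ (ZMod (Orbit.one n).size → K.A) where
  toFun x _ := x.1
  map_zero' := rfl
  map_add' _ _ := rfl

/-- The projection to the summand in position `1`. -/
def proj₁ (K : GComplex) (b : Orbit n) : (L b.size K).A →+ (ZMod b.size → K.A) where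
  toFun x := x.2.1
  map_zero' := rfl
  map_add' _ _ := rfl

/-- The projection to the summand in position `2`. -/
def proj₂ (K : GComplex) (b : Orbit n) : (L b.size K).A →+ (ZMod b.size → K.A) where
  toFun x := x.2.2
  map_zero' := rfl
  map_add' _ _ := rfl

lemma tri_mem {a : K.A} {f h : ZMod b.size → K.A} {k : ℤ} (h₁ : a ∈ K.gr k)
    (h₂ : ∀ y, f y ∈ K.gr (k - 1)) (h₃ : ∀ y, h y ∈ K.gr (k - 2)) :
    tri a f h ∈ (L b.size K).gr k := ⟨h₁, h₂, h₃⟩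

lemma t_tri (a : K.A) (f h : ZMod b.size → K.A) :
    (L b.size K).t (tri a f h) = tri (K.t a) (K.funT b.size f) (K.funT b.size h) := rfl

end GComplex

open GComplex

/-- The isomorphism `F_b □ K_q ≅ Map(Θ_b, K_q)`. -/
def boxFreeIso (K : GComplex) (q : ℤ) (b : Orbit n) :
    ((box n).obj (free.obj b)).obj (fixMod n K.t (K.gr q)) ≅
      fixMod n (K.funT b.size) (funGr K b.size q) := asIso (boxFree K q b)

/-- The map from `X_p □ K_q` to the total complex, for `X = S^{λ_b}`. -/
def lamMap (K : GComplex) (b : Orbit n) : ∀ (p : ℕ) (q k : ℤ), p + q = k →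
    (((box n).obj (lambdaX b p)).obj (fixMod n K.t (K.gr q)) ⟶
      fixMod n (L b.size K).t ((L b.size K).gr k))
  | 0, q, k, h => boxFree K q (Orbit.one n) ≫ fixMod.map (incl₀ K b)
      (fun f => by
        change tri (K.t (f (0 - 1))) 0 0 = (L b.size K).t (tri (f 0) 0 0)
        rw [t_tri, map_zero, Subsingleton.elim (0 - 1) (0 : ZMod (Orbit.one n).size)])
      (fun f hf => tri_mem (by
        have h' : q = k := by rw [← h]; simp
        exact h' ▸ hf 0) (fun _ => zero_mem _) (fun _ => zero_mem _))
  | 1, q, k, h => boxFree K q b ≫ fixMod.map (incl₁ K b)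
      (fun f => by
        change tri 0 (K.funT b.size f) 0 = (L b.size K).t (tri 0 f 0)
        rw [t_tri, map_zero, map_zero])
      (fun f hf => tri_mem (zero_mem _) (fun y => by
        have h' : q = k - 1 := by rw [← h]; simp
        exact h' ▸ hf y) (fun _ => zero_mem _))
  | 2, q, k, h => boxFree K q b ≫ fixMod.map (incl₂ K b)
      (fun f => by
        change tri 0 0 (K.funT b.size f) = (L b.size K).t (tri 0 0 f)
        rw [t_tri, map_zero, map_zero])
      (fun f hf => tri_mem (zero_mem _) (fun _ => zero_mem _) (fun y => by
        have h' : q = k - 2 := by rw [← h]; simp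
        exact h' ▸ hf y))
  | _ + 3, _, _, _ => 0

/-- The projection from the total complex to `X_p □ K_q`, for `X = S^{λ_b}`. -/
def lamProj (K : GComplex) (b : Orbit n) : ∀ (p : ℕ) (q k : ℤ), p + q = k →
    (fixMod n (L b.size K).t ((L b.size K).gr k) ⟶
      ((box n).obj (lambdaX b p)).obj (fixMod n K.t (K.gr q)))
  | 0, q, k, h => fixMod.map (proj₀ K b) (fun _ => rfl) (P' := funGr K (Orbit.one n).size q)
      (fun x hx _ => by
        have h' : k = q := by rw [← h]; simp
        exact h' ▸ hx.1) ≫ (boxFreeIso K q (Orbit.one n)).inv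
  | 1, q, k, h => fixMod.map (proj₁ K b) (fun _ => rfl) (P' := funGr K b.size q)
      (fun x hx y => by
        have h' : k - 1 = q := by rw [← h]; simp
        exact h' ▸ hx.2.1 y) ≫ (boxFreeIso K q b).inv
  | 2, q, k, h => fixMod.map (proj₂ K b) (fun _ => rfl) (P' := funGr K b.size q)
      (fun x hx y => by
        have h' : k - 2 = q := by rw [← h]; simp
        exact h' ▸ hx.2.2 y) ≫ (boxFreeIso K q b).inv
  | _ + 3, _, _, _ => 0

lemma isZero_box_lambdaX (b : Orbit n) (p : ℕ) (M : MackeyMod n) :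
    IsZero (((box n).obj (lambdaX b (p + 3))).obj M) :=
  ((box n).map_isZero (isZero_zero _)).obj M

lemma lamMap_lamProj (p : ℕ) {q k : ℤ} (h : p + q = k) :
    lamMap K b p q k h ≫ lamProj K b p q k h = 𝟙 _ := by
  have aux {A : Type} [AddCommGroup A] {t : A →+ A} {P : AddSubgroup A} {X : MackeyMod n}
      (f : X ≅ fixMod n t P) (i : A →+ (L b.size K).A) (hi hi')
      (j : (L b.size K).A →+ A) (hj hj') (hij : ∀ x ∈ P, j (i x) = x) :
      (f.hom ≫ fixMod.map (t' := (L b.size K).t) (P' := (L b.size K).gr k) i hi hi') ≫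
        fixMod.map j hj hj' ≫ f.inv = 𝟙 X := by
    rw [Category.assoc, ← Category.assoc (fixMod.map _ _ _), fixMod.map_comp,
      show fixMod.map (n := n) (j.comp i) _ _ = 𝟙 (fixMod n t P) from
        fixMod.hom_ext fun d m x => hij _ (m.2 x).2, Category.id_comp, Iso.hom_inv_id]
  match p, h with
  | 0, h => exact aux (boxFreeIso K q (Orbit.one n)) _ _ _ _ _ _ fun f _ => funext fun y =>
      congrArg f (Subsingleton.elim 0 y)
  | 1, h => exact aux (boxFreeIso K q b) _ _ _ _ _ _ fun f _ => rfl
  | 2, h => exact aux (boxFreeIso K q b) _ _ _ _ _ _ fun f _ => rfl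
  | p + 3, h => exact (isZero_box_lambdaX b p _).eq_of_src _ _

lemma lamMap_lamProj_ne {p p' : ℕ} (hp : p ≠ p') {q q' k : ℤ} (h : p + q = k) (h' : p' + q' = k) :
    lamMap K b p q k h ≫ lamProj K b p' q' k h' = 0 := by
  have aux {A : Type} [AddCommGroup A] {t : A →+ A} {P : AddSubgroup A} {A' : Type}
      [AddCommGroup A'] {t' : A' →+ A'} {P' : AddSubgroup A'} {X Y : MackeyMod n}
      (f : X ⟶ fixMod n t P) (i : A →+ (L b.size K).A) (hi hi') (j : (L b.size K).A →+ A') (hj hj')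
      (g : fixMod n t' P' ⟶ Y) (hij : ∀ x, j (i x) = 0) :
      (f ≫ fixMod.map (t' := (L b.size K).t) (P' := (L b.size K).gr k) i hi hi') ≫ fixMod.map j hj hj' ≫ g = 0 := by
    rw [Category.assoc, ← Category.assoc (fixMod.map _ _ _), fixMod.map_comp,
      show fixMod.map (n := n) (j.comp i) _ _ = 0 from fixMod.hom_ext fun d m x => hij _,
      zero_comp, comp_zero]
  match p, p', h, h' with
  | 0, 1, h, h' => exact aux _ _ _ _ _ _ _ _ fun _ => rfl
  | 0, 2, h, h' => exact aux _ _ _ _ _ _ _ _ fun _ => rfl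
  | 1, 0, h, h' => exact aux _ _ _ _ _ _ _ _ fun _ => rfl
  | 1, 2, h, h' => exact aux _ _ _ _ _ _ _ _ fun _ => rfl
  | 2, 0, h, h' => exact aux _ _ _ _ _ _ _ _ fun _ => rfl
  | 2, 1, h, h' => exact aux _ _ _ _ _ _ _ _ fun _ => rfl
  | p + 3, p', h, h' => exact (isZero_box_lambdaX b p _).eq_of_src _ _
  | p, p' + 3, h, h' => exact comp_zero
  | 0, 0, h, h' => exact absurd rfl hp
  | 1, 1, h, h' => exact absurd rfl hp
  | 2, 2, h, h' => exact absurd rfl hp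

lemma sum_lamProj_lamMap {q₀ q₁ q₂ k : ℤ} (h₀ : (0 : ℕ) + q₀ = k) (h₁ : (1 : ℕ) + q₁ = k)
    (h₂ : (2 : ℕ) + q₂ = k) :
    lamProj K b 0 q₀ k h₀ ≫ lamMap K b 0 q₀ k h₀ + lamProj K b 1 q₁ k h₁ ≫ lamMap K b 1 q₁ k h₁ +
      lamProj K b 2 q₂ k h₂ ≫ lamMap K b 2 q₂ k h₂ = 𝟙 _ := by
  have aux {A : Type} [AddCommGroup A] {t : A →+ A} {P : AddSubgroup A} {X : MackeyMod n}
      (f : X ≅ fixMod n t P) (i : A →+ (L b.size K).A) (hi hi')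
      (j : (L b.size K).A →+ A) (hj hj') (d : Orbit n)
      (m : (fixMod n (L b.size K).t ((L b.size K).gr k)).val d) (x : ZMod d.size) :
      (show eqvFun (L b.size K).t ((L b.size K).gr k) d.size from
        MackeyMod.component ((fixMod.map j hj hj' ≫ f.inv) ≫
          f.hom ≫ fixMod.map (t' := (L b.size K).t) (P' := (L b.size K).gr k) i hi hi') d m).1 x =
      i (j ((show eqvFun (L b.size K).t ((L b.size K).gr k) d.size from m).1 x)) := by
    rw [Category.assoc, Iso.inv_hom_id_assoc, fixMod.map_comp]
    rfl
  refine fixMod.hom_ext fun d m x => ?_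
  refine (congrArg₂ (· + ·) (congrArg₂ (· + ·)
    (aux (boxFreeIso K q₀ (Orbit.one n)) (incl₀ K b) _ _ (proj₀ K b) _ _ d m x)
    (aux (boxFreeIso K q₁ b) (incl₁ K b) _ _ (proj₁ K b) _ _ d m x))
    (aux (boxFreeIso K q₂ b) (incl₂ K b) _ _ (proj₂ K b) _ _ d m x)).trans ?_
  obtain ⟨a, f, h, hm⟩ := exists_eq_tri
    ((show eqvFun (L b.size K).t ((L b.size K).gr k) d.size from m).1 x)
  rw [hm]
  change tri a 0 0 + tri 0 f 0 + tri 0 0 h = _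
  rw [tri_add, tri_add]
  simp only [add_zero, zero_add]
  exact hm.symm

end compare

/-! ### Compatibility of the summand maps with the differentials -/

section compare

open GComplex

variable {K : GComplex} {b : Orbit n} {q q' k k' : ℤ}

lemma pushFun_Rpi (f : ZMod b.size → K.A) (y : ZMod (Orbit.one n).size) :
    pushFun K (show orbitHom b (Orbit.one n) from Rpi b) f y = ∑ w, f w := by
  change ∑ w, (if (0 : ZMod (Orbit.one n).size) = y then (1 : ℤ) else 0) • f w = _
  simp only [if_pos (Subsingleton.elim (0 : ZMod (Orbit.one n).size) y), one_smul]

lemma pushFun_Rt (f : ZMod b.size → K.A) (y : ZMod b.size) :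
    pushFun K (show orbitHom b b from Rt b) f y = f (y - 1) := by
  change ∑ w, (if w + 1 = y then (1 : ℤ) else 0) • f w = _
  rw [Finset.sum_eq_single (y - 1) (fun w _ hw => by
    rw [if_neg fun h => hw (eq_sub_of_add_eq h), zero_smul]) (by simp), sub_add_cancel, if_pos rfl,
    one_smul]

lemma lamMap_zero_diff (h : (0 : ℕ) + q = k) (hk : k' = k - 1) (hq : q' = q - 1)
    (h' : (0 : ℕ) + q' = k') :
    lamMap K b 0 q k h ≫ (L b.size K).diff n hk =
      ((box n).obj (lambdaX b 0)).map (K.diff n hq) ≫ lamMap K b 0 q' k' h' := by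
  refine (Category.assoc (boxFree K q (Orbit.one n)) _ _).trans ?_
  refine Eq.trans ?_ (Category.assoc (((box n).obj (free.obj (Orbit.one n))).map (K.diff n hq))
    (boxFree K q' (Orbit.one n)) _)
  rw [boxFree_right, Category.assoc]
  refine congrArg (boxFree K q (Orbit.one n) ≫ ·) (fixMod.hom_ext fun d m x => ?_)
  change (L b.size K).d (tri (m.1 x 0) 0 0) = tri (K.d (m.1 x 0)) 0 0
  rw [L_d]
  exact tri_congr (by simp) (by simp) (by simp)

lemma lamMap_one_diff (h : (1 : ℕ) + q = k) (hk : k' = k - 1) (hq : q' = q - 1)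
    (h' : (0 : ℕ) + q = k') (h'' : (1 : ℕ) + q' = k') :
    lamMap K b 1 q k h ≫ (L b.size K).diff n hk =
      ((box n).map (lambdaD b 0)).app _ ≫ lamMap K b 0 q k' h' -
      ((box n).obj (lambdaX b 1)).map (K.diff n hq) ≫ lamMap K b 1 q' k' h'' := by
  refine (Category.assoc (boxFree K q b) _ _).trans (Eq.trans ?_ (congrArg₂ (· - ·)
    (Category.assoc (((box n).map (free.map (Rpi b))).app (fixMod n K.t (K.gr q)))
      (boxFree K q (Orbit.one n)) _)
    (Category.assoc (((box n).obj (free.obj b)).map (K.diff n hq)) (boxFree K q' b) _)))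
  rw [boxFree_right]
  refine Eq.trans ?_ (congrArg (fun u => u ≫ fixMod.map _ _ _ - _)
    (boxFree_left (K := K) (q := q) (Rpi b)).symm)
  rw [Category.assoc, Category.assoc, ← Preadditive.comp_sub]
  refine congrArg (boxFree K q b ≫ ·) (fixMod.hom_ext fun d m x => ?_)
  change (L b.size K).d (tri 0 (m.1 x) 0) =
    tri (pushFun K (show orbitHom b (Orbit.one n) from Rpi b) (m.1 x) 0) 0 0 -
      tri 0 (fun w => K.d (m.1 x w)) 0
  rw [pushFun_Rpi, L_d, tri_sub]
  exact tri_congr (by simp) (by simp) (by simp)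

lemma lamMap_two_diff (h : (2 : ℕ) + q = k) (hk : k' = k - 1) (hq : q' = q - 1)
    (h' : (1 : ℕ) + q = k') (h'' : (2 : ℕ) + q' = k') :
    lamMap K b 2 q k h ≫ (L b.size K).diff n hk =
      ((box n).map (lambdaD b 1)).app _ ≫ lamMap K b 1 q k' h' +
      ((box n).obj (lambdaX b 2)).map (K.diff n hq) ≫ lamMap K b 2 q' k' h'' := by
  refine (Category.assoc (boxFree K q b) _ _).trans (Eq.trans ?_ (congrArg₂ (· + ·)
    (Category.assoc (((box n).map (𝟙 (free.obj b) - free.map (Rt b))).app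
      (fixMod n K.t (K.gr q))) (boxFree K q b) _)
    (Category.assoc (((box n).obj (free.obj b)).map (K.diff n hq)) (boxFree K q' b) _)))
  rw [boxFree_right, Functor.map_sub, NatTrans.app_sub, CategoryTheory.Functor.map_id, NatTrans.id_app,
    Preadditive.sub_comp, Category.id_comp]
  refine Eq.trans ?_ (congrArg (fun u => (boxFree K q b - u) ≫ fixMod.map _ _ _ + _)
    (boxFree_left (K := K) (q := q) (Rt b)).symm)
  rw [Preadditive.sub_comp, Category.assoc, Category.assoc, ← Preadditive.comp_sub,
    ← Preadditive.comp_add]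
  refine congrArg (boxFree K q b ≫ ·) (fixMod.hom_ext fun d m x => ?_)
  change (L b.size K).d (tri 0 0 (m.1 x)) =
    tri 0 (m.1 x) 0 - tri 0 (pushFun K (show orbitHom b b from Rt b) (m.1 x)) 0 +
      tri 0 0 (fun w => K.d (m.1 x w))
  rw [L_d, tri_sub, tri_add]
  exact tri_congr (by simp) (fun y => by simp [pushFun_Rt]) (by simp)

lemma lambdaX_d (b : Orbit n) (p : ℕ) : (sphereLambda b).d (p + 1) p = lambdaD b p :=
  ChainComplex.of_d (lambdaX b) (lambdaD b) p

end compare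

/-! ### Maps out of the box product of two complexes -/

section desc

open HomologicalComplex

variable {X Y : ChainComplex (MackeyMod n) ℕ} {Z Z' : MackeyMod n} {k : ℕ}
  (f : ∀ p q, p + q = k → (((box n).obj (X.X p)).obj (Y.X q) ⟶ Z))

/-- A map out of the box product of two complexes, given by its components. -/
def boxDesc : (mapBifunctor X Y (box n) (ComplexShape.down ℕ)).X k ⟶ Z :=
  mapBifunctorDesc fun p q h => f p q h

lemma ι_boxDesc {p q : ℕ} (h : p + q = k) :
    ιMapBifunctor X Y (box n) (ComplexShape.down ℕ) p q k h ≫ boxDesc f = f p q h :=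
  ι_mapBifunctorDesc ..

lemma d₁_zero_boxDesc (q : ℕ) :
    mapBifunctor.d₁ X Y (box n) (ComplexShape.down ℕ) 0 q k ≫ boxDesc f = 0 := by
  rw [mapBifunctor.d₁_eq_zero, zero_comp]
  simp

lemma d₁_succ_boxDesc {p q : ℕ} (h : p + q = k) :
    mapBifunctor.d₁ X Y (box n) (ComplexShape.down ℕ) (p + 1) q k ≫ boxDesc f =
      ((box n).map (X.d (p + 1) p)).app (Y.X q) ≫ f p q h := by
  rw [mapBifunctor.d₁_eq X Y (box n) (ComplexShape.down ℕ) (i₁' := p) rfl q k h]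
  change ((1 : ℤˣ) • _) ≫ _ = _
  rw [one_smul, Category.assoc, ι_boxDesc]

lemma d₂_zero_boxDesc (p : ℕ) :
    mapBifunctor.d₂ X Y (box n) (ComplexShape.down ℕ) p 0 k ≫ boxDesc f = 0 := by
  rw [mapBifunctor.d₂_eq_zero, zero_comp]
  simp

lemma d₂_succ_boxDesc {p q : ℕ} (h : p + q = k) :
    mapBifunctor.d₂ X Y (box n) (ComplexShape.down ℕ) p (q + 1) k ≫ boxDesc f =
      ((-1) ^ p : ℤˣ) • ((box n).obj (X.X p)).map (Y.d (q + 1) q) ≫ f p q h := by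
  rw [mapBifunctor.d₂_eq X Y (box n) (ComplexShape.down ℕ) p (i₂' := q) rfl k h]
  change (((-1) ^ p : ℤˣ) • _) ≫ _ = _
  rw [Linear.units_smul_comp, Category.assoc, ι_boxDesc]

lemma d_boxDesc {f} {f' : ∀ p q, p + q = k + 1 → (((box n).obj (X.X p)).obj (Y.X q) ⟶ Z')}
    {δ : Z' ⟶ Z} (h : ∀ p q (h : p + q = k + 1), f' p q h ≫ δ =
      mapBifunctor.d₁ X Y (box n) (ComplexShape.down ℕ) p q k ≫ boxDesc f +
      mapBifunctor.d₂ X Y (box n) (ComplexShape.down ℕ) p q k ≫ boxDesc f) :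
    boxDesc f' ≫ δ =
      (mapBifunctor X Y (box n) (ComplexShape.down ℕ)).d (k + 1) k ≫ boxDesc f := by
  refine mapBifunctor.hom_ext fun p q hpq => ?_
  rw [← Category.assoc, ι_boxDesc, h, mapBifunctor.d_eq, Preadditive.add_comp, Preadditive.comp_add,
    ← Category.assoc, ← Category.assoc, mapBifunctor.ι_D₁, mapBifunctor.ι_D₂]

end desc

/-! ### The comparison map as a chain map -/

section compare

open GComplex

variable {K : GComplex} {b : Orbit n}

lemma lamMap_succ_diff (p : ℕ) {q q' : ℤ} {k k' : ℕ} (hq : q' = q - 1) (hk : k = k' + 1)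
    (h : (p + 1 : ℕ) + q = k) (h' : p + q = k') (h'' : (p + 1 : ℕ) + q' = k') :
    lamMap K b (p + 1) q k h ≫ (L b.size K).diff n (q := k) (q' := k')
        (by rw [hk]; push_cast; ring) =
      ((box n).map (lambdaD b p)).app _ ≫ lamMap K b p q k' h' +
        ((-1) ^ (p + 1) : ℤˣ) • ((box n).obj (lambdaX b (p + 1))).map (K.diff n hq) ≫
          lamMap K b (p + 1) q' k' h'' := by
  match p with
  | 0 =>
    refine (lamMap_one_diff h _ hq h' h'').trans ?_
    rw [show ((-1) ^ (0 + 1) : ℤˣ) = -1 from rfl, Units.neg_smul, one_smul, sub_eq_add_neg]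
  | 1 =>
    refine (lamMap_two_diff h _ hq h' h'').trans ?_
    rw [show ((-1) ^ (1 + 1) : ℤˣ) = 1 from rfl, one_smul]
  | p + 2 => exact (isZero_box_lambdaX b p _).eq_of_src _ _

lemma lamMap_diff (p q : ℕ) {k : ℕ} (h : p + q = k + 1) :
    lamMap K b p q (k + 1 : ℕ) (by exact_mod_cast h) ≫ ((L b.size K).cplx n).d (k + 1) k =
      HomologicalComplex.mapBifunctor.d₁ (sphereLambda b) (K.cplx n) (box n)
          (ComplexShape.down ℕ) p q k ≫
        boxDesc (fun p q h => lamMap K b p q k (by exact_mod_cast h)) +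
      HomologicalComplex.mapBifunctor.d₂ (sphereLambda b) (K.cplx n) (box n)
          (ComplexShape.down ℕ) p q k ≫
        boxDesc (fun p q h => lamMap K b p q k (by exact_mod_cast h)) := by
  rw [cplx_d]
  match p, q, h with
  | 0, 0, h => omega
  | 0, q + 1, h =>
    refine Eq.trans ?_ (congrArg₂ (· + ·) (d₁_zero_boxDesc _ _)
      (d₂_succ_boxDesc _ (by omega))).symm
    refine Eq.trans ?_ (zero_add _).symm
    rw [pow_zero, one_smul, cplx_d]
    exact lamMap_zero_diff _ _ _ _
  | p + 1, 0, h =>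
    refine Eq.trans ?_ (congrArg₂ (· + ·) (d₁_succ_boxDesc _ (by omega))
      (d₂_zero_boxDesc _ _)).symm
    rw [lambdaX_d]
    refine Eq.trans ?_ (add_zero _).symm
    -- For q = 0 the general formula is used with q' = -1, where the module vanishes; this removes
    -- the term of the second differential.
    refine (lamMap_succ_diff p (q' := -1) (by simp) rfl (by exact_mod_cast h)
      (by push_cast; omega) (by push_cast; omega)).trans ?_
    rw [(fixMod.isZero fun x hx => K.gr_neg (by omega) hx).eq_of_tgt (K.diff n (q' := -1) _) 0,
      Functor.map_zero, zero_comp, smul_zero, add_zero]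
    rfl
  | p + 1, q + 1, h =>
    refine Eq.trans ?_ (congrArg₂ (· + ·) (d₁_succ_boxDesc _ (by omega))
      (d₂_succ_boxDesc _ (by omega))).symm
    rw [lambdaX_d, cplx_d]
    exact lamMap_succ_diff p _ rfl _ _ _

/-- The comparison map, as a map of complexes. -/
def compare (K : GComplex) (b : Orbit n) :
    boxComplex (sphereLambda b) (K.cplx n) ⟶ (L b.size K).cplx n :=
  ChainComplex.ofHom
    (fun k => boxDesc (X := sphereLambda b) (Y := K.cplx n)
      fun p q h => lamMap K b p q k (by exact_mod_cast h))
    fun _ => d_boxDesc fun p q h => lamMap_diff p q h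

lemma ι_compare {p q k : ℕ} (h : p + q = k) :
    HomologicalComplex.ιMapBifunctor (sphereLambda b) (K.cplx n) (box n) (ComplexShape.down ℕ)
      p q k h ≫ (compare K b).f k = lamMap K b p q k (by exact_mod_cast h) :=
  ι_boxDesc (X := sphereLambda b) (Y := K.cplx n) _ h

end compare

/-! ### The comparison map is an isomorphism -/

section compare

open GComplex HomologicalComplex

variable {K : GComplex} {b : Orbit n}

/-- The modules in the total complex. -/
def lamTot (K : GComplex) (b : Orbit n) (k : ℕ) : MackeyMod n :=
  (mapBifunctor (sphereLambda b) (K.cplx n) (box n) (ComplexShape.down ℕ)).X k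

/-- The inclusion of a summand of the total complex. -/
def lamι (K : GComplex) (b : Orbit n) (p q k : ℕ) (h : p + q = k) :
    ((box n).obj (lambdaX b p)).obj (fixMod n K.t (K.gr q)) ⟶ lamTot K b k :=
  ιMapBifunctor (sphereLambda b) (K.cplx n) (box n) (ComplexShape.down ℕ) p q k h

/-- The comparison map in degree `k`. -/
def lamDesc (K : GComplex) (b : Orbit n) (k : ℕ) :
    lamTot K b k ⟶ fixMod n (L b.size K).t ((L b.size K).gr k) := (compare K b).f k

lemma lamι_lamDesc {p q k : ℕ} (h : p + q = k) :
    lamι K b p q k h ≫ lamDesc K b k = lamMap K b p q k (by exact_mod_cast h) := ι_compare h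

lemma lamTot_hom_ext {k : ℕ} {M : MackeyMod n} {f g : lamTot K b k ⟶ M}
    (h : ∀ p q (h : p + q = k), lamι K b p q k h ≫ f = lamι K b p q k h ≫ g) : f = g :=
  mapBifunctor.hom_ext (K₁ := sphereLambda b) (K₂ := K.cplx n) h

/-- A summand of the inverse of the comparison map. -/
def lamInv (K : GComplex) (b : Orbit n) (p k : ℕ) :
    fixMod n (L b.size K).t ((L b.size K).gr k) ⟶ lamTot K b k :=
  if h : p ≤ k then
    lamProj K b p (k - p : ℕ) k (by push_cast [h]; ring) ≫
      lamι K b p (k - p) k (Nat.add_sub_cancel' h)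
  else 0

lemma lamInv_eq {p q k : ℕ} (h : p + q = k) : lamInv K b p k =
    lamProj K b p q k (by exact_mod_cast h) ≫ lamι K b p q k h := by
  obtain rfl : q = k - p := by omega
  exact dif_pos (by omega)

lemma lamMap_lamInv {p q k : ℕ} (h : p + q = k) :
    lamMap K b p q k (by exact_mod_cast h) ≫ lamInv K b p k = lamι K b p q k h := by
  rw [lamInv_eq h, ← Category.assoc, lamMap_lamProj, Category.id_comp]

lemma lamMap_lamInv_ne {p p' q k : ℕ} (hp : p ≠ p') (h : p + q = k) :
    lamMap K b p q k (by exact_mod_cast h) ≫ lamInv K b p' k = 0 := by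
  by_cases h' : p' ≤ k
  · rw [lamInv_eq (Nat.add_sub_cancel' h'), ← Category.assoc, lamMap_lamProj_ne hp, zero_comp]
  · rw [lamInv, dif_neg h', comp_zero]

/-- With q allowed to be negative the formula covers p > k as well: then `K` vanishes in degree q
and both sides are 0. So the three cells can be added in every degree k. -/
lemma lamInv_lamDesc (p : ℕ) {k : ℕ} {q : ℤ} (h : p + q = k) :
    lamInv K b p k ≫ lamDesc K b k = lamProj K b p q k h ≫ lamMap K b p q k h := by
  by_cases h' : p ≤ k
  · obtain ⟨q, rfl⟩ := Int.eq_ofNat_of_zero_le (a := q) (by omega)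
    have h'' : p + q = k := by exact_mod_cast h
    rw [lamInv_eq h'', Category.assoc, lamι_lamDesc]
  · rw [lamInv, dif_neg h', (((box n).obj (lambdaX b p)).map_isZero
      (fixMod.isZero fun x hx => K.gr_neg (by omega) hx)).eq_of_src (lamMap K b p q k h) 0,
      comp_zero, zero_comp]

lemma isIso_lamDesc (K : GComplex) (b : Orbit n) (k : ℕ) : IsIso (lamDesc K b k) := by
  refine ⟨lamInv K b 0 k + lamInv K b 1 k + lamInv K b 2 k, ?_, ?_⟩
  · refine lamTot_hom_ext fun p q h => ?_
    rw [← Category.assoc, lamι_lamDesc, Preadditive.comp_add, Preadditive.comp_add,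
      Category.comp_id]
    match p, h with
    | 0, h =>
      rw [lamMap_lamInv h, lamMap_lamInv_ne (by decide) h, lamMap_lamInv_ne (by decide) h, add_zero,
        add_zero]
    | 1, h =>
      rw [lamMap_lamInv h, lamMap_lamInv_ne (by decide) h, lamMap_lamInv_ne (by decide) h, add_zero,
        zero_add]
    | 2, h =>
      rw [lamMap_lamInv h, lamMap_lamInv_ne (by decide) h, lamMap_lamInv_ne (by decide) h, add_zero,
        zero_add]
    | p + 3, h => exact (isZero_box_lambdaX b p _).eq_of_src _ _
  · rw [Preadditive.add_comp, Preadditive.add_comp, lamInv_lamDesc 0 (q := k) (by simp),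
      lamInv_lamDesc 1 (q := k - 1) (by simp), lamInv_lamDesc 2 (q := k - 2) (by simp)]
    exact sum_lamProj_lamMap _ _ _

instance (K : GComplex) (b : Orbit n) (k : ℕ) : IsIso ((compare K b).f k) := isIso_lamDesc K b k

/-- The comparison isomorphism of complexes. -/
def compareIso (K : GComplex) (b : Orbit n) :
    boxComplex (sphereLambda b) (K.cplx n) ≅ (L b.size K).cplx n :=
  have : IsIso (compare K b) := Hom.isIso_of_components _
  asIso (compare K b)

end compare

/-! ### The unit complex and the iterated product -/

section point

open GComplex

/-- The generator of the point in the `Θ_1` spot. -/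
def pointElt (n : ℕ) : (fixMod n point.t (point.gr 0)).val (Orbit.one n) :=
  (⟨fun _ => pointOne, fun _ => ⟨rfl, mem_point_gr_zero _⟩⟩ :
    eqvFun point.t (point.gr 0) (Orbit.one n).size)

lemma pointElt_desc {d : Orbit n} (φ : orbitHom d (Orbit.one n)) (x : ZMod d.size) :
    (show eqvFun point.t (point.gr 0) d.size from
      MackeyMod.component (free.desc (pointElt n)) d φ).1 x = φ.1 x 0 • pointOne := by
  change ∑ y, φ.1 x y • pointOne = _
  rw [Fintype.sum_eq_single (0 : ZMod (Orbit.one n).size) fun y hy =>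
    absurd (Subsingleton.elim _ _) hy]

instance (n : ℕ) : IsIso (free.desc (pointElt n)) :=
  MackeyMod.isIso_of_bijective _ fun d => by
    refine ⟨(injective_iff_map_eq_zero _).2 fun φ hφ => Subtype.ext (funext fun x =>
      funext fun y => ?_), fun m => ?_⟩
    · have h := pointElt_desc φ x
      rw [hφ] at h
      rw [Subsingleton.elim y 0]
      exact zsmul_pointOne_eq_zero.1 h.symm
    · let m' : eqvFun point.t (point.gr 0) d.size := m
      refine ⟨(⟨fun x _ => (show ℤ from m'.1 x), fun x _ => (m'.2 x).1⟩ :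
        orbitHom d (Orbit.one n)), Subtype.ext (funext fun x => (pointElt_desc _ x).trans ?_)⟩
      exact mul_one (show ℤ from m'.1 x)

/-- The unit complex is the complex of a point. -/
def pointHom (n : ℕ) : (ChainComplex.single₀ (MackeyMod n)).obj (free.obj (Orbit.one n)) ⟶
    point.cplx n :=
  (ChainComplex.fromSingle₀Equiv _ _).symm (free.desc (pointElt n))

instance (n k : ℕ) : IsIso ((pointHom n).f k) := by
  rcases k with _ | k
  · exact inferInstanceAs (IsIso (free.desc (pointElt n)))
  · have h₁ : IsZero (((ChainComplex.single₀ (MackeyMod n)).obj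
      (free.obj (Orbit.one n))).X (k + 1)) :=
      HomologicalComplex.isZero_single_obj_X _ _ _ _ (by simp)
    have h₂ : IsZero ((point.cplx n).X (k + 1)) :=
      fixMod.isZero (point_gr_eq_zero (by push_cast; omega))
    exact ⟨0, h₁.eq_of_src _ _, h₂.eq_of_src _ _⟩

/-- The unit complex is the complex of a point. -/
def pointIso (n : ℕ) : (ChainComplex.single₀ (MackeyMod n)).obj (free.obj (Orbit.one n)) ≅
    point.cplx n :=
  have : IsIso (pointHom n) := HomologicalComplex.Hom.isIso_of_components _
  asIso (pointHom n)

/-- The isomorphism of box products induced by an isomorphism of the second factors. -/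
def boxComplexIso (X : ChainComplex (MackeyMod n) ℕ) {Y Y' : ChainComplex (MackeyMod n) ℕ}
    (e : Y ≅ Y') : boxComplex X Y ≅ boxComplex X Y' :=
  (((box n).map₂HomologicalComplex (ComplexShape.down ℕ) (ComplexShape.down ℕ)
    (ComplexShape.down ℕ)).obj X).mapIso e

/-- The iterated box product of spheres is given by the iterated construction `L`. -/
def sphereIso : ∀ bs : List (Orbit n), sphere bs ≅ (ofList bs).cplx n
  | [] => pointIso n
  | b :: bs => (boxComplexIso (sphereLambda b) (sphereIso bs)).trans (compareIso (ofList bs) b)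

end point

/-! ### The au-monomials under the comparison isomorphism -/

section au

open GComplex HomologicalComplex

variable {K : GComplex} {b : Orbit n}

/-- The value at the base point of an element of a fixed point module in the `Θ_1` spot. -/
def valOne {A : Type} [AddCommGroup A] {t : A →+ A} {P : AddSubgroup A}
    (m : (fixMod n t P).val (Orbit.one n)) : A :=
  (show eqvFun t P (Orbit.one n).size from m).1 0

lemma boxFun_boxElt {q : ℤ} (φ : Orbit.one n ⟶ b)
    (m : (fixMod n K.t (K.gr q)).val (Orbit.one n)) (w : ZMod b.size) :
    (show eqvFun (K.funT b.size) (funGr K b.size q) (Orbit.one n).size from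
      MackeyMod.component (boxFree K q b) (Orbit.one n) (boxElt (free.elt φ) m)).1 0 w =
        (show orbitHom (Orbit.one n) b from φ).1 0 w • valOne m := by
  refine (congrArg (fun f : eqvFun (K.funT b.size) (funGr K b.size q) (Orbit.one n).size =>
    f.1 0 w) (boxFreeHom_mk (K := K) (q := q) _ φ m)).trans ?_
  change ∑ y : ZMod (Orbit.one n).size, ∑ z : ZMod (Orbit.one n).size,
    (1 * (show orbitHom (Orbit.one n) b from φ).1 y w) •
      (show eqvFun K.t (K.gr q) (Orbit.one n).size from m).1 z = _
  rw [Fintype.sum_eq_single (0 : ZMod (Orbit.one n).size) fun y hy =>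
    absurd (Subsingleton.elim _ _) hy, Fintype.sum_eq_single (0 : ZMod (Orbit.one n).size)
    fun y hy => absurd (Subsingleton.elim _ _) hy, one_mul]
  rfl

lemma lamMap_aChain {q k : ℤ} (h : (0 : ℕ) + q = k)
    (m : (fixMod n K.t (K.gr q)).val (Orbit.one n)) :
    valOne (MackeyMod.component (lamMap K b 0 q k h) (Orbit.one n) (boxElt (aChain b) m)) =
      aMul b.size K (valOne m) := by
  refine Eq.trans (congrArg (fun x => (tri x 0 0 : (L b.size K).A))
    (boxFun_boxElt (𝟙 (Orbit.one n)) m 0)) ?_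
  exact tri_congr (one_smul ℤ _) (fun _ => rfl) (fun _ => rfl)

lemma lamMap_uChain {q k : ℤ} (h : (2 : ℕ) + q = k)
    (m : (fixMod n K.t (K.gr q)).val (Orbit.one n)) :
    valOne (MackeyMod.component (lamMap K b 2 q k h) (Orbit.one n) (boxElt (uChain b) m)) =
      uMul b.size K (valOne m) := by
  refine Eq.trans (congrArg (fun x => (tri 0 0 x : (L b.size K).A))
    (funext fun w => boxFun_boxElt (Ipi b) m w)) ?_
  refine tri_congr rfl (fun _ => rfl) (fun w => ?_)
  change (if (0 : ZMod (Orbit.one n).size) = 0 then (1 : ℤ) else 0) • valOne m = valOne m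
  rw [if_pos rfl, one_smul]

/-- The isomorphism is the box product with the previous one followed by the comparison map, and
both are known on each summand of the total complex. -/
lemma sphereIso_chainMul {bs : List (Orbit n)} {p q k : ℕ} (h : p + q = k)
    (x : ((sphereLambda b).X p).val (Orbit.one n)) (z : ((sphere bs).X q).val (Orbit.one n)) :
    MackeyMod.component ((sphereIso (b :: bs)).hom.f k) _ (chainMul h x z) =
      MackeyMod.component (lamMap (ofList bs) b p q k (by exact_mod_cast h)) _
        (boxElt x (MackeyMod.component ((sphereIso bs).hom.f q) _ z)) := by
  have h₁ : (boxComplexIso (sphereLambda b) (sphereIso bs)).hom =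
    mapBifunctorMap (𝟙 (sphereLambda b)) (sphereIso bs).hom (box n) (ComplexShape.down ℕ) := rfl
  have h₂ := ι_mapBifunctorMap (𝟙 (sphereLambda b)) (sphereIso bs).hom (box n)
    (ComplexShape.down ℕ) p q k h
  rw [← h₁] at h₂
  have h₃ := congrArg (fun f => MackeyMod.component (f ≫ (compare (ofList bs) b).f k)
    (Orbit.one n) (boxElt x z)) h₂
  refine Eq.trans h₃ ?_
  have h₄ := ι_compare (K := ofList bs) (b := b) h
  refine Eq.trans (congrArg (fun f => MackeyMod.component f (Orbit.one n)
    (MackeyMod.component (boxMap ((𝟙 (sphereLambda b) : _ ⟶ _).f p) (𝟙 _) ≫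
      boxMap (𝟙 _) ((sphereIso bs).hom.f q)) (Orbit.one n) (boxElt x z))) h₄) ?_
  refine congrArg (MackeyMod.component (lamMap (ofList bs) b p q k _) (Orbit.one n)) ?_
  refine (congrArg (MackeyMod.component (boxMap (𝟙 _) ((sphereIso bs).hom.f q)) (Orbit.one n))
    (boxMap_mk ..)).trans ?_
  exact boxMap_mk ..

lemma nonneg_of_mem_auSet (bs : List (Orbit n)) {k : ℤ} {x} (hx : x ∈ auSet bs k) : 0 ≤ k := by
  induction bs generalizing k with
  | nil => exact hx.1.ge
  | cons b bs ih =>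
    obtain ⟨x, hx, rfl⟩ | ⟨x, hx, rfl⟩ := hx
    · exact ih hx
    · have := ih hx; omega

lemma exists_isAUChain (bs : List (Orbit n)) {k : ℕ} {x} (hx : x ∈ auSet bs k) :
    ∃ z, IsAUChain bs k z ∧
      valOne (MackeyMod.component ((sphereIso bs).hom.f k) (Orbit.one n) z) = x := by
  induction bs generalizing k with
  | nil =>
    obtain ⟨hk, rfl⟩ := hx
    obtain rfl : k = 0 := by exact_mod_cast hk
    refine ⟨_, .nil, ?_⟩
    let φ : Orbit.one n ⟶ Orbit.one n := 𝟙 (Orbit.one n)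
    exact Eq.trans (pointElt_desc (show orbitHom (Orbit.one n) (Orbit.one n) from φ) 0)
      (one_smul ℤ _)
  | cons b bs ih =>
    obtain ⟨x, hx, rfl⟩ | ⟨x, hx, rfl⟩ := hx
    · obtain ⟨z, hz, rfl⟩ := ih hx
      refine ⟨_, .a hz, ?_⟩
      rw [sphereIso_chainMul]
      exact lamMap_aChain _ _
    -- Products of classes have nonnegative degree, so a u_b-multiple has degree at least 2.
    · obtain ⟨k, rfl⟩ : ∃ k', k = k' + 2 := ⟨k - 2, by
        have := nonneg_of_mem_auSet bs hx; omega⟩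
      obtain ⟨z, hz, rfl⟩ := ih (k := k) (by
        rwa [show ((k + 2 : ℕ) : ℤ) - 2 = k by push_cast; ring] at hx)
      refine ⟨_, .u hz, ?_⟩
      rw [sphereIso_chainMul]
      exact lamMap_uChain _ _

end au

/-! ## Homology in terms of elements -/

namespace MackeyMod

variable {M N : MackeyMod n}

lemma act_id {d : Orbit n} (x : M.val d) : M.act (𝟙 d) x = x :=
  ConcreteCategory.congr_hom (M.obj.map_id (op d)) x

lemma act_comp {a b c : Orbit n} (φ : a ⟶ b) (ψ : b ⟶ c) (x : M.val c) :
    M.act (φ ≫ ψ) x = M.act φ (M.act ψ x) :=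
  ConcreteCategory.congr_hom (M.obj.map_comp ψ.op φ.op) x

lemma act_add {a b : Orbit n} (φ ψ : a ⟶ b) (x : M.val b) :
    M.act (φ + ψ) x = M.act φ x + M.act ψ x :=
  ConcreteCategory.congr_hom (M.property.map_add (f := φ.op) (g := ψ.op)) x

/-- The action on an element, as a homomorphism. -/
def actHom (a : Orbit n) {b : Orbit n} (x : M.val b) : (a ⟶ b) →+ M.val a :=
  AddMonoidHom.mk' (fun φ => M.act φ x) fun φ ψ => act_add φ ψ x

lemma act_zsmul {a b : Orbit n} (m : ℤ) (φ : a ⟶ b) (x : M.val b) :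
    M.act (m • φ) x = m • M.act φ x :=
  map_zsmul (actHom a x) m φ

lemma desc_id {d : Orbit n} (x : M.val d) :
    component (free.desc x) d (free.elt (𝟙 d)) = x := act_id x

lemma free_hom_ext {d : Orbit n} {f g : free.obj d ⟶ M}
    (h : component f d (free.elt (𝟙 d)) = component g d (free.elt (𝟙 d))) : f = g :=
  hom_ext' fun a φ => by
    have e : (free.obj d).act (show a ⟶ d from φ) (free.elt (𝟙 d)) = φ :=
      Category.comp_id (show a ⟶ d from φ)
    rw [← e, component_act, component_act, h]

/-- Elements of `M.val d` are maps from the free module F_d, by Yoneda. -/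
lemma injective_of_mono (f : M ⟶ N) [Mono f] (d : Orbit n) : Function.Injective (component f d) :=
  (injective_iff_map_eq_zero _).2 fun x hx => by
    have h : free.desc x ≫ f = 0 := free_hom_ext (by rw [component_comp, desc_id, hx]; rfl)
    have h' : free.desc x = 0 := zero_of_comp_mono f h
    rw [← desc_id x, h']
    rfl

/-- The inclusion of additive functors into all functors preserves epimorphisms, and these are
tested pointwise. -/
lemma surjective_of_epi (f : M ⟶ N) [Epi f] (d : Orbit n) :
    Function.Surjective (component f d) := by
  have h₁ : Epi ((ObjectProperty.ι _).map f) := inferInstance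
  have h₂ : Epi (((ObjectProperty.ι _).map f).app (op d)) := inferInstance
  exact (AddCommGrpCat.epi_iff_surjective _).1 h₂

instance (d : Orbit n) : Projective (free.obj d) where
  factors {M N} f e _ := by
    obtain ⟨y, hy⟩ := surjective_of_epi e d (component f d (free.elt (𝟙 d)))
    exact ⟨free.desc y, free_hom_ext (by rw [component_comp, desc_id, hy])⟩

variable {C : ChainComplex (MackeyMod n) ℕ} {k : ℕ} {d : Orbit n}

lemma exists_cycle (x : (C.X k).val d)
    (hx : component (C.d k ((ComplexShape.down ℕ).next k)) d x = 0) :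
    ∃ w : (C.cycles k).val d, component (C.iCycles k) d w = x := by
  have h : free.desc x ≫ C.d k _ = 0 := free_hom_ext (by rw [component_comp, desc_id, hx]; rfl)
  refine ⟨component (C.liftCycles (free.desc x) _ rfl h) d (free.elt (𝟙 d)), ?_⟩
  rw [← component_comp, HomologicalComplex.liftCycles_i, desc_id]

lemma d_iCycles (w : (C.cycles k).val d) (j : ℕ) :
    component (C.d k j) d (component (C.iCycles k) d w) = 0 := by
  rw [← component_comp, HomologicalComplex.iCycles_d]
  rfl

/-- The class `w`, viewed as a map from the projective F_d, lifts through the exact sequence of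
chains, cycles and homology. -/
lemma homologyπ_eq_zero_iff (w : (C.cycles k).val d) :
    component (C.homologyπ k) d w = 0 ↔ ∃ y, component (C.toCycles (k + 1) k) d y = w := by
  constructor
  · intro hw
    have hS := ShortComplex.exact_of_g_is_cokernel
      (ShortComplex.mk _ _ (C.toCycles_comp_homologyπ (k + 1) k))
      (C.homologyIsCokernel (k + 1) k (by simp))
    have h : free.desc w ≫ C.homologyπ k = 0 :=
      free_hom_ext (by rw [component_comp, desc_id, hw]; rfl)
    refine ⟨component (hS.liftFromProjective (free.desc w) h) d (free.elt (𝟙 d)), ?_⟩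
    have h' := hS.liftFromProjective_comp (free.desc w) h
    have h'' := congrArg (fun f => component f d (free.elt (𝟙 d))) h'
    exact h''.trans (desc_id w)
  · rintro ⟨y, rfl⟩
    rw [← component_comp, HomologicalComplex.toCycles_comp_homologyπ]
    rfl

end MackeyMod

/-! ### Equivariant functions on Θ_d and elements fixed by `t ^ d` -/

section eqvFun

variable {A : Type} [AddCommGroup A] {t : A →+ A} {P : AddSubgroup A} {d : ℕ}

lemma eqvFun_natCast (m : eqvFun t P d) (i : ℕ) : m.1 i = t^[i] (m.1 0) := by
  induction i with
  | zero => simp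
  | succ i ih => rw [Nat.cast_succ, (m.2 _).1, ih, Function.iterate_succ_apply']

lemma eqvFun_ext [NeZero d] {m m' : eqvFun t P d} (h : m.1 0 = m'.1 0) : m = m' :=
  Subtype.ext (funext fun y => by
    rw [← ZMod.natCast_zmod_val y, eqvFun_natCast, eqvFun_natCast, h])

lemma eqvFun_zero_mem {K : GComplex} {k : ℤ} (m : eqvFun K.t (K.gr k) d) : m.1 0 ∈ K.F k d :=
  ⟨(m.2 0).2, by rw [← eqvFun_natCast, ZMod.natCast_self]⟩

lemma exists_eqvFun [NeZero d] {K : GComplex} {k : ℤ} {x : K.A} (hx : x ∈ K.F k d) :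
    ∃ m : eqvFun K.t (K.gr k) d, m.1 0 = x := by
  refine ⟨⟨fun y => K.t^[y.val] x, fun y => ⟨?_, K.iterate_t_mem hx.1 _⟩⟩, by simp⟩
  beta_reduce
  rw [← Function.iterate_succ_apply' K.t]
  refine iterate_eq_of_modEq hx.2 ?_
  rw [← ZMod.natCast_eq_natCast_iff, ZMod.natCast_zmod_val, Nat.cast_succ, ZMod.natCast_zmod_val]

end eqvFun

/-! ### Cycles and boundaries in terms of fixed elements -/

section cycleVal

open MackeyMod GComplex

variable {K : GComplex} {C : ChainComplex (MackeyMod n) ℕ} (α : C ≅ K.cplx n) {k : ℕ} {d : Orbit n}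

/-- The value at the base point of a chain. -/
def chainVal (k : ℕ) (d : Orbit n) : (C.X k).val d →+ K.A where
  toFun z := (show eqvFun K.t (K.gr k) d.size from component (α.hom.f k) d z).1 0
  map_zero' := by
    rw [map_zero]; rfl
  map_add' x y := by
    rw [map_add]; rfl

lemma chainVal_injective : Function.Injective (chainVal α k d) := fun x y h => by
  have h' : component (α.hom.f k) d x = component (α.hom.f k) d y := eqvFun_ext h
  exact injective_of_mono (α.hom.f k) d h'

lemma chainVal_mem (z : (C.X k).val d) : chainVal α k d z ∈ K.F k d.size := eqvFun_zero_mem _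

lemma exists_chainVal {x : K.A} (hx : x ∈ K.F k d.size) : ∃ z, chainVal α k d z = x := by
  obtain ⟨m, rfl⟩ := exists_eqvFun hx
  obtain ⟨z, hz⟩ := surjective_of_epi (α.hom.f k) d m
  exact ⟨z, congrArg (fun m : eqvFun K.t (K.gr k) d.size => m.1 0) hz⟩

lemma chainVal_d (z : (C.X (k + 1)).val d) :
    chainVal α k d (component (C.d (k + 1) k) d z) = K.d (chainVal α (k + 1) d z) := by
  have h : component (α.hom.f k) d (component (C.d (k + 1) k) d z) =
      component (K.diff n (by push_cast; ring)) d (component (α.hom.f (k + 1)) d z) := by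
    rw [← component_comp, ← α.hom.comm, cplx_d]
    rfl
  exact congrArg (fun m : eqvFun K.t (K.gr k) d.size => m.1 0) h

/-- In terms of values at the base point, restriction from Θ_1 to Θ_d is the inclusion of `t`-fixed
elements into `t ^ d`-fixed ones. -/
lemma chainVal_act_Rpi (z : (C.X k).val (Orbit.one n)) :
    chainVal α k d ((C.X k).act (Rpi d) z) = chainVal α k (Orbit.one n) z := by
  have h := component_act (α.hom.f k) (Rpi d) z
  refine (congrArg (fun m : eqvFun K.t (K.gr k) d.size => m.1 0) h).trans ?_
  change ∑ y : ZMod (Orbit.one n).size, (if (0 : ZMod (Orbit.one n).size) = y then (1 : ℤ) else 0) •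
    (show eqvFun K.t (K.gr k) (Orbit.one n).size from component (α.hom.f k) _ z).1 y = _
  rw [Fintype.sum_eq_single (0 : ZMod (Orbit.one n).size) fun y hy =>
    absurd (Subsingleton.elim _ _) hy, if_pos rfl, one_smul]
  rfl

/-- The value at the base point of a cycle. -/
def cycleVal (k : ℕ) (d : Orbit n) : (C.cycles k).val d →+ K.A :=
  (chainVal α k d).comp (component (C.iCycles k) d)

lemma cycleVal_injective : Function.Injective (cycleVal α k d) :=
  (chainVal_injective α).comp (injective_of_mono _ _)

lemma cycleVal_mem (w : (C.cycles k).val d) : cycleVal α k d w ∈ K.Z k d.size := by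
  refine ⟨chainVal_mem α _, ?_⟩
  change K.d (cycleVal α k d w) = 0
  rcases k with _ | k
  -- In degree 0 the differential of `K` lands in degree -1, which is zero.
  · exact K.gr_neg (by simp) (K.d_mem (chainVal_mem α _).1)
  · exact (chainVal_d α _).symm.trans ((congrArg _ (d_iCycles w k)).trans (map_zero _))

lemma exists_cycle_of_chainVal_mem {z : (C.X k).val d} (hz : chainVal α k d z ∈ K.Z k d.size) :
    ∃ w, component (C.iCycles k) d w = z := by
  refine exists_cycle z ?_
  rcases k with _ | k
  · rw [C.shape _ _ (by simp)]
    rfl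
  · rw [ChainComplex.next_nat_succ]
    exact chainVal_injective α ((chainVal_d α z).trans (hz.2.trans (map_zero _).symm))

lemma exists_cycleVal {x : K.A} (hx : x ∈ K.Z k d.size) : ∃ w, cycleVal α k d w = x := by
  obtain ⟨z, rfl⟩ := exists_chainVal α hx.1
  obtain ⟨w, rfl⟩ := exists_cycle_of_chainVal_mem α hx
  exact ⟨w, rfl⟩

lemma homologyπ_eq_zero_iff_cycleVal_mem (w : (C.cycles k).val d) :
    component (C.homologyπ k) d w = 0 ↔ cycleVal α k d w ∈ K.B k d.size := by
  have key (y : (C.X (k + 1)).val d) : cycleVal α k d (component (C.toCycles (k + 1) k) d y) =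
      K.d (chainVal α (k + 1) d y) := by
    rw [← chainVal_d]
    refine congrArg (chainVal α k d) ?_
    rw [← component_comp, HomologicalComplex.toCycles_i]
  rw [homologyπ_eq_zero_iff]
  constructor
  · rintro ⟨y, rfl⟩
    rw [key]
    have h := chainVal_mem α y
    push_cast at h
    exact ⟨_, h, rfl⟩
  · rintro ⟨v, hv, hv'⟩
    obtain ⟨y, rfl⟩ := exists_chainVal α (k := k + 1) (d := d) (by push_cast; exact hv)
    exact ⟨y, cycleVal_injective α ((key y).trans hv')⟩

lemma cycleVal_act_Rpi (w : (C.cycles k).val (Orbit.one n)) :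
    cycleVal α k d ((C.cycles k).act (Rpi d) w) = cycleVal α k (Orbit.one n) w := by
  refine Eq.trans ?_ (chainVal_act_Rpi α (d := d) _)
  exact congrArg (chainVal α k d) (component_act (C.iCycles k) (Rpi d) w)

end cycleVal

/-! ## Quotients of the constant Mackey functor -/

section constZ

open MackeyMod

/-- A morphism to Θ_1 is a matrix with one constant column, hence is determined by its row sum. This
makes `constZ.desc` natural. -/
lemma comp_Rpi {a b : Orbit n} (φ : a ⟶ b) : φ ≫ Rpi b = degree φ • Rpi a :=
  Subtype.ext <| by
    funext x z
    change ∑ y, (show orbitHom a b from φ).1 x y * (if (0 : ZMod (Orbit.one n).size) = z then 1 else 0)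
      = degree φ * if (0 : ZMod (Orbit.one n).size) = z then 1 else 0
    rw [← Finset.sum_mul, row_sum]
    rfl

/-- The map from the constant Mackey functor given by an element in the `Θ_1` spot. -/
def constZ.desc {M : MackeyMod n} (c : M.val (Orbit.one n)) : constZ n ⟶ M :=
  ObjectProperty.homMk
    { app := fun d => AddCommGrpCat.ofHom
        { toFun := fun m : ℤ => m • M.act (Rpi d.unop) c
          map_zero' := zero_smul _ _
          map_add' := fun _ _ => add_smul _ _ _ }
      naturality := fun a b φ => by
        refine AddCommGrpCat.hom_ext (AddMonoidHom.ext fun m : ℤ => ?_)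
        change (degree φ.unop * m) • M.act (Rpi b.unop) c =
          M.act φ.unop (m • M.act (Rpi a.unop) c)
        rw [map_zsmul, ← act_comp, comp_Rpi, act_zsmul, smul_smul, mul_comm] }

/-- The greatest common divisor of two orbits. -/
def Orbit.gcd (c d : Orbit n) : Orbit n :=
  ⟨c.size.gcd d.size, (Nat.gcd_dvd_left _ _).trans c.dvd, Nat.gcd_pos_of_pos_left _ c.pos⟩

/-- Go from Θ_d to Θ_{gcd(c,d)} by the projection, of degree 1, and then to Θ_c by the `I` of the
projection, whose degree is the fibre size c/gcd(c,d). Hence I_c at Θ_d contains all multiples of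
`quotOrder c d`. -/
lemma exists_degree_eq (d c : Orbit n) : ∃ φ : d ⟶ c, degree φ = quotOrder c.size d.size := by
  let f : ZMod d.size →+* ZMod (c.gcd d).size := ZMod.castHom (Nat.gcd_dvd_right _ _) _
  let f' : ZMod c.size →+* ZMod (c.gcd d).size := ZMod.castHom (Nat.gcd_dvd_left _ _) _
  let ρ : d ⟶ c.gcd d := R f fun x => by rw [map_add, map_one]
  let τ : c.gcd d ⟶ c := I f' fun x => by rw [map_add, map_one]
  have hρ : degree ρ = 1 := by
    change ∑ y, (if f 0 = y then (1 : ℤ) else 0) = 1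
    simp
  -- All rows of τ have the same sum, and together the rows count the points of Θ_c once each.
  have hτ : ((c.gcd d).size : ℤ) * degree τ = c.size := by
    have h₁ : ∑ y : ZMod (c.gcd d).size, ∑ x : ZMod c.size, (if f' x = y then (1 : ℤ) else 0) =
        c.size := by
      rw [Finset.sum_comm]
      simp
    refine Eq.trans ?_ h₁
    refine Eq.trans ?_ (Finset.sum_congr rfl fun y _ =>
      row_sum (show orbitHom (c.gcd d) c from τ) y).symm
    rw [Finset.sum_const, Finset.card_univ, ZMod.card, nsmul_eq_mul]
    rfl
  refine ⟨ρ ≫ τ, ?_⟩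
  rw [degree_comp, hρ, one_mul, quotOrder, Int.natCast_div]
  exact (Int.ediv_eq_of_eq_mul_right (by exact_mod_cast (c.gcd d).pos.ne') hτ.symm).symm

/-- The map `F_c → ℤ` whose image is the ideal `I_c`. -/
def idealI.gen (c : Orbit n) : free.obj c ⟶ constZ n := free.desc (M := constZ n) (1 : ℤ)

/-- The epimorphism from `F_c` to the ideal `I_c`. -/
def idealI.proj (c : Orbit n) : free.obj c ⟶ idealI c := factorThruImage (idealI.gen c)

lemma idealI.proj_incl (c : Orbit n) : idealI.proj c ≫ idealI.incl c = idealI.gen c :=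
  image.fac _

instance (c : Orbit n) : Epi (idealI.proj c) :=
  inferInstanceAs (Epi (factorThruImage (idealI.gen c)))

lemma idealI.gen_id (c : Orbit n) :
    component (idealI.gen c) c (free.elt (𝟙 c)) = (1 : ℤ) := desc_id (M := constZ n) _

lemma exists_gen_eq {c d : Orbit n} {m : ℤ} (h : (quotOrder c.size d.size : ℤ) ∣ m) :
    ∃ φ, component (idealI.gen c) d φ = m := by
  obtain ⟨φ, hφ⟩ := exists_degree_eq d c
  obtain ⟨r, rfl⟩ := h
  refine ⟨r • free.elt φ, ?_⟩
  rw [map_zsmul]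
  change r * (degree φ * 1) = _
  rw [hφ, mul_one, mul_comm]

variable {M : MackeyMod n} {x : M.val (Orbit.one n)}

lemma surjective_constZ_desc (h : ∀ d (y : M.val d), ∃ m : ℤ, y = m • M.act (Rpi d) x) (d : Orbit n) :
    Function.Surjective (component (constZ.desc x) d) := fun y => by
  obtain ⟨m, rfl⟩ := h d y
  exact ⟨m, rfl⟩

lemma nonempty_iso_constZ (h : ∀ d (y : M.val d), ∃ m : ℤ, y = m • M.act (Rpi d) x)
    (h' : ∀ d (m : ℤ), m • M.act (Rpi d) x = 0 → m = 0) : Nonempty (M ≅ constZ n) := by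
  have : IsIso (constZ.desc x) := isIso_of_bijective _ fun d =>
    ⟨(injective_iff_map_eq_zero _).2 (h' d), surjective_constZ_desc h d⟩
  exact ⟨(asIso (constZ.desc x)).symm⟩

/-- The map ℤ → M given by x kills the generator of I_c, because the order at Θ_c itself is 1.
Conversely, whatever it kills at Θ_d is a multiple of `quotOrder c d`, and such multiples lie in I_c
by `exists_gen_eq`. -/
lemma nonempty_iso_quotI {c : Orbit n} (h : ∀ d (y : M.val d), ∃ m : ℤ, y = m • M.act (Rpi d) x)
    (h' : ∀ d (m : ℤ), m • M.act (Rpi d) x = 0 ↔ (quotOrder c.size d.size : ℤ) ∣ m) :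
    Nonempty (M ≅ quotI c) := by
  have h₁ : idealI.incl c ≫ constZ.desc x = 0 := by
    rw [← cancel_epi (idealI.proj c), comp_zero, ← Category.assoc, idealI.proj_incl]
    refine free_hom_ext ?_
    rw [component_comp, idealI.gen_id]
    exact (h' c 1).2 (by rw [quotOrder_self_eq_one c.pos]; simp)
  have : IsIso (cokernel.desc (idealI.incl c) (constZ.desc x) h₁) :=
    isIso_of_bijective _ fun d => by
      have hπ (m : (constZ n).val d) : component (cokernel.desc (idealI.incl c) (constZ.desc x) h₁) d
          (component (cokernel.π (idealI.incl c)) d m) = component (constZ.desc x) d m := by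
        rw [← component_comp, cokernel.π_desc]
      refine ⟨(injective_iff_map_eq_zero _).2 fun y hy => ?_, fun y => ?_⟩
      · obtain ⟨m, rfl⟩ := surjective_of_epi (cokernel.π (idealI.incl c)) d y
        rw [hπ] at hy
        obtain ⟨φ, hφ⟩ := exists_gen_eq ((h' d m).1 hy)
        rw [← hφ, ← idealI.proj_incl, component_comp, ← component_comp (idealI.incl c),
          cokernel.condition]
        rfl
      · obtain ⟨m, hm⟩ := surjective_constZ_desc h d y
        exact ⟨_, (hπ m).trans hm⟩
  exact ⟨(asIso (cokernel.desc (idealI.incl c) (constZ.desc x) h₁)).symm⟩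

end constZ

/-! ### The homology modules and their generators -/

section homology

open MackeyMod GComplex

variable {K : GComplex} {C : ChainComplex (MackeyMod n) ℕ} (α : C ≅ K.cplx n) {k : ℕ}

include α in
lemma isZero_homology (h : K.Acyclic k) : IsZero (C.homology k) :=
  isZero_of_eq_zero fun d y => by
    obtain ⟨w, rfl⟩ := surjective_of_epi (C.homologyπ k) d y
    exact (homologyπ_eq_zero_iff_cycleVal_mem α w).2 (h _ d.pos (cycleVal_mem α w))

include α in
lemma exists_generator {c : ℕ} {x : K.A} (h : K.Gen k c x) : ∃ y : (C.homology k).val (Orbit.one n),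
    (∀ d (z : (C.homology k).val d), ∃ m : ℤ, z = m • (C.homology k).act (Rpi d) y) ∧
    ∀ (d : Orbit n) (m : ℤ), m • (C.homology k).act (Rpi d) y = 0 ↔ (quotOrder c d.size : ℤ) ∣ m := by
  obtain ⟨w, hw⟩ := exists_cycleVal α (d := Orbit.one n) h.mem
  have hπ (d : Orbit n) (m : ℤ) : m • (C.homology k).act (Rpi d) (component (C.homologyπ k) _ w) =
      component (C.homologyπ k) d (m • (C.cycles k).act (Rpi d) w) := by
    rw [map_zsmul, component_act]
  have hv (d : Orbit n) (m : ℤ) : cycleVal α k d (m • (C.cycles k).act (Rpi d) w) = m • x := by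
    rw [map_zsmul, cycleVal_act_Rpi, hw]
  refine ⟨component (C.homologyπ k) _ w, fun d z => ?_, fun d m => ?_⟩
  · obtain ⟨v, rfl⟩ := surjective_of_epi (C.homologyπ k) d z
    obtain ⟨m, hm⟩ := h.gen _ d.pos _ (cycleVal_mem α v)
    refine ⟨m, ?_⟩
    rw [hπ, ← sub_eq_zero, ← map_sub, homologyπ_eq_zero_iff_cycleVal_mem α, map_sub, hv]
    exact hm
  · rw [hπ, homologyπ_eq_zero_iff_cycleVal_mem α, hv]
    exact h.zsmul_mem _ d.pos m

/-- A submodule containing the au-classes contains their restrictions along π to Θ_d, and by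
`ofList_generated` integer combinations of these exhaust the homology at Θ_d. -/
lemma generatedBy_auClasses (bs : List (Orbit n)) (k : ℕ) :
    GeneratedBy ((sphere bs).homology k) (auClasses bs k) := by
  intro P i _ hi
  let α := sphereIso bs
  refine isIso_of_bijective i fun d => ⟨injective_of_mono i d, fun y => ?_⟩
  obtain ⟨w, rfl⟩ := surjective_of_epi ((sphere bs).homologyπ k) d y
  obtain ⟨a, ha, β, hβ, hw⟩ := AddSubgroup.mem_sup.1
    (ofList_generated bs k d.size d.pos (cycleVal_mem α w))
  obtain ⟨w', hw', p, hp⟩ : ∃ w', cycleVal α k d w' = a ∧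
      ∃ p, component i d p = component ((sphere bs).homologyπ k) d w' := by
    refine AddSubgroup.closure_induction (fun x hx => ?_) ?_ (fun x y _ _ hx hy => ?_)
      (fun x _ hx => ?_) ha
    · obtain ⟨z, hz, rfl⟩ := exists_isAUChain bs hx
      obtain ⟨v, hv⟩ := exists_cycle_of_chainVal_mem α (z := z) (auSet_subset_Z bs k hx)
      obtain ⟨p, hp⟩ := hi _ ⟨z, hz, v, hv, rfl⟩
      refine ⟨((sphere bs).cycles k).act (Rpi d) v, ?_, P.act (Rpi d) p, ?_⟩
      · rw [cycleVal_act_Rpi]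
        exact congrArg (chainVal α k _) hv
      · rw [component_act, component_act, hp]
    · exact ⟨0, map_zero _, 0, by rw [map_zero, map_zero]⟩
    · obtain ⟨v, rfl, p, hp⟩ := hx
      obtain ⟨v', rfl, p', hp'⟩ := hy
      exact ⟨v + v', map_add _ _ _, p + p', by rw [map_add, map_add, hp, hp']⟩
    · obtain ⟨v, rfl, p, hp⟩ := hx
      exact ⟨-v, map_neg _ _, -p, by rw [map_neg, map_neg, hp]⟩
  refine ⟨p, ?_⟩
  rw [hp, ← sub_eq_zero, ← map_sub, homologyπ_eq_zero_iff_cycleVal_mem α, map_sub, hw', ← hw,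
    sub_add_cancel_left]
  exact neg_mem hβ

end homology

end CyclicMackey

end

/-! ### The main theorem -/

theorem mainTheorem1 (n : ℕ) (hn : Odd n) (s : ℕ) (b : Fin s → ℕ) (hb : ∀ i, b i ∣ n) :
    let bs : List (CyclicMackey.Orbit n) :=
      List.ofFn fun i => CyclicMackey.Orbit.ofDvd hn (hb i)
    let S : ChainComplex (CyclicMackey.MackeyMod n) ℕ := CyclicMackey.sphere bs
    (∀ k : ℕ, Odd k → IsZero (S.homology k)) ∧
    (∀ k : ℕ, 2 * s < k → IsZero (S.homology k)) ∧
    Nonempty (S.homology (2 * s) ≅ CyclicMackey.constZ n) ∧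
    (∀ (i : ℕ) (hi : i < s), Nonempty (S.homology (2 * i) ≅
      CyclicMackey.quotI (CyclicMackey.Orbit.ofDvd hn
        (CyclicMackey.lcmGcd_dvd (j := i + 1) hb hi)))) ∧
    ∀ k : ℕ, CyclicMackey.GeneratedBy (S.homology k) (CyclicMackey.auClasses bs k) := by
  intro bs S
  have hs : bs.length = s := List.length_ofFn
  have hsize : bs.map CyclicMackey.Orbit.size = List.ofFn b := List.map_ofFn ..
  have hgen (j : ℕ) (hj : j ≤ s) : ∃ y : (S.homology (2 * j)).val (CyclicMackey.Orbit.one n),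
      (∀ d (z : (S.homology (2 * j)).val d),
        ∃ m : ℤ, z = m • (S.homology (2 * j)).act (CyclicMackey.Rpi d) y) ∧
      ∀ (d : CyclicMackey.Orbit n) (m : ℤ), m • (S.homology (2 * j)).act (CyclicMackey.Rpi d) y = 0 ↔
        (CyclicMackey.quotOrder (CyclicMackey.lcmGcd b (j + 1)) d.size : ℤ) ∣ m := by
    obtain ⟨x, hx⟩ := (CyclicMackey.GComplex.ofList_homology bs).2.1 j (hj.trans hs.ge)
    rw [hsize, ← CyclicMackey.lcmGcd_eq_lcmGcdList] at hx
    exact CyclicMackey.exists_generator (CyclicMackey.sphereIso bs) (by exact_mod_cast hx)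
  refine ⟨fun k hk => ?_, fun k hk => ?_, ?_, fun i hi => ?_,
    CyclicMackey.generatedBy_auClasses bs⟩
  · exact CyclicMackey.isZero_homology (CyclicMackey.sphereIso bs)
      ((CyclicMackey.GComplex.ofList_homology bs).1 k (by exact_mod_cast hk))
  · exact CyclicMackey.isZero_homology (CyclicMackey.sphereIso bs)
      (CyclicMackey.GComplex.acyclic_of_eq_zero
        (CyclicMackey.GComplex.ofList_gr_eq_zero bs (by rw [hs]; exact_mod_cast hk)))
  · obtain ⟨y, hy, hy'⟩ := hgen s le_rfl
    refine CyclicMackey.nonempty_iso_constZ hy fun d m hm => ?_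
    have h := (hy' d m).1 hm
    -- There are no s + 1 distinct indices, so the gcd is over an empty family and the generator has
    -- infinite order at every Θ_d.
    have h₀ : CyclicMackey.lcmGcd b (s + 1) = 0 := by
      rw [CyclicMackey.lcmGcd_eq_lcmGcdList]
      exact CyclicMackey.lcmGcdList_eq_zero _ (by rw [List.length_ofFn]; exact Nat.lt_succ_self s)
    rw [h₀, CyclicMackey.quotOrder_zero] at h
    simpa using h
  · obtain ⟨y, hy, hy'⟩ := hgen i hi.le
    exact CyclicMackey.nonempty_iso_quotI hy hy'
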